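/- Let $M\subset\mathbb R^3$ be a smooth compact surface, diffeomorphic to $S^2$, with everywhere positive Gauss curvature and invariant under the rotations about the $x_3$-axis; let $X_3$ be the vector field generating the $2\pi$-periodic rotation, $\nu$ the outward unit normal, $Jv=\nu\times v$ the rotation by $90^\circ$ in the tangent planes, $dS$ the area measure, and $\nabla$, $\Delta$ the gradient and the Laplace-Beltrami operator of $M$. Put $\chi=e_3\cdot\nu$, and let $\xi\in C^\infty(M)$ satisfy $J\nabla\xi=-X_3$, with $\alpha_0=\min_M\xi$ and $\alpha_1=\max_M\xi$. Let $\Omega\in\mathbb R$, let $f\in C^\infty(M)$ be real and zonal ($X_3f=0$), so that $f=f(\xi)$ is a function of $\xi\in[\alpha_0,\alpha_1]$ with derivative $f'(\xi)$, and put $w=\Delta f$. On $L^2_b(M)=\{\zeta\in L^2(M):\int_M\zeta\,dS=0\}$ (complex valued functions) let $\Delta^{-1}$ be the inverse of $\Delta$ with range in $L^2_b(M)$, and let $$\Gamma\zeta=-\nabla_{J\nabla f}\,\zeta+\nabla_{J\nabla(w-\Omega\chi)}\,\Delta^{-1}\zeta$$ be the vorticity equation operator linearized at the stationary flow $u=J\nabla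 f$, with derivatives in the weak sense and domain $\{\zeta\in L^2_b(M):\Gamma\zeta\in L^2_b(M)\}$. For $k\in\mathbb Z$ let $V_k=\{\zeta\in L^2_b(M):X_3\zeta=ik\zeta\}$ (weakly). Then $\Gamma$ is well defined and restricts to a bounded operator $\Gamma_k:V_k\to V_k$ for each $k\in\mathbb Z$, and the following hold. (1) For each $k\in\mathbb Z$, $$\operatorname{Spec}\Gamma_k\subset ik\Sigma\cup S_k,\qquad \Sigma=\{f'(\lambda):\alpha_0\le\lambda\le\alpha_1\},$$ where $S_k\subset\mathbb C$ is a countable set all of whose accumulation points lie in $ik\Sigma$, and each $\mu\in S_k$ is an eigenvalue of $\Gamma_k$ whose generalized eigenspace $\bigcup_n\ker(\Gamma_k-\mu)^n$ is finite dimensional. (2) If $\operatorname{Spec}\Gamma$ is not contained in the imaginary axis, then some $\Gamma_k$ has an eigenvalue with nonzero real part. -/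

import Mathlib

open MeasureTheory Set Topology
open scoped ContDiff

noncomputable section

/-- Euclidean 3-space. -/
abbrev E3 : Type := EuclideanSpace ℝ (Fin 3)

/-- A smooth compact surface in `ℝ³`, diffeomorphic to the sphere, of positive Gauss curvature and
invariant under rotation about the third axis.  It is given by its meridian
`s ↦ (r s, z s)`, `0 ≤ s ≤ L`, parametrized by arc length from the lower to the upper pole
(`r` is the distance to the axis, `z` the height).  The section of the surface by a plane through
the axis is a closed smooth curve symmetric about the axis: `(r, z)` extends to all of `ℝ` with `r`
odd and `z` even about both `0` and `L`, and this is exactly smoothness of the surface at the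
poles. -/
structure SurfaceOfRevolution where
  /-- distance to the axis -/
  r : ℝ → ℝ
  /-- height -/
  z : ℝ → ℝ
  /-- length of the meridian -/
  L : ℝ
  L_pos : 0 < L
  r_smooth : ContDiff ℝ ∞ r
  z_smooth : ContDiff ℝ ∞ z
  r_odd : ∀ s, r (-s) = -r s
  r_odd' : ∀ s, r (2 * L - s) = -r s
  z_even : ∀ s, z (-s) = z s
  z_even' : ∀ s, z (2 * L - s) = z s
  arc_length : ∀ s, deriv r s ^ 2 + deriv z s ^ 2 = 1
  r_pos : ∀ s ∈ Ioo 0 L, 0 < r s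
  z_upward : ∀ s ∈ Ioo 0 L, 0 < deriv z s
  /-- The Gauss curvature, `-r''/r` away from the poles and its limit `-r'''/r'` at the poles,
  is positive. -/
  curvature_pos : ∀ s ∈ Icc 0 L,
    0 < if r s = 0 then -(iteratedDeriv 3 r s) / deriv r s else -(iteratedDeriv 2 r s) / r s

namespace SurfaceOfRevolution

variable (S : SurfaceOfRevolution)

/-- The point of the surface at arc length `s` on the meridian of longitude `θ`. -/
def param (s θ : ℝ) : E3 :=
  !₂[S.r s * Real.cos θ, S.r s * Real.sin θ, S.z s]

/-- The surface `M`, as a subset of `ℝ³`. -/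
def carrier : Set E3 := {x | ∃ s ∈ Icc 0 S.L, ∃ θ : ℝ, S.param s θ = x}

/-- The outward unit normal at `param s θ`. -/
def normalAt (s θ : ℝ) : E3 :=
  !₂[deriv S.z s * Real.cos θ, deriv S.z s * Real.sin θ, -deriv S.r s]

open Classical in
/-- The outward unit normal `ν` at a point of `M` (and `0` off `M`). -/
def normal (x : E3) : E3 :=
  if h : ∃ p : ℝ × ℝ, p.1 ∈ Icc 0 S.L ∧ S.param p.1 p.2 = x then
    S.normalAt h.choose.1 h.choose.2
  else 0

/-- The area measure `dS = |∂ₛ × ∂_θ| ds dθ = r ds dθ` of `M`, as a measure on `ℝ³` carried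
by `M`. -/
def area : Measure E3 :=
  ((volume.restrict (Ioc 0 S.L ×ˢ Ioc 0 (2 * Real.pi))).withDensity
    (fun p : ℝ × ℝ => ENNReal.ofReal (S.r p.1))).map (fun p => S.param p.1 p.2)

/-- Orthogonal projection of `v` to the tangent plane `T_x M`. -/
def tangentProj (x v : E3) : E3 := v - (inner ℝ (S.normal x) v) • S.normal x

/-- The gradient on `M` of (the restriction to `M` of) a real function. -/
def grad (g : E3 → ℝ) (x : E3) : E3 := S.tangentProj x (gradient g x)

/-- The gradient on `M` of a complex function, with values in `ℂ³`. -/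
def gradC (φ : E3 → ℂ) (x : E3) : EuclideanSpace ℂ (Fin 3) :=
  WithLp.toLp 2 fun i => fderiv ℝ φ x (S.tangentProj x (EuclideanSpace.single i 1))

/-- Counterclockwise rotation `J v = ν × v` by 90 degrees in `T_x M`. -/
def J (x v : E3) : E3 :=
  WithLp.toLp 2 (crossProduct (WithLp.ofLp (S.normal x)) (WithLp.ofLp v))

/-- The vector field generating the `2π`-periodic rotation about the third axis. -/
def X3 (x : E3) : E3 := !₂[-x 1, x 0, 0]

/-- `w = Δ f` on `M`, for the Laplace-Beltrami operator of the metric `ds² + r² dθ²`; at the poles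
the value of `w` is determined by continuity. -/
def IsLaplacian (f w : E3 → ℝ) : Prop :=
  ∀ s ∈ Ioo 0 S.L, ∀ θ : ℝ,
    w (S.param s θ) =
      deriv (fun t => S.r t * deriv (fun t' => f (S.param t' θ)) t) s / S.r s
        + iteratedDeriv 2 (fun τ => f (S.param s τ)) θ / S.r s ^ 2

/-! ### Facts needed for the definitions of the function spaces -/

lemma continuous_param : Continuous fun p : ℝ × ℝ => S.param p.1 p.2 := by
  have h1 := S.r_smooth.continuous
  have h2 := S.z_smooth.continuous
  unfold param
  refine (PiLp.continuous_toLp 2 _).comp (continuous_pi fun i => ?_)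
  fin_cases i <;> simp <;> fun_prop

instance : IsFiniteMeasure S.area := by
  have hr := S.r_smooth.continuous
  have : IsFiniteMeasure ((volume.restrict (Ioc 0 S.L ×ˢ Ioc 0 (2 * Real.pi))).withDensity
      (fun p : ℝ × ℝ => ENNReal.ofReal (S.r p.1))) := by
    refine isFiniteMeasure_withDensity_ofReal ?_
    have hc : IntegrableOn (fun p : ℝ × ℝ => S.r p.1)
        (Icc 0 S.L ×ˢ Icc 0 (2 * Real.pi)) :=
      (hr.comp continuous_fst).continuousOn.integrableOn_compact
        (isCompact_Icc.prod isCompact_Icc)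
    exact (hc.mono_set (prod_mono Ioc_subset_Icc_self Ioc_subset_Icc_self)).2
  unfold area
  infer_instance

lemma isCompact_carrier : IsCompact S.carrier := by
  have : S.carrier = (fun p : ℝ × ℝ => S.param p.1 p.2) ''
      (Icc 0 S.L ×ˢ Icc 0 (2 * Real.pi)) := by
    ext x
    constructor
    · rintro ⟨s, hs, θ, rfl⟩
      obtain ⟨y, hy, hy'⟩ := Real.cos_periodic.exists_mem_Ico₀ Real.two_pi_pos θ
      refine ⟨(s, toIcoMod Real.two_pi_pos 0 θ), ⟨hs, ?_⟩, ?_⟩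
      · have := toIcoMod_mem_Ico Real.two_pi_pos 0 θ
        exact ⟨this.1, by simpa using this.2.le⟩
      · have h := self_sub_toIcoDiv_zsmul Real.two_pi_pos 0 θ
        simp only [param, ← h, zsmul_eq_mul, Real.cos_sub_int_mul_two_pi,
          Real.sin_sub_int_mul_two_pi]
    · rintro ⟨p, hp, rfl⟩
      exact ⟨p.1, hp.1, p.2, rfl⟩
  rw [this]
  exact (isCompact_Icc.prod isCompact_Icc).image S.continuous_param

lemma ae_mem_carrier : ∀ᵐ x ∂S.area, x ∈ S.carrier := by
  unfold area
  rw [ae_map_iff (p := fun x => x ∈ S.carrier) S.continuous_param.measurable.aemeasurable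
    S.isCompact_carrier.isClosed.measurableSet]
  refine (withDensity_absolutelyContinuous _ _).ae_le ?_
  refine (ae_restrict_iff' (measurableSet_Ioc.prod measurableSet_Ioc)).2
    (Filter.Eventually.of_forall fun p hp => ?_)
  exact ⟨p.1, Ioc_subset_Icc_self hp.1, p.2, rfl⟩

/-- `L²(M)`, complex valued. -/
abbrev L2 : Type := Lp ℂ 2 S.area

lemma integrable_L2 (ζ : S.L2) : Integrable (fun x => ζ x) S.area :=
  (Lp.memLp ζ).integrable (by norm_num)

lemma integrable_L2_mul (ζ : S.L2) {u : E3 → ℂ} (hu : Continuous u) :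
    Integrable (fun x => ζ x * u x) S.area := by
  obtain ⟨C, hC⟩ := S.isCompact_carrier.exists_bound_of_continuousOn hu.continuousOn
  refine (S.integrable_L2 ζ).mul_bdd (c := C) hu.aestronglyMeasurable ?_
  filter_upwards [S.ae_mem_carrier] with x hx using hC x hx

lemma continuous_X3 : Continuous X3 := by
  unfold X3
  refine (PiLp.continuous_toLp 2 _).comp (continuous_pi fun i => ?_)
  fin_cases i <;> simp <;> fun_prop

lemma continuous_X3_deriv {φ : E3 → ℂ} (hφ : ContDiff ℝ ∞ φ) :
    Continuous fun x => fderiv ℝ φ x (X3 x) :=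
  (hφ.continuous_fderiv (by simp)).clm_apply continuous_X3

/-- The normal field is the one given by the parametrization. -/
lemma normal_param {s : ℝ} (hs : s ∈ Icc 0 S.L) (θ : ℝ) :
    S.normal (S.param s θ) = S.normalAt s θ := by
  have h : ∃ p : ℝ × ℝ, p.1 ∈ Icc 0 S.L ∧ S.param p.1 p.2 = S.param s θ := ⟨(s, θ), hs, rfl⟩
  have key : ∀ p : ℝ × ℝ, p.1 ∈ Icc 0 S.L → S.param p.1 p.2 = S.param s θ →
      S.normalAt p.1 p.2 = S.normalAt s θ := by
    rintro ⟨t, τ⟩ ht e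
    have hmono : StrictMonoOn S.z (Icc 0 S.L) :=
      strictMonoOn_of_deriv_pos (convex_Icc _ _) S.z_smooth.continuous.continuousOn
        (by simpa using S.z_upward)
    have e0 : S.r t * Real.cos τ = S.r s * Real.cos θ := by
      simpa [param] using congrArg (fun v : E3 => v 0) e
    have e1 : S.r t * Real.sin τ = S.r s * Real.sin θ := by
      simpa [param] using congrArg (fun v : E3 => v 1) e
    have e2 : S.z t = S.z s := by
      simpa [param] using congrArg (fun v : E3 => v 2) e
    obtain rfl : t = s := hmono.injOn ht hs e2
    rcases eq_or_ne (S.r t) 0 with h0 | h0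
    · have hz : deriv S.z t = 0 := by
        have hend : t = 0 ∨ t = S.L := by
          by_contra hne
          push Not at hne
          exact (S.r_pos t ⟨lt_of_le_of_ne ht.1 (Ne.symm hne.1),
            lt_of_le_of_ne ht.2 hne.2⟩).ne' h0
        have hd : ∀ x, DifferentiableAt ℝ S.z x := fun x =>
          (S.z_smooth.differentiable (by simp)) x
        rcases hend with rfl | rfl
        · have h1 : deriv (fun x => S.z (-x)) 0 = -deriv S.z (-0) := deriv_comp_neg S.z 0
          rw [funext S.z_even] at h1
          simp at h1
          linarith
        · have h1 : deriv (fun x => S.z (2 * S.L - x)) S.L = -deriv S.z (2 * S.L - S.L) :=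
            deriv_comp_const_sub S.z (2 * S.L) S.L
          rw [funext S.z_even', show 2 * S.L - S.L = S.L by ring] at h1
          linarith
      simp [normalAt, hz]
    · have hc := mul_left_cancel₀ h0 e0
      have hsn := mul_left_cancel₀ h0 e1
      simp [normalAt, hc, hsn]
  unfold normal
  rw [dif_pos h]
  exact key _ h.choose_spec.1 h.choose_spec.2

/-! ### Function spaces and the linearized vorticity operator -/

/-- `L²_b(M)`: the square integrable functions with integral `0`. -/
def L2b : Submodule ℂ S.L2 where
  carrier := {ζ | ∫ x, ζ x ∂S.area = 0}
  zero_mem' := by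
    have : ∫ x, (0 : S.L2) x ∂S.area = ∫ _, (0 : ℂ) ∂S.area :=
      integral_congr_ae (Lp.coeFn_zero ℂ 2 S.area)
    simpa using this
  add_mem' := by
    intro a b ha hb
    have h : ∫ x, (a + b) x ∂S.area = ∫ x, (a x + b x) ∂S.area :=
      integral_congr_ae (Lp.coeFn_add a b)
    rw [integral_add (S.integrable_L2 a) (S.integrable_L2 b)] at h
    simp only [mem_ofPred_eq] at ha hb ⊢
    rw [h, ha, hb, add_zero]
  smul_mem' := by
    intro c a ha
    have h : ∫ x, (c • a) x ∂S.area = ∫ x, c • a x ∂S.area :=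
      integral_congr_ae (Lp.coeFn_smul c a)
    rw [integral_smul] at h
    simp only [mem_ofPred_eq] at ha ⊢
    rw [h, ha, smul_zero]

/-- `V_k = {ζ ∈ L²_b(M) : X₃ ζ = i k ζ}`, where the derivative is taken in the weak sense
(`X₃` is divergence free, hence formally skew). -/
def V (k : ℤ) : Submodule ℂ S.L2b where
  carrier := {ζ | ∀ φ : E3 → ℂ, ContDiff ℝ ∞ φ →
    -∫ x, (ζ : S.L2) x * fderiv ℝ φ x (X3 x) ∂S.area
      = Complex.I * k * ∫ x, (ζ : S.L2) x * φ x ∂S.area}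
  zero_mem' := by
    intro φ hφ
    have h0 : ∀ u : E3 → ℂ, ∫ x, ((0 : S.L2b) : S.L2) x * u x ∂S.area = 0 := by
      intro u
      have : ∫ x, ((0 : S.L2b) : S.L2) x * u x ∂S.area = ∫ _, (0 : ℂ) ∂S.area := by
        refine integral_congr_ae ?_
        filter_upwards [Lp.coeFn_zero ℂ 2 S.area] with x hx
        rw [show ((0 : S.L2b) : S.L2) = 0 from rfl, hx, Pi.zero_apply, zero_mul]
      simpa using this
    rw [h0, h0]
    simp
  add_mem' := by
    intro a b ha hb φ hφ
    have hadd : ∀ u : E3 → ℂ, Continuous u →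
        ∫ x, ((a + b : S.L2b) : S.L2) x * u x ∂S.area
          = ∫ x, (a : S.L2) x * u x ∂S.area + ∫ x, (b : S.L2) x * u x ∂S.area := by
      intro u hu
      rw [← integral_add (S.integrable_L2_mul _ hu) (S.integrable_L2_mul _ hu)]
      refine integral_congr_ae ?_
      filter_upwards [Lp.coeFn_add (a : S.L2) (b : S.L2)] with x hx
      simp only [Submodule.coe_add, hx, Pi.add_apply, add_mul]
    rw [hadd _ (continuous_X3_deriv hφ), hadd _ hφ.continuous, neg_add, ha φ hφ, hb φ hφ]
    ring
  smul_mem' := by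
    intro c a ha φ hφ
    have hsm : ∀ u : E3 → ℂ,
        ∫ x, ((c • a : S.L2b) : S.L2) x * u x ∂S.area
          = c * ∫ x, (a : S.L2) x * u x ∂S.area := by
      intro u
      rw [← integral_const_mul]
      refine integral_congr_ae ?_
      filter_upwards [Lp.coeFn_smul c (a : S.L2)] with x hx
      simp only [Submodule.coe_smul, hx, Pi.smul_apply, smul_eq_mul, mul_assoc]
    have := ha φ hφ
    rw [hsm, hsm, ← mul_neg, this]
    ring

/-- `η ∈ H¹(M)` with gradient `G`: the pair is an `L²` limit of pairs `(φ, ∇φ)` with `φ` smooth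
on `M`. -/
def HasH1Grad (η : S.L2) (G : Lp (EuclideanSpace ℂ (Fin 3)) 2 S.area) : Prop :=
  (η, G) ∈ closure {q : S.L2 × Lp (EuclideanSpace ℂ (Fin 3)) 2 S.area |
    ∃ φ : E3 → ℂ, ContDiff ℝ ∞ φ ∧ q.1 =ᵐ[S.area] φ ∧ q.2 =ᵐ[S.area] S.gradC φ}

/-- `η = Δ⁻¹ ζ` for `ζ ∈ L²_b(M)`: `η ∈ H¹(M)` has integral `0` and solves `Δ η = ζ` weakly. -/
def IsInvLaplacian (ζ η : S.L2b) : Prop :=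
  ∃ G : Lp (EuclideanSpace ℂ (Fin 3)) 2 S.area, S.HasH1Grad η G ∧
    ∀ φ : E3 → ℂ, ContDiff ℝ ∞ φ →
      -∫ x, inner ℂ (S.gradC φ x) (G x) ∂S.area = ∫ x, inner ℂ (φ x) ((ζ : S.L2) x) ∂S.area

/-- The graph of the linearized vorticity operator
`Γ ζ = -∇_{J∇f} ζ + ∇_{J∇(w - Ωχ)} Δ⁻¹ ζ` in `L²_b(M)`, on its maximal domain: the derivatives
along the two (divergence free) fields are taken in the weak sense, and `ζ` belongs to the domain
if the result is in `L²`. -/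
def gammaGraph (f w χ : E3 → ℝ) (Ω : ℝ) : Set (S.L2b × S.L2b) :=
  {q | ∃ η : S.L2b, S.IsInvLaplacian q.1 η ∧
    ∀ φ : E3 → ℂ, ContDiff ℝ ∞ φ →
      ∫ x, (q.2 : S.L2) x * φ x ∂S.area =
        ∫ x, (q.1 : S.L2) x * fderiv ℝ φ x (S.J x (S.grad f x)) ∂S.area
        - ∫ x, (η : S.L2) x *
            fderiv ℝ φ x (S.J x (S.grad (fun y => w y - Ω * χ y) x)) ∂S.area}

end SurfaceOfRevolution

/-- `Σ = {f₁'(l) : α₀ ≤ l ≤ α₁}` for a function `f₁` on `[α₀, α₁]` (one-sided derivatives at the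
end points). -/
def derivRange (f₁ : ℝ → ℝ) (α₀ α₁ : ℝ) : Set ℝ :=
  derivWithin f₁ (Icc α₀ α₁) '' Icc α₀ α₁

/-- The set `i k A` for a set `A` of real numbers. -/
def ikSet (k : ℤ) (A : Set ℝ) : Set ℂ := (fun a : ℝ => Complex.I * (k : ℂ) * (a : ℂ)) '' A

/-- The spectrum of the (in general unbounded) operator `T` in `H` with graph `T`: `μ` is not in it
iff `T - μ` maps the domain of `T` bijectively to `H` and has a bounded inverse `R`. -/
def graphSpectrum {H : Type*} [NormedAddCommGroup H] [NormedSpace ℂ H] (T : Set (H × H)) : Set ℂ :=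
  {μ | ¬ ∃ R : H →L[ℂ] H, ∀ ζ h : H, (ζ, h + μ • ζ) ∈ T ↔ ζ = R h}

end

/-! Away from the poles the field J∇g of a smooth zonal function g = g₁(ξ) is -g₁'(ξ) X₃. With a =
f'(ξ) and b = h₁'(ξ), where w - Ωχ = h₁(ξ), the operator becomes Γζ = X₃(aζ - b Δ⁻¹ζ)
(`mem_gammaGraph_iff`). Since a, b and Δ⁻¹ commute with rotations, Γ acts on V_k as the bounded
operator Γ_k = ik(a - bΔ⁻¹) (`transport_mem_weakX3_iff`): multiplication by ika, which takes values
in ikΣ, plus a compact operator.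

Part (1) is the stability of the essential spectrum, obtained from quadratic polynomials. Because
ika is purely imaginary, for every μ off ikΣ there is a quadratic q with q(μ) = 1 and ‖q(ika)‖ < 1
(`quadBoundOff_imagMul`). Then ika - μ is invertible, and the Fredholm alternative turns spectrum of
Γ_k at μ into eigenvalues (`QuadBoundOff.hasEigenvalue`). Moreover q(Γ_k) is a compact perturbation
of an operator of norm < 1, whereas infinitely many eigenvalues near μ, or an infinite dimensional
generalized eigenspace, would make q(Γ_k) triangular along an infinite flag with diagonal entries
close to 1 (`false_of_triangular_flag`, `QuadBoundOff.exists_nhds_no_flag`).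

Compactness of Δ⁻¹ rests on a Poincaré inequality with explicit constants on n² coordinate
rectangles (`cell_poincare`). Positive curvature makes r concave, so the constants tend to 0 with
the mesh even at the poles, where the weight r degenerates. With one cell this gives the Poincaré
inequality behind the Lax–Milgram construction of Δ⁻¹; with many cells it gives Rellich compactness.

For part (2) let Re μ ≠ 0. On V_k the norm of Δ⁻¹ is O(k⁻²) (`norm_invLap_le`), so ‖(Γ_k - μ)ζ‖ ≥
|Re μ|/2 ‖ζ‖ for large |k| (`norm_gammaK_sub_smul_ge`). If μ is in the spectrum of no Γ_k, the
resolvents are thus uniformly bounded in k. By Stone–Weierstrass L²_b is the Hilbert sum of the V_k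
(`isHilbertSum_V`) and Γ is diagonal there, so the resolvents assemble to one of Γ
(`notMem_graphSpectrum`). Hence a point of Spec Γ off the imaginary axis lies in some Spec Γ_k, away
from ikΣ, and is an eigenvalue by part (1). -/

noncomputable section

/-! ### Compact perturbations: eigenvalues outside the essential spectrum -/

section CompactPerturbation

variable {H : Type*} [NormedAddCommGroup H] [InnerProductSpace ℂ H]

/-- A compact operator maps an orthonormal sequence to a sequence without lower bound on the
diagonal matrix entries. -/
lemma IsCompactOperator.exists_norm_inner_orthonormal_lt {K : H →L[ℂ] H}
    (hK : IsCompactOperator K) {y : ℕ → H} (hy : Orthonormal ℂ y) {ε : ℝ} (hε : 0 < ε) :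
    ∃ n, ‖inner ℂ (y n) (K (y n))‖ < ε := by
  obtain ⟨S, hS, hS'⟩ := hK.image_closedBall_subset_compact (1 : ℝ)
  obtain ⟨z, -, ψ, hψ, hz⟩ := hS.tendsto_subseq
    (fun n => hS' ⟨y n, by simp [hy.1 n], rfl⟩ : ∀ n, K (y n) ∈ S)
  have h1 : Filter.Tendsto (fun n => ‖inner ℂ (y (ψ n)) z‖ ^ 2) Filter.atTop (𝓝 0) :=
    ((hy.inner_products_summable z).tendsto_atTop_zero).comp hψ.tendsto_atTop
  have h2 : Filter.Tendsto (fun n => ‖K (y (ψ n)) - z‖) Filter.atTop (𝓝 0) := by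
    have := (hz.sub_const z).norm
    simpa using this
  have e1 := h1.eventually (gt_mem_nhds (show (0 : ℝ) < (ε / 2) ^ 2 by positivity))
  have e2 := h2.eventually (gt_mem_nhds (show (0 : ℝ) < ε / 2 by positivity))
  obtain ⟨n, hn1, hn2⟩ := (e1.and e2).exists
  refine ⟨ψ n, ?_⟩
  have h3 : ‖inner ℂ (y (ψ n)) z‖ < ε / 2 := lt_of_pow_lt_pow_left₀ 2 (by positivity) hn1
  have h4 : inner ℂ (y (ψ n)) (K (y (ψ n)))
      = inner ℂ (y (ψ n)) (K (y (ψ n)) - z) + inner ℂ (y (ψ n)) z := by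
    rw [← inner_add_right, sub_add_cancel]
  have h5 : ‖inner ℂ (y (ψ n)) (K (y (ψ n)) - z)‖ ≤ ‖K (y (ψ n)) - z‖ := by
    have := norm_inner_le_norm (𝕜 := ℂ) (y (ψ n)) (K (y (ψ n)) - z)
    rwa [hy.1, one_mul] at this
  rw [h4]
  exact (norm_add_le _ _).trans_lt (by linarith)

/-- A compact perturbation of an operator of norm `ρ` is not triangular with diagonal entries of
modulus larger than `ρ` with respect to any infinite flag. -/
lemma false_of_triangular_flag [CompleteSpace H] {B K : H →L[ℂ] H} (hK : IsCompactOperator K)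
    {ρ : ℝ} (hρ : ‖B‖ < ρ) (Y : ℕ → Submodule ℂ H) (hYc : ∀ n, IsClosed (Y n : Set H))
    (hY : StrictMono Y) (l : ℕ → ℂ) (hl : ∀ n, ρ ≤ ‖l n‖)
    (hPY : ∀ n, ∀ y ∈ Y (n + 1), (B + K) y - l n • y ∈ Y n) : False := by
  -- Unit vectors in the orthogonal complement of Y n inside Y (n + 1); together they form an
  -- orthonormal sequence.
  have hex : ∀ n, ∃ y ∈ Y (n + 1), y ∈ (Y n)ᗮ ∧ ‖y‖ = 1 := by
    intro n
    have : CompleteSpace (Y n) := (hYc n).completeSpace_coe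
    obtain ⟨x, hx, hxn⟩ := SetLike.exists_of_lt (hY (Nat.lt_succ_self n))
    obtain ⟨u, hu, v, hv, huv⟩ := (Y n).exists_add_mem_mem_orthogonal x
    have hv0 : v ≠ 0 := by
      rintro rfl
      exact hxn (by simpa [huv] using hu)
    have hvY : v ∈ Y (n + 1) := by
      have : v = x - u := by rw [huv]; abel
      rw [this]
      exact Submodule.sub_mem _ hx (hY.monotone (Nat.le_succ n) hu)
    exact ⟨((‖v‖ : ℂ)⁻¹) • v, Submodule.smul_mem _ _ hvY, Submodule.smul_mem _ _ hv,
      by simp [norm_smul, hv0]⟩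
  choose y hy1 hy2 hy3 using hex
  have hon : Orthonormal ℂ y := by
    refine ⟨hy3, ?_⟩
    have hlt : ∀ m n, m < n → inner ℂ (y m) (y n) = 0 := fun m n hmn =>
      (Submodule.mem_orthogonal _ _).1 (hy2 n) _ (hY.monotone hmn (hy1 m))
    intro m n hmn
    rcases lt_or_gt_of_ne hmn with h | h
    · exact hlt m n h
    · exact inner_eq_zero_symm.1 (hlt n m h)
  obtain ⟨n, hn⟩ := hK.exists_norm_inner_orthonormal_lt hon (sub_pos.2 hρ)
  -- Pairing with y n annihilates the part in Y n, so l n is the diagonal entry ⟨y n, (B + K) y n⟩.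
  have h0 := (Submodule.mem_orthogonal' _ _).1 (hy2 n) _ (hPY n _ (hy1 n))
  rw [inner_sub_right, inner_smul_right, inner_self_eq_norm_sq_to_K, hy3] at h0
  simp only [add_apply, inner_add_right] at h0
  have h1 : ‖inner ℂ (y n) (B (y n))‖ ≤ ‖B‖ := by
    have := norm_inner_le_norm (𝕜 := ℂ) (y n) (B (y n))
    have h2 := B.le_opNorm (y n)
    rw [hy3] at this h2
    linarith
  have h2 : l n = inner ℂ (y n) (B (y n)) + inner ℂ (y n) (K (y n)) := by
    simp at h0
    linear_combination -h0
  have h3 := hl n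
  rw [h2] at h3
  have := norm_add_le (inner ℂ (y n) (B (y n))) (inner ℂ (y n) (K (y n)))
  linarith

/-- `q(T) = 1 + δ (T - μ) (T - ν)`. -/
def quadOp (δ μ ν : ℂ) (T : H →L[ℂ] H) : H →L[ℂ] H :=
  1 + δ • ((T - μ • 1) * (T - ν • 1))

/-- Expanding the product, each term beyond those in A alone has a factor K, and the compact
operators form a two-sided ideal. -/
lemma quadOp_add_isCompact (δ μ ν : ℂ) (A : H →L[ℂ] H) {K : H →L[ℂ] H}
    (hK : IsCompactOperator K) :
    ∃ K' : H →L[ℂ] H, IsCompactOperator K' ∧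
      quadOp δ μ ν (A + K) = quadOp δ μ ν A + K' := by
  refine ⟨δ • (K * (A + K - ν • 1) + (A - μ • 1) * K), ?_, ?_⟩
  · exact (IsCompactOperator.add (hK.comp_clm (A + K - ν • 1))
      (hK.clm_comp (A - μ • 1))).smul δ
  · ext x
    simp [quadOp]
    module

/-- `A` satisfies a quadratic norm estimate at every point off `C`: then `C` contains the essential
spectrum of every compact perturbation of `A` and does not separate the plane. -/
def QuadBoundOff (A : H →L[ℂ] H) (C : Set ℂ) : Prop :=
  ∀ μ ∉ C, ∃ δ ν : ℂ, ‖quadOp δ μ ν A‖ < 1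

variable [CompleteSpace H] {A K : H →L[ℂ] H} {C : Set ℂ}

/-- By the Neumann series 1 - q(A) = -δ(A - μ)(A - ν) is invertible; its factors commute, so each of
them is invertible. -/
lemma QuadBoundOff.isUnit (hA : QuadBoundOff A C) {μ : ℂ} (hμ : μ ∉ C) :
    IsUnit (A - μ • 1) := by
  obtain ⟨δ, ν, h⟩ := hA μ hμ
  have h1 : IsUnit (1 - quadOp δ μ ν A) := isUnit_one_sub_of_norm_lt_one h
  have hc : Commute (A - μ • 1) (A - ν • 1) := by
    ext x
    simp
    module
  have h2 : (1 - quadOp δ μ ν A) = (A - μ • 1) * (-δ • (A - ν • 1)) := by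
    ext x
    simp [quadOp]
  rw [h2] at h1
  exact ((hc.smul_right (-δ)).isUnit_mul_iff.1 h1).1

/-- Factor A + K - μ = u(1 + u⁻¹K) with u = A - μ invertible. The Fredholm alternative for the
compact operator u⁻¹K at -1 gives either a kernel vector or invertibility. -/
lemma QuadBoundOff.hasEigenvalue (hA : QuadBoundOff A C) (hK : IsCompactOperator K) {μ : ℂ}
    (hμ : μ ∉ C) (hs : μ ∈ spectrum ℂ (A + K)) :
    Module.End.HasEigenvalue ((A + K : H →L[ℂ] H) : Module.End ℂ H) μ := by
  obtain ⟨u, hu⟩ := hA.isUnit hμ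
  have hK' : IsCompactOperator ((↑u⁻¹ : H →L[ℂ] H) * K) := hK.clm_comp _
  have hfac : (A + K) - μ • 1 = (u : H →L[ℂ] H) * ((↑u⁻¹ : H →L[ℂ] H) * K - (-1 : ℂ) • 1) := by
    rw [mul_sub, ← mul_assoc, Units.mul_inv, one_mul, hu]
    ext x
    simp
    abel
  rcases hK'.hasEigenvalue_or_mem_resolventSet (show (-1 : ℂ) ≠ 0 by norm_num) with h | h
  · obtain ⟨v, hv⟩ := h.exists_hasEigenvector
    refine Module.End.hasEigenvalue_of_hasEigenvector (x := v)
      ⟨Module.End.mem_eigenspace_iff.2 ?_, hv.2⟩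
    have h1 : ((↑u⁻¹ : H →L[ℂ] H) * K) v = (-1 : ℂ) • v := hv.apply_eq_smul
    have h2 := congrArg (fun T : H →L[ℂ] H => T v) hfac
    have h3 : ((A + K) - μ • 1 : H →L[ℂ] H) v = 0 := by
      rw [h2]
      change (u : H →L[ℂ] H) (((↑u⁻¹ : H →L[ℂ] H) * K) v - (-1 : ℂ) • v) = 0
      rw [h1, sub_self, map_zero]
    have h4 : (A + K) v - μ • v = 0 := h3
    exact sub_eq_zero.1 h4
  · exfalso
    apply hs
    rw [spectrum.mem_resolventSet_iff] at h ⊢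
    rw [← IsUnit.neg_iff]
    have h1 : -(algebraMap ℂ (H →L[ℂ] H) μ - (A + K)) = (A + K) - μ • 1 := by
      rw [Algebra.algebraMap_eq_smul_one, neg_sub]
    rw [h1, hfac]
    refine u.isUnit.mul ?_
    rw [← IsUnit.neg_iff]
    rwa [Algebra.algebraMap_eq_smul_one, ← neg_sub, IsUnit.neg_iff, ← IsUnit.neg_iff] at h

/-- The polynomial q has q(μ) = 1 and ‖q(A)‖ < ρ < 1, so |q| > ρ near μ. A flag along which A + K is
triangular with diagonal l n is one along which q(A + K) is triangular with diagonal q(l n), which a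
compact perturbation of q(A) cannot have. -/
lemma QuadBoundOff.exists_nhds_no_flag (hA : QuadBoundOff A C) (hK : IsCompactOperator K) {μ : ℂ}
    (hμ : μ ∉ C) : ∃ U ∈ 𝓝 μ, ∀ (l : ℕ → ℂ) (_ : ∀ n, l n ∈ U) (Y : ℕ → Submodule ℂ H)
      (_ : ∀ n, IsClosed (Y n : Set H)) (_ : StrictMono Y)
      (_ : ∀ n, ∀ y ∈ Y (n + 1), (A + K) y - l n • y ∈ Y n), False := by
  obtain ⟨δ, ν, h⟩ := hA μ hμ
  obtain ⟨K', hK', hq⟩ := quadOp_add_isCompact δ μ ν A hK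
  obtain ⟨ρ, hρ, hρ1⟩ := exists_between h
  let q : ℂ → ℂ := fun z => 1 + δ * ((z - μ) * (z - ν))
  have hqc : Continuous q := by fun_prop
  have hU : {z | ρ < ‖q z‖} ∈ 𝓝 μ := by
    refine (isOpen_lt continuous_const hqc.norm).mem_nhds ?_
    simpa [q] using hρ1
  refine ⟨_, hU, fun l hl Y hYc hY hΓ => ?_⟩
  refine false_of_triangular_flag hK' hρ Y hYc hY (fun n => q (l n)) (fun n => (hl n).le) ?_
  intro n y hy
  rw [← hq]
  have hY1 := hY.monotone (Nat.le_succ n)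
  have hw := hΓ n y hy
  have hinv : ∀ w ∈ Y n, (A + K) w ∈ Y n := by
    intro w hw'
    have := Submodule.add_mem _ (hΓ n w (hY1 hw')) (Submodule.smul_mem _ (l n) hw')
    simpa using this
  have hw2 := hinv _ hw
  -- The factorization q(T) - q(l) = δ (T + l - μ - ν)(T - l), applied with T = A + K.
  have key : quadOp δ μ ν (A + K) y - q (l n) • y
      = δ • ((A + K) ((A + K) y - l n • y) + (l n - μ - ν) • ((A + K) y - l n • y)) := by
    have h1 : quadOp δ μ ν (A + K) y
        = y + δ • ((A + K) ((A + K) y - ν • y) - μ • ((A + K) y - ν • y)) := rfl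
    rw [h1]
    simp only [q, map_sub, map_smul]
    module
  rw [key]
  exact Submodule.smul_mem _ _ (Submodule.add_mem _ hw2 (Submodule.smul_mem _ _ hw))

/-- Eigenvectors for infinitely many distinct eigenvalues near μ are linearly independent, and the
spans of their initial segments form a forbidden flag. -/
lemma QuadBoundOff.not_accPt (hA : QuadBoundOff A C) (hK : IsCompactOperator K) {μ : ℂ}
    (hμ : μ ∉ C) {E : Set ℂ}
    (hE : ∀ l ∈ E, Module.End.HasEigenvalue ((A + K : H →L[ℂ] H) : Module.End ℂ H) l) :
    ¬ AccPt μ (Filter.principal E) := by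
  intro hacc
  obtain ⟨U, hU, hfalse⟩ := hA.exists_nhds_no_flag hK hμ
  have hinf : (U ∩ E).Infinite := Set.Infinite.of_accPt (hacc.nhds_inter hU)
  let l : ℕ ↪ (U ∩ E : Set ℂ) := hinf.natEmbedding
  choose x hx using fun n => (hE (l n) (l n).2.2).exists_hasEigenvector
  have hli : LinearIndependent ℂ x :=
    Module.End.eigenvectors_linearIndependent' _ (fun n => ((l n : ℂ)))
      (Subtype.val_injective.comp l.injective) x hx
  have hxe : ∀ n, (A + K) (x n) = (l n : ℂ) • x n := fun n => (hx n).apply_eq_smul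
  refine hfalse (fun n => l n) (fun n => (l n).2.1)
    (fun n => Submodule.span ℂ (x '' Set.Iio n)) (fun n => ?_) ?_ ?_
  · have : FiniteDimensional ℂ (Submodule.span ℂ (x '' Set.Iio n)) :=
      FiniteDimensional.span_of_finite ℂ ((Set.finite_Iio n).image x)
    exact Submodule.closed_of_finiteDimensional _
  · refine strictMono_nat_of_lt_succ fun n => ?_
    refine lt_of_le_of_ne (Submodule.span_mono (Set.image_mono (Set.Iio_subset_Iio n.le_succ))) ?_
    intro heq
    have h1 : x n ∈ Submodule.span ℂ (x '' Set.Iio n) := by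
      rw [heq]
      exact Submodule.subset_span ⟨n, Nat.lt_succ_self n, rfl⟩
    exact (hli.notMem_span_image (s := Set.Iio n) (x := n) (by simp)) h1
  · intro n y hy
    induction hy using Submodule.span_induction with
    | mem y hy =>
      obtain ⟨m, hm, rfl⟩ := hy
      rw [hxe, ← sub_smul]
      rcases (Nat.lt_succ_iff_lt_or_eq.1 hm) with h | h
      · exact Submodule.smul_mem _ _ (Submodule.subset_span ⟨m, h, rfl⟩)
      · subst h
        simp
    | zero => simp
    | add y z _ _ h1 h2 =>
      have := Submodule.add_mem _ h1 h2
      convert this using 1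
      simp only [map_add]
      module
    | smul c y _ h1 =>
      have := Submodule.smul_mem _ c h1
      convert this using 1
      simp only [map_smul]
      module

/-- In an infinite dimensional generalized eigenspace every finite dimensional invariant subspace
can be enlarged by a vector that Γ - μ sends back into it. Iterating from ⊥ gives a forbidden flag
with constant diagonal μ. -/
lemma QuadBoundOff.finiteDimensional_maxGenEigenspace (hA : QuadBoundOff A C)
    (hK : IsCompactOperator K) {μ : ℂ} (hμ : μ ∉ C) :
    FiniteDimensional ℂ
      (Module.End.maxGenEigenspace ((A + K : H →L[ℂ] H) : Module.End ℂ H) μ) := by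
  by_contra hinf
  obtain ⟨U, hU, hfalse⟩ := hA.exists_nhds_no_flag hK hμ
  set Γ : Module.End ℂ H := ((A + K : H →L[ℂ] H) : Module.End ℂ H) with hΓ
  let N : Module.End ℂ H := Γ - μ • 1
  let F := {Y : Submodule ℂ H // FiniteDimensional ℂ Y ∧ Y ≤ Γ.maxGenEigenspace μ ∧
    ∀ y ∈ Y, N y ∈ Y}
  have step : ∀ Y : F, ∃ Z : F, Y.1 < Z.1 ∧ ∀ z ∈ Z.1, N z ∈ Y.1 := by
    rintro ⟨Y, hYf, hYE, hYN⟩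
    have hlt : Y < Γ.maxGenEigenspace μ := by
      refine lt_of_le_of_ne hYE ?_
      rintro rfl
      exact hinf hYf
    obtain ⟨x, hx, hxY⟩ := SetLike.exists_of_lt hlt
    have hex : ∃ j, (N ^ j) x ∈ Y := by
      obtain ⟨j, hj⟩ := (Module.End.mem_maxGenEigenspace _ _ _).1 hx
      exact ⟨j, by rw [show (N ^ j) x = 0 from hj]; exact Y.zero_mem⟩
    classical
    -- The least power of N taking x into Y is positive because x ∉ Y; one power less gives the new
    -- vector.
    obtain ⟨i, hi⟩ : ∃ i, Nat.find hex = i + 1 := by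
      refine Nat.exists_eq_succ_of_ne_zero fun h0 => hxY ?_
      have := Nat.find_spec hex
      rw [h0] at this
      simpa using this
    have hv : (N ^ i) x ∉ Y := Nat.find_min hex (by omega)
    have hNv : N ((N ^ i) x) ∈ Y := by
      have := Nat.find_spec hex
      rw [hi, pow_succ'] at this
      exact this
    have hvE : (N ^ i) x ∈ Γ.maxGenEigenspace μ := by
      obtain ⟨j, hj⟩ := (Module.End.mem_maxGenEigenspace _ _ _).1 hx
      refine (Module.End.mem_maxGenEigenspace _ _ _).2 ⟨j, ?_⟩
      change (N ^ j * N ^ i) x = 0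
      rw [← pow_add, add_comm, pow_add]
      change (N ^ i) ((N ^ j) x) = 0
      rw [show (N ^ j) x = 0 from hj, map_zero]
    set v := (N ^ i) x
    have hZ : ∀ z ∈ Y ⊔ Submodule.span ℂ {v}, N z ∈ Y := by
      intro z hz
      obtain ⟨y, hy, w, hw, rfl⟩ := Submodule.mem_sup.1 hz
      obtain ⟨c, rfl⟩ := Submodule.mem_span_singleton.1 hw
      rw [map_add, map_smul]
      exact Submodule.add_mem _ (hYN y hy) (Submodule.smul_mem _ _ hNv)
    refine ⟨⟨Y ⊔ Submodule.span ℂ {v}, inferInstance, sup_le hYE ?_, fun z hz =>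
      (le_sup_left : Y ≤ _) (hZ z hz)⟩, ?_, hZ⟩
    · rwa [Submodule.span_singleton_le_iff_mem]
    · refine lt_of_le_of_ne le_sup_left fun h => hv ?_
      change Y = _ at h
      rw [h]
      exact (le_sup_right : _ ≤ Y ⊔ _) (Submodule.mem_span_singleton_self v)
  choose next hlt hnext using step
  let Y : ℕ → F := fun n => Nat.rec ⟨⊥, inferInstance, bot_le, by simp⟩ (fun _ => next) n
  refine hfalse (fun _ => μ) (fun _ => mem_of_mem_nhds hU) (fun n => (Y n).1) (fun n => ?_)
    (strictMono_nat_of_lt_succ fun n => hlt (Y n)) (fun n y hy => hnext (Y n) y hy)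
  have := (Y n).2.1
  exact Submodule.closed_of_finiteDimensional _

/-- No point of this set is an accumulation point of it, and a discrete subset of the plane is
countable. -/
lemma QuadBoundOff.countable (hA : QuadBoundOff A C) (hK : IsCompactOperator K) :
    (spectrum ℂ (A + K) \ C).Countable := by
  have : DiscreteTopology (spectrum ℂ (A + K) \ C : Set ℂ) :=
    discreteTopology_of_noAccPts fun μ hμ =>
      hA.not_accPt hK hμ.2 fun l hl => hA.hasEigenvalue hK hl.2 hl.1
  exact Set.countable_coe_iff.1 countable_of_Lindelof_of_discrete

end CompactPerturbation

namespace SurfaceOfRevolution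

variable (S : SurfaceOfRevolution)

/-! ### Rotations and the area measure -/

lemma r_zero : S.r 0 = 0 := by
  have := S.r_odd 0
  simp at this
  linarith

lemma r_L : S.r S.L = 0 := by
  have := S.r_odd' S.L
  rw [show 2 * S.L - S.L = S.L by ring] at this
  linarith

lemma r_nonneg {s : ℝ} (hs : s ∈ Icc 0 S.L) : 0 ≤ S.r s := by
  rcases eq_or_lt_of_le hs.1 with h | h
  · rw [← h, r_zero]
  rcases eq_or_lt_of_le hs.2 with h' | h'
  · rw [h', r_L]
  exact (S.r_pos s ⟨h, h'⟩).le

/-- The parameter rectangle, up to a null set. -/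
def box : Set (ℝ × ℝ) := Ioc 0 S.L ×ˢ Ioc 0 (2 * Real.pi)

/-- The area measure in the coordinates `(s, θ)`. -/
def paramMeasure : Measure (ℝ × ℝ) :=
  (volume.restrict S.box).withDensity (fun p => ENNReal.ofReal (S.r p.1))

lemma measurePreserving_param :
    MeasurePreserving (fun p : ℝ × ℝ => S.param p.1 p.2) S.paramMeasure S.area :=
  ⟨S.continuous_param.measurable, rfl⟩

lemma measurableSet_box : MeasurableSet S.box := measurableSet_Ioc.prod measurableSet_Ioc

instance : IsFiniteMeasure S.paramMeasure := by
  constructor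
  have h := S.measurePreserving_param.measure_preimage MeasurableSet.univ.nullMeasurableSet
  rw [preimage_univ] at h
  rw [h]
  exact measure_lt_top _ _

lemma integral_paramMeasure {E : Type*} [NormedAddCommGroup E] [NormedSpace ℝ E]
    (F : ℝ × ℝ → E) (A : Set (ℝ × ℝ)) (hA : MeasurableSet A) (hAb : A ⊆ S.box) :
    ∫ p in A, F p ∂S.paramMeasure = ∫ p in A, S.r p.1 • F p := by
  have hm : Measurable fun p : ℝ × ℝ => ENNReal.ofReal (S.r p.1) :=
    ((S.r_smooth.continuous.comp continuous_fst).measurable).ennreal_ofReal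
  unfold paramMeasure
  rw [restrict_withDensity hA, Measure.restrict_restrict hA, inter_eq_left.2 hAb,
    integral_withDensity_eq_integral_toReal_smul hm (by simp)]
  refine setIntegral_congr_fun hA fun p hp => ?_
  have := (hAb hp).1
  change (ENNReal.ofReal (S.r p.1)).toReal • F p = _
  rw [ENNReal.toReal_ofReal (S.r_nonneg ⟨this.1.le, this.2⟩)]

lemma paramMeasure_restrict_box : S.paramMeasure.restrict S.box = S.paramMeasure := by
  unfold paramMeasure
  rw [restrict_withDensity S.measurableSet_box, Measure.restrict_restrict S.measurableSet_box,
    inter_self]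

lemma integral_area {E : Type*} [NormedAddCommGroup E] [NormedSpace ℝ E] {F : E3 → E}
    (hF : AEStronglyMeasurable F S.area) :
    ∫ x, F x ∂S.area = ∫ p in S.box, S.r p.1 • F (S.param p.1 p.2) := by
  have h := integral_map (μ := S.paramMeasure) (φ := fun p : ℝ × ℝ => S.param p.1 p.2)
    S.continuous_param.measurable.aemeasurable (f := F) hF
  have h2 : S.area = S.paramMeasure.map (fun p : ℝ × ℝ => S.param p.1 p.2) := rfl
  rw [h2, h, ← S.integral_paramMeasure (fun p => F (S.param p.1 p.2)) _ S.measurableSet_box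
    subset_rfl, paramMeasure_restrict_box]

lemma integral_area_of_continuous {E : Type*} [NormedAddCommGroup E] [NormedSpace ℝ E]
    [CompleteSpace E] [SecondCountableTopology E] {F : E3 → E} (hF : Continuous F) :
    ∫ x, F x ∂S.area
      = ∫ s in Ioc 0 S.L, S.r s • ∫ θ in (0 : ℝ)..2 * Real.pi, F (S.param s θ) := by
  have hc : Continuous fun p : ℝ × ℝ => S.r p.1 • F (S.param p.1 p.2) :=
    (S.r_smooth.continuous.comp continuous_fst).smul (hF.comp S.continuous_param)
  rw [S.integral_area hF.aestronglyMeasurable, box, Measure.volume_eq_prod, setIntegral_prod]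
  · refine setIntegral_congr_fun measurableSet_Ioc fun s _ => ?_
    simp only
    rw [integral_smul, intervalIntegral.integral_of_le Real.two_pi_pos.le]
  · exact (hc.continuousOn.integrableOn_compact (isCompact_Icc.prod isCompact_Icc)).mono_set
      (prod_mono Ioc_subset_Icc_self Ioc_subset_Icc_self)

/-- Rotation by the angle `t` about the third axis. -/
def rot (t : ℝ) : E3 →L[ℝ] E3 :=
  LinearMap.toContinuousLinearMap
    { toFun := fun x => !₂[Real.cos t * x 0 - Real.sin t * x 1,
        Real.sin t * x 0 + Real.cos t * x 1, x 2]
      map_add' := by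
        intro x y
        ext i
        fin_cases i <;> simp <;> ring
      map_smul' := by
        intro c x
        ext i
        fin_cases i <;> simp <;> ring }

lemma rot_apply (t : ℝ) (x : E3) : rot t x = !₂[Real.cos t * x 0 - Real.sin t * x 1,
    Real.sin t * x 0 + Real.cos t * x 1, x 2] := rfl

lemma rot_neg_rot (t : ℝ) (x : E3) : rot (-t) (rot t x) = x := by
  have := Real.sin_sq_add_cos_sq t
  ext i
  fin_cases i
  · simp [rot_apply]
    linear_combination (x 0) * this
  · simp [rot_apply]
    linear_combination (x 1) * this
  · simp [rot_apply]

lemma rot_rot_neg (t : ℝ) (x : E3) : rot t (rot (-t) x) = x := by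
  simpa using rot_neg_rot (-t) x

lemma rot_zero (x : E3) : rot 0 x = x := by
  ext i
  fin_cases i <;> simp [rot_apply]

lemma rot_X3 (t : ℝ) (x : E3) : rot t (X3 x) = X3 (rot t x) := by
  ext i
  fin_cases i <;> simp [rot_apply, X3] <;> ring

lemma rot_param (t s θ : ℝ) : rot t (S.param s θ) = S.param s (θ + t) := by
  ext i
  fin_cases i <;> simp [rot_apply, param, Real.cos_add, Real.sin_add] <;> ring

lemma rot_normalAt (t s θ : ℝ) : rot t (S.normalAt s θ) = S.normalAt s (θ + t) := by
  ext i
  fin_cases i <;> simp [rot_apply, normalAt, Real.cos_add, Real.sin_add] <;> ring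

lemma rot_mem_carrier {x : E3} (hx : x ∈ S.carrier) (t : ℝ) : rot t x ∈ S.carrier := by
  obtain ⟨s, hs, θ, rfl⟩ := hx
  exact ⟨s, hs, θ + t, (S.rot_param t s θ).symm⟩

lemma normal_rot {x : E3} (hx : x ∈ S.carrier) (t : ℝ) :
    S.normal (rot t x) = rot t (S.normal x) := by
  obtain ⟨s, hs, θ, rfl⟩ := hx
  rw [rot_param, S.normal_param hs, S.normal_param hs, rot_normalAt]

lemma inner_rot (t : ℝ) (x y : E3) : inner ℝ (rot t x) (rot t y) = inner ℝ x y := by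
  simp [PiLp.inner_apply, Fin.sum_univ_three, rot_apply]
  linear_combination (y 0 * x 0 + y 1 * x 1) * Real.sin_sq_add_cos_sq t

lemma hasDerivAt_rot (t : ℝ) (x : E3) : HasDerivAt (fun t => rot t x) (X3 (rot t x)) t := by
  have h : HasDerivAt (fun t => (![Real.cos t * x 0 - Real.sin t * x 1,
      Real.sin t * x 0 + Real.cos t * x 1, x 2] : Fin 3 → ℝ))
      ![-(Real.sin t * x 0 + Real.cos t * x 1), Real.cos t * x 0 - Real.sin t * x 1, 0] t := by
    refine hasDerivAt_pi.2 fun i => ?_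
    fin_cases i
    · have := ((Real.hasDerivAt_cos t).mul_const (x 0)).sub
        ((Real.hasDerivAt_sin t).mul_const (x 1))
      refine this.congr_deriv ?_
      simp
      ring
    · have := ((Real.hasDerivAt_sin t).mul_const (x 0)).add
        ((Real.hasDerivAt_cos t).mul_const (x 1))
      refine this.congr_deriv ?_
      simp
      ring
    · exact hasDerivAt_const _ _
  exact (PiLp.hasFDerivAt_toLp 2 _).comp_hasDerivAt t h

lemma param_periodic (s : ℝ) : Function.Periodic (S.param s) (2 * Real.pi) := by
  intro θ
  simp [param]

/-- In the coordinates (s, θ) a rotation shifts θ, and the integral of a 2π-periodic function over a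
period does not change. Finite measures are determined by bounded continuous functions. -/
lemma measurePreserving_rot (t : ℝ) : MeasurePreserving (rot t) S.area S.area := by
  refine ⟨(rot t).continuous.measurable, ?_⟩
  have : IsFiniteMeasure (S.area.map (rot t)) := Measure.isFiniteMeasure_map _ _
  refine ext_of_forall_integral_eq_of_IsFiniteMeasure fun F => ?_
  rw [integral_map (rot t).continuous.measurable.aemeasurable
    F.continuous.aestronglyMeasurable, S.integral_area_of_continuous F.continuous,
    S.integral_area_of_continuous (F := fun x => F (rot t x))
      (F.continuous.comp (rot t).continuous)]
  refine setIntegral_congr_fun measurableSet_Ioc fun s _ => ?_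
  simp only [rot_param]
  congr 1
  have hp : Function.Periodic (fun θ => F (S.param s θ)) (2 * Real.pi) := fun θ => by
    simp only [S.param_periodic s θ]
  have h1 := intervalIntegral.integral_comp_add_right (a := 0) (b := 2 * Real.pi)
    (fun θ => F (S.param s θ)) t
  have h2 := hp.intervalIntegral_add_eq t 0
  rw [h1, zero_add, add_comm (2 * Real.pi) t, h2, zero_add]

lemma hasDerivAt_param (s θ : ℝ) : HasDerivAt (S.param s) (X3 (S.param s θ)) θ := by
  have h := hasDerivAt_rot θ (S.param s 0)
  have h2 : (fun t => rot t (S.param s 0)) = S.param s := by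
    funext t
    rw [rot_param, zero_add]
  rw [h2] at h
  rwa [rot_param, zero_add] at h

/-- The integrand is a θ-derivative along each parallel, so it integrates to 0 over the closed
circle. This makes X₃ formally skew. -/
lemma integral_X3_deriv {φ : E3 → ℂ} (hφ : ContDiff ℝ ∞ φ) :
    ∫ x, fderiv ℝ φ x (X3 x) ∂S.area = 0 := by
  rw [S.integral_area_of_continuous (continuous_X3_deriv hφ)]
  refine integral_eq_zero_of_ae (Filter.Eventually.of_forall fun s => ?_)
  have hd : ∀ θ, HasDerivAt (fun θ => φ (S.param s θ))
      (fderiv ℝ φ (S.param s θ) (X3 (S.param s θ))) θ := fun θ =>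
    ((hφ.differentiable (by simp)).differentiableAt.hasFDerivAt).comp_hasDerivAt θ
      (S.hasDerivAt_param s θ)
  have hc : Continuous fun θ => fderiv ℝ φ (S.param s θ) (X3 (S.param s θ)) :=
    (continuous_X3_deriv hφ).comp (S.continuous_param.comp (by fun_prop : Continuous fun θ : ℝ => (s, θ)))
  simp only [Pi.zero_apply]
  rw [intervalIntegral.integral_eq_sub_of_hasDerivAt (fun θ _ => hd θ) (hc.intervalIntegrable _ _)]
  have := S.param_periodic s 0
  rw [zero_add] at this
  rw [this, sub_self, smul_zero]

/-! ### Rotations on `L²` -/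

lemma integral_mul_eq_of_smooth {ζ ζ' : S.L2}
    (h : ∀ φ : E3 → ℂ, ContDiff ℝ ∞ φ → ∫ x, ζ x * φ x ∂S.area = ∫ x, ζ' x * φ x ∂S.area) :
    ζ = ζ' := by
  rw [← sub_eq_zero]
  refine Lp.ext ?_
  have hI : Integrable (fun x => (ζ - ζ' : S.L2) x) S.area := S.integrable_L2 _
  refine Filter.EventuallyEq.trans (g := fun _ => (0 : ℂ))
    (ae_eq_zero_of_integral_contDiff_smul_eq_zero hI.locallyIntegrable fun g hg _ => ?_)
    (Lp.coeFn_zero ℂ 2 S.area).symm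
  have hg' : ContDiff ℝ ∞ fun x => (g x : ℂ) := Complex.ofRealCLM.contDiff.comp hg
  have h1 : ∫ x, g x • (ζ - ζ' : S.L2) x ∂S.area
      = ∫ x, (ζ x * g x - ζ' x * g x) ∂S.area := by
    refine integral_congr_ae ?_
    filter_upwards [Lp.coeFn_sub ζ ζ'] with x hx
    simp only [hx, Pi.sub_apply, Complex.real_smul]
    ring
  rw [h1, integral_sub (S.integrable_L2_mul _ hg'.continuous)
    (S.integrable_L2_mul _ hg'.continuous), h _ hg', sub_self]

/-- Composition with a rotation on `L²(M)`. -/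
def U (t : ℝ) : S.L2 →ₗᵢ[ℂ] S.L2 :=
  Lp.compMeasurePreservingₗᵢ ℂ (rot t) (S.measurePreserving_rot t)

lemma U_coeFn (t : ℝ) (ζ : S.L2) : S.U t ζ =ᵐ[S.area] fun x => ζ (rot t x) :=
  Lp.coeFn_compMeasurePreserving ζ (S.measurePreserving_rot t)

lemma measurableEmbedding_rot (t : ℝ) : MeasurableEmbedding (rot t) := by
  let e : E3 ≃ₜ E3 :=
    { toFun := rot t
      invFun := rot (-t)
      left_inv := rot_neg_rot t
      right_inv := rot_rot_neg t
      continuous_toFun := (rot t).continuous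
      continuous_invFun := (rot (-t)).continuous }
  exact e.measurableEmbedding

lemma integral_U_mul (t : ℝ) (ζ : S.L2) (u : E3 → ℂ) :
    ∫ x, S.U t ζ x * u x ∂S.area = ∫ x, ζ x * u (rot (-t) x) ∂S.area := by
  rw [← (S.measurePreserving_rot t).integral_comp (measurableEmbedding_rot t)
    fun x => ζ x * u (rot (-t) x)]
  refine integral_congr_ae ?_
  filter_upwards [S.U_coeFn t ζ] with x hx
  rw [hx, rot_neg_rot]

/-- The weak equation `X₃ ζ = i k ζ`. -/
def IsWeakEigen (k : ℤ) (ζ : S.L2) : Prop :=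
  ∀ φ : E3 → ℂ, ContDiff ℝ ∞ φ →
    -∫ x, ζ x * fderiv ℝ φ x (X3 x) ∂S.area = Complex.I * k * ∫ x, ζ x * φ x ∂S.area

lemma fderiv_comp_rot {φ : E3 → ℂ} (hφ : ContDiff ℝ ∞ φ) (t : ℝ) (x v : E3) :
    fderiv ℝ (fun y => φ (rot t y)) x v = fderiv ℝ φ (rot t x) (rot t v) := by
  have h := ((hφ.differentiable (by simp)).differentiableAt (x := rot t x)).hasFDerivAt.comp x
    (rot t).hasFDerivAt
  have h2 : HasFDerivAt (fun y => φ (rot t y)) _ x := h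
  rw [h2.fderiv]
  rfl

lemma hasDerivAt_integral_U (ζ : S.L2) {φ : E3 → ℂ} (hφ : ContDiff ℝ ∞ φ) (t : ℝ) :
    HasDerivAt (fun t => ∫ x, S.U t ζ x * φ x ∂S.area)
      (-∫ x, ζ x * fderiv ℝ (fun y => φ (rot (-t) y)) x (X3 x) ∂S.area) t := by
  simp only [integral_U_mul, fderiv_comp_rot hφ, rot_X3]
  have hd := continuous_X3_deriv hφ
  obtain ⟨C, hC⟩ := S.isCompact_carrier.exists_bound_of_continuousOn hd.continuousOn
  rw [← integral_neg]
  refine (hasDerivAt_integral_of_dominated_loc_of_deriv_le (s := univ) Filter.univ_mem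
    (F := fun t x => ζ x * φ (rot (-t) x))
    (F' := fun t x => -(ζ x * fderiv ℝ φ (rot (-t) x) (X3 (rot (-t) x))))
    (bound := fun x => ‖ζ x‖ * C) ?_ ?_ ?_ ?_ ?_ ?_).2
  · exact Filter.Eventually.of_forall fun t =>
      (S.integrable_L2_mul ζ (hφ.continuous.comp (rot (-t)).continuous)).1
  · exact S.integrable_L2_mul ζ (hφ.continuous.comp (rot (-t)).continuous)
  · exact (S.integrable_L2_mul ζ (hd.comp (rot (-t)).continuous)).1.neg
  · filter_upwards [S.ae_mem_carrier] with x hx t _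
    rw [norm_neg, norm_mul]
    exact mul_le_mul_of_nonneg_left (hC _ (S.rot_mem_carrier hx _)) (norm_nonneg _)
  · exact (S.integrable_L2 ζ).norm.mul_const C
  · refine Filter.Eventually.of_forall fun x t _ => ?_
    have h1 : HasDerivAt (fun t => rot (-t) x) (-X3 (rot (-t) x)) t := by
      have := (hasDerivAt_rot (-t) x).scomp t (hasDerivAt_neg t)
      rw [neg_one_smul] at this
      exact this
    have h2 := ((hφ.differentiable (by simp)).differentiableAt
      (x := rot (-t) x)).hasFDerivAt.comp_hasDerivAt t h1
    have h3 := h2.const_mul (ζ x)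
    rw [map_neg, mul_neg] at h3
    exact h3

/-- Tested against φ, the orbit U t ζ satisfies the linear equation y' = iky, and conversely
differentiation at t = 0 returns the weak equation. The rotational form needs no test functions, so
it passes to products with merely continuous zonal functions and to Δ⁻¹. -/
lemma isWeakEigen_iff (k : ℤ) (ζ : S.L2) :
    S.IsWeakEigen k ζ ↔ ∀ t : ℝ, S.U t ζ = Complex.exp (Complex.I * k * t) • ζ := by
  have hsm : ∀ (c : ℂ) (u : E3 → ℂ), ∫ x, (c • ζ : S.L2) x * u x ∂S.area
      = c * ∫ x, ζ x * u x ∂S.area := by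
    intro c u
    rw [← integral_const_mul]
    refine integral_congr_ae ?_
    filter_upwards [Lp.coeFn_smul c ζ] with x hx
    rw [hx, Pi.smul_apply, smul_eq_mul, mul_assoc]
  have hexp : ∀ t : ℝ, HasDerivAt (fun t : ℝ => Complex.exp (Complex.I * k * t))
      (Complex.exp (Complex.I * k * t) * (Complex.I * k)) t := by
    intro t
    have h1 : HasDerivAt (fun t : ℝ => Complex.I * k * (t : ℂ)) (Complex.I * k) t := by
      simpa using (Complex.ofRealCLM.hasDerivAt (x := t)).const_mul (Complex.I * (k : ℂ))
    exact h1.cexp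
  have hU0 : S.U 0 ζ = ζ := by
    refine Lp.ext ((S.U_coeFn 0 ζ).trans (Filter.Eventually.of_forall fun x => ?_))
    simp only [rot_zero]
  constructor
  · intro h t
    refine S.integral_mul_eq_of_smooth fun φ hφ => ?_
    have hder : ∀ t : ℝ, HasDerivAt (fun t => ∫ x, S.U t ζ x * φ x ∂S.area)
        (Complex.I * k * ∫ x, S.U t ζ x * φ x ∂S.area) t := by
      intro t
      have h1 := S.hasDerivAt_integral_U ζ hφ t
      -- The weak equation is used with the rotated test function, which turns the derivative at 0
      -- into the derivative at t.
      rw [h (fun y => φ (rot (-t) y)) (hφ.comp (rot (-t)).contDiff)] at h1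
      rw [integral_U_mul]
      exact h1
    have hconst : ∀ t : ℝ, HasDerivAt (fun t : ℝ => Complex.exp (-(Complex.I * k * t)) *
        ∫ x, S.U t ζ x * φ x ∂S.area) 0 t := by
      intro t
      have h1 : HasDerivAt (fun t : ℝ => -(Complex.I * k * (t : ℂ))) (-(Complex.I * k)) t := by
        have := ((Complex.ofRealCLM.hasDerivAt (x := t)).const_mul (Complex.I * (k : ℂ))).neg
        refine this.congr_deriv ?_
        simp
      refine (h1.cexp.mul (hder t)).congr_deriv ?_
      ring
    have h3 := is_const_of_deriv_eq_zero (fun t => (hconst t).differentiableAt)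
      (fun t => (hconst t).deriv) t 0
    simp only [hU0, Complex.ofReal_zero, mul_zero, neg_zero, Complex.exp_zero, one_mul] at h3
    rw [hsm, ← h3, ← mul_assoc, ← Complex.exp_add]
    simp
  · intro h φ hφ
    have h1 := S.hasDerivAt_integral_U ζ hφ 0
    have h2 : (fun y => φ (rot (-0) y)) = φ := by
      funext y
      rw [neg_zero, rot_zero]
    rw [h2] at h1
    have h3 := (hexp 0).mul_const (∫ x, ζ x * φ x ∂S.area)
    have h4 : (fun t : ℝ => ∫ x, S.U t ζ x * φ x ∂S.area)
        = fun t : ℝ => Complex.exp (Complex.I * k * t) * ∫ x, ζ x * φ x ∂S.area := by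
      funext t
      rw [h t, hsm]
    rw [h4] at h1
    have h5 := h1.unique h3
    simpa using h5

end SurfaceOfRevolution

namespace SurfaceOfRevolution

variable (S : SurfaceOfRevolution)

/-! ### Tangent vectors and the gradient -/

/-- The unit tangent vector of the meridian. -/
def tangentS (s θ : ℝ) : E3 :=
  !₂[deriv S.r s * Real.cos θ, deriv S.r s * Real.sin θ, deriv S.z s]

lemma hasDerivAt_r (s : ℝ) : HasDerivAt S.r (deriv S.r s) s :=
  (S.r_smooth.differentiable (by simp)).differentiableAt.hasDerivAt

lemma hasDerivAt_z (s : ℝ) : HasDerivAt S.z (deriv S.z s) s :=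
  (S.z_smooth.differentiable (by simp)).differentiableAt.hasDerivAt

lemma hasDerivAt_param_left (s θ : ℝ) :
    HasDerivAt (fun s => S.param s θ) (S.tangentS s θ) s := by
  have h : HasDerivAt (fun s => (![S.r s * Real.cos θ, S.r s * Real.sin θ, S.z s] : Fin 3 → ℝ))
      ![deriv S.r s * Real.cos θ, deriv S.r s * Real.sin θ, deriv S.z s] s := by
    refine hasDerivAt_pi.2 fun i => ?_
    fin_cases i
    · exact (S.hasDerivAt_r s).mul_const _
    · exact (S.hasDerivAt_r s).mul_const _
    · exact S.hasDerivAt_z s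
  exact (PiLp.hasFDerivAt_toLp 2 _).comp_hasDerivAt s h

lemma norm_tangentS (s θ : ℝ) : ‖S.tangentS s θ‖ = 1 := by
  rw [EuclideanSpace.norm_eq, Real.sqrt_eq_one]
  simp [Fin.sum_univ_three, tangentS]
  linear_combination S.arc_length s + deriv S.r s ^ 2 * Real.sin_sq_add_cos_sq θ

lemma norm_X3_param {s : ℝ} (hs : s ∈ Icc 0 S.L) (θ : ℝ) : ‖X3 (S.param s θ)‖ = S.r s := by
  rw [EuclideanSpace.norm_eq, Real.sqrt_eq_iff_mul_self_eq (by positivity) (S.r_nonneg hs)]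
  simp [Fin.sum_univ_three, X3, param]
  linear_combination S.r s ^ 2 * Real.sin_sq_add_cos_sq θ

lemma inner_normal_tangentS {s : ℝ} (hs : s ∈ Icc 0 S.L) (θ : ℝ) :
    inner ℝ (S.normal (S.param s θ)) (S.tangentS s θ) = 0 := by
  rw [S.normal_param hs]
  simp [PiLp.inner_apply, Fin.sum_univ_three, normalAt, tangentS]
  linear_combination (deriv S.r s * deriv S.z s) * Real.sin_sq_add_cos_sq θ

lemma inner_normal_X3 {x : E3} (hx : x ∈ S.carrier) : inner ℝ (S.normal x) (X3 x) = 0 := by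
  obtain ⟨s, hs, θ, rfl⟩ := hx
  rw [S.normal_param hs]
  simp [PiLp.inner_apply, Fin.sum_univ_three, normalAt, X3, param]
  ring

/-- The parametrization of M by a compact rectangle is a quotient map, so continuity may be checked
on the formula in (s, θ). -/
lemma continuousOn_normal : ContinuousOn S.normal S.carrier := by
  let K : Set (ℝ × ℝ) := Icc 0 S.L ×ˢ Icc 0 (2 * Real.pi)
  have hK : IsCompact K := isCompact_Icc.prod isCompact_Icc
  have : CompactSpace K := isCompact_iff_compactSpace.1 hK
  let p : K → S.carrier := fun q => ⟨S.param q.1.1 q.1.2, q.1.1, q.2.1, q.1.2, rfl⟩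
  have hp : Continuous p := (S.continuous_param.comp continuous_subtype_val).subtype_mk _
  have hsurj : Function.Surjective p := by
    rintro ⟨x, s, hs, θ, rfl⟩
    refine ⟨⟨(s, toIcoMod Real.two_pi_pos 0 θ), hs, ?_⟩, ?_⟩
    · have := toIcoMod_mem_Ico Real.two_pi_pos 0 θ
      exact ⟨this.1, by simpa using this.2.le⟩
    · have h := self_sub_toIcoDiv_zsmul Real.two_pi_pos 0 θ
      simp only [p, param, ← h, zsmul_eq_mul, Real.cos_sub_int_mul_two_pi,
        Real.sin_sub_int_mul_two_pi]
  have hq : IsQuotientMap p := .of_surjective_continuous hsurj hp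
  rw [continuousOn_iff_continuous_domRestrict, hq.continuous_iff]
  have h1 : (S.carrier.domRestrict S.normal) ∘ p = fun q : K => S.normalAt q.1.1 q.1.2 := by
    funext q
    exact S.normal_param q.2.1 _
  rw [h1]
  have hr : Continuous (deriv S.r) := S.r_smooth.continuous_deriv (by simp)
  have hz : Continuous (deriv S.z) := S.z_smooth.continuous_deriv (by simp)
  unfold normalAt
  refine (PiLp.continuous_toLp 2 _).comp (continuous_pi fun i => ?_)
  fin_cases i <;> simp <;> fun_prop

lemma tangentProj_eq_self {x v : E3} (h : inner ℝ (S.normal x) v = 0) :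
    S.tangentProj x v = v := by
  simp [tangentProj, h]

lemma fderiv_tangentProj (φ : E3 → ℂ) (x v : E3) :
    fderiv ℝ φ x (S.tangentProj x v) = ∑ i, (v i : ℂ) * S.gradC φ x i := by
  have h : S.tangentProj x v = ∑ i, v i • S.tangentProj x (EuclideanSpace.single i 1) := by
    have hv : v = ∑ i, v i • EuclideanSpace.single i (1 : ℝ) := by
      ext j
      fin_cases j <;> simp [Fin.sum_univ_three]
    conv_lhs => rw [hv]
    simp only [tangentProj, Fin.sum_univ_three, inner_add_right, inner_smul_right]
    module
  rw [h, map_sum]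
  refine Finset.sum_congr rfl fun i _ => ?_
  rw [map_smul, Complex.real_smul]
  rfl

/-- The complexification of a real vector. -/
def toC3 (v : E3) : EuclideanSpace ℂ (Fin 3) := WithLp.toLp 2 fun i => (v i : ℂ)

lemma norm_toC3 (v : E3) : ‖toC3 v‖ = ‖v‖ := by
  rw [EuclideanSpace.norm_eq, EuclideanSpace.norm_eq]
  simp [toC3]

lemma inner_toC3 (v : E3) (G : EuclideanSpace ℂ (Fin 3)) :
    inner ℂ (toC3 v) G = ∑ i, (v i : ℂ) * G i := by
  simp [PiLp.inner_apply, toC3, mul_comm]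

lemma fderiv_eq_inner_gradC {φ : E3 → ℂ} {x v : E3} (h : inner ℝ (S.normal x) v = 0) :
    fderiv ℝ φ x v = inner ℂ (toC3 v) (S.gradC φ x) := by
  rw [inner_toC3, ← fderiv_tangentProj, S.tangentProj_eq_self h]

lemma norm_fderiv_le_gradC {φ : E3 → ℂ} {x v : E3} (h : inner ℝ (S.normal x) v = 0) :
    ‖fderiv ℝ φ x v‖ ≤ ‖v‖ * ‖S.gradC φ x‖ := by
  rw [S.fderiv_eq_inner_gradC h, ← norm_toC3]
  exact norm_inner_le_norm _ _

lemma continuousOn_gradC {φ : E3 → ℂ} (hφ : ContDiff ℝ ∞ φ) :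
    ContinuousOn (S.gradC φ) S.carrier := by
  refine (PiLp.continuous_toLp 2 _).comp_continuousOn (continuousOn_pi.2 fun i => ?_)
  have hn := S.continuousOn_normal
  refine (hφ.continuous_fderiv (by simp)).continuousOn.clm_apply ?_
  unfold tangentProj
  fun_prop

lemma area_restrict_carrier : S.area.restrict S.carrier = S.area :=
  Measure.restrict_eq_self_of_ae_mem S.ae_mem_carrier

lemma aestronglyMeasurable_of_continuousOn {E : Type*} [NormedAddCommGroup E]
    {F : E3 → E} (hF : ContinuousOn F S.carrier) : AEStronglyMeasurable F S.area := by
  rw [← area_restrict_carrier]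
  exact hF.aestronglyMeasurable_of_isCompact S.isCompact_carrier
    S.isCompact_carrier.isClosed.measurableSet

lemma memLp_of_continuousOn {E : Type*} [NormedAddCommGroup E] {F : E3 → E}
    (hF : ContinuousOn F S.carrier) : MemLp F 2 S.area := by
  obtain ⟨C, hC⟩ := S.isCompact_carrier.exists_bound_of_continuousOn hF
  exact MemLp.of_bound (S.aestronglyMeasurable_of_continuousOn hF) C
    (by filter_upwards [S.ae_mem_carrier] with x hx using hC x hx)

lemma gradC_add {φ ψ : E3 → ℂ} (hφ : ContDiff ℝ ∞ φ) (hψ : ContDiff ℝ ∞ ψ) (x : E3) :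
    S.gradC (fun y => φ y + ψ y) x = S.gradC φ x + S.gradC ψ x := by
  ext i
  have h : fderiv ℝ (fun y => φ y + ψ y) x = fderiv ℝ φ x + fderiv ℝ ψ x :=
    fderiv_add (hφ.differentiable (by simp)).differentiableAt
      (hψ.differentiable (by simp)).differentiableAt
  simp [gradC, h]

lemma gradC_const_mul {φ : E3 → ℂ} (hφ : ContDiff ℝ ∞ φ) (c : ℂ) (x : E3) :
    S.gradC (fun y => c * φ y) x = c • S.gradC φ x := by
  ext i
  have h : fderiv ℝ (fun y => c * φ y) x = c • fderiv ℝ φ x :=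
    fderiv_const_mul (hφ.differentiable (by simp)).differentiableAt c
  simp [gradC, h]

lemma gradC_sub_const (φ : E3 → ℂ) (c : ℂ) (x : E3) :
    S.gradC (fun y => φ y - c) x = S.gradC φ x := by
  ext i
  simp only [gradC, fderiv_sub_const]

/-! ### Rotations of vector fields -/

/-- Rotation of `ℂ³` by the angle `t` about the third axis. -/
def rotC (t : ℝ) : EuclideanSpace ℂ (Fin 3) →L[ℂ] EuclideanSpace ℂ (Fin 3) :=
  LinearMap.toContinuousLinearMap
    { toFun := fun x => !₂[Real.cos t * x 0 - Real.sin t * x 1,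
        Real.sin t * x 0 + Real.cos t * x 1, x 2]
      map_add' := by
        intro x y
        ext i
        fin_cases i <;> simp <;> ring
      map_smul' := by
        intro c x
        ext i
        fin_cases i <;> simp <;> ring }

lemma rotC_apply (t : ℝ) (x : EuclideanSpace ℂ (Fin 3)) :
    rotC t x = !₂[Real.cos t * x 0 - Real.sin t * x 1,
      Real.sin t * x 0 + Real.cos t * x 1, x 2] := rfl

lemma inner_rotC_neg (t : ℝ) (x y : EuclideanSpace ℂ (Fin 3)) :
    inner ℂ x (rotC (-t) y) = inner ℂ (rotC t x) y := by
  simp [PiLp.inner_apply, Fin.sum_univ_three, rotC_apply, Complex.conj_ofReal, -Complex.ofReal_cos,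
    -Complex.ofReal_sin]
  ring

/-- The normal field is equivariant, so tangential projection commutes with rotation; the transpose
of a rotation by t is the rotation by -t. -/
lemma gradC_comp_rot {φ : E3 → ℂ} (hφ : ContDiff ℝ ∞ φ) (t : ℝ) {x : E3} (hx : x ∈ S.carrier) :
    S.gradC (fun y => φ (rot t y)) x = rotC (-t) (S.gradC φ (rot t x)) := by
  have h1 : ∀ v, rot t (S.tangentProj x v) = S.tangentProj (rot t x) (rot t v) := by
    intro v
    simp only [tangentProj, map_sub, map_smul, S.normal_rot hx, inner_rot]
  have h2 : ∀ i, S.gradC (fun y => φ (rot t y)) x i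
      = ∑ j, ((rot t (EuclideanSpace.single i 1) j : ℝ) : ℂ) * S.gradC φ (rot t x) j := by
    intro i
    rw [← fderiv_tangentProj, ← h1]
    exact fderiv_comp_rot hφ t x _
  ext i
  rw [h2]
  fin_cases i <;> simp [Fin.sum_univ_three, rotC_apply, rot_apply]

/-! ### Functions constant along the parallels -/

lemma inner_gradient (g : E3 → ℝ) (x v : E3) :
    gradient g x 0 * v 0 + gradient g x 1 * v 1 + gradient g x 2 * v 2 = fderiv ℝ g x v := by
  have h : inner ℝ (gradient g x) v = fderiv ℝ g x v := by
    rw [gradient, InnerProductSpace.toDual_symm_apply]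
  rw [← h, PiLp.inner_apply, Fin.sum_univ_three]
  simp only [RCLike.inner_apply, conj_trivial]
  ring

lemma J_grad (g : E3 → ℝ) (x : E3) : S.J x (S.grad g x) = S.J x (gradient g x) := by
  ext i
  fin_cases i <;> simp [J, grad, tangentProj, crossProduct] <;> ring

/-- A vanishing θ-derivative leaves only the meridian component of the tangential gradient, and J
maps the unit meridian vector to -X₃/r. -/
lemma J_grad_param {g : E3 → ℝ} {s θ : ℝ} (hs : s ∈ Ioo 0 S.L)
    (h : fderiv ℝ g (S.param s θ) (X3 (S.param s θ)) = 0) :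
    S.J (S.param s θ) (S.grad g (S.param s θ))
      = -((fderiv ℝ g (S.param s θ) (S.tangentS s θ)) / S.r s) • X3 (S.param s θ) := by
  have hr := (S.r_pos s hs).ne'
  rw [J_grad]
  rw [← inner_gradient] at h ⊢
  set p := gradient g (S.param s θ)
  have hJ : S.J (S.param s θ) p
      = WithLp.toLp 2 (crossProduct (WithLp.ofLp (S.normalAt s θ)) (WithLp.ofLp p)) := by
    rw [J, S.normal_param (Ioo_subset_Icc_self hs)]
  have h0 : -Real.sin θ * p 0 + Real.cos θ * p 1 = 0 := by
    have : S.r s * (-Real.sin θ * p 0 + Real.cos θ * p 1) = 0 := by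
      simp [X3, param] at h
      linear_combination h
    exact (mul_eq_zero.1 this).resolve_left hr
  have hc := Real.sin_sq_add_cos_sq θ
  rw [hJ]
  ext i
  fin_cases i
  · simp [crossProduct, normalAt, tangentS, X3, param]
    field_simp
    linear_combination (deriv S.r s * Real.cos θ) * h0 - deriv S.r s * p 1 * hc
  · simp [crossProduct, normalAt, tangentS, X3, param]
    field_simp
    linear_combination (deriv S.r s * Real.sin θ) * h0 + deriv S.r s * p 0 * hc
  · simp [crossProduct, normalAt, tangentS, X3, param]
    linear_combination (deriv S.z s) * h0

/-- Reading the equation in components gives ∂_s ξ = r and ∂_θ ξ = 0; the vertical component is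
divided by z' > 0. -/
lemma fderiv_of_J_grad_eq_neg_X3 {ξ : E3 → ℝ} {s θ : ℝ}
    (hs : s ∈ Ioo 0 S.L)
    (h : S.J (S.param s θ) (S.grad ξ (S.param s θ)) = -X3 (S.param s θ)) :
    fderiv ℝ ξ (S.param s θ) (S.tangentS s θ) = S.r s ∧
      fderiv ℝ ξ (S.param s θ) (X3 (S.param s θ)) = 0 := by
  rw [J_grad] at h
  rw [← inner_gradient, ← inner_gradient]
  set p := gradient ξ (S.param s θ)
  rw [J, S.normal_param (Ioo_subset_Icc_self hs)] at h
  have hc := Real.sin_sq_add_cos_sq θ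
  have h0 := congrArg (fun v : E3 => v 0) h
  have h1 := congrArg (fun v : E3 => v 1) h
  have h2 := congrArg (fun v : E3 => v 2) h
  simp [crossProduct, normalAt, X3, param] at h0 h1 h2
  have h3 : Real.cos θ * p 1 - Real.sin θ * p 0 = 0 := by
    have : deriv S.z s * (Real.cos θ * p 1 - Real.sin θ * p 0) = 0 := by
      linear_combination h2
    exact (mul_eq_zero.1 this).resolve_left (S.z_upward s hs).ne'
  simp [tangentS, X3, param]
  constructor
  · linear_combination Real.sin θ * h0 - Real.cos θ * h1
      + (S.r s - deriv S.z s * p 2) * hc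
  · linear_combination S.r s * h3

end SurfaceOfRevolution

/-! ### Differentiation with respect to a monotone parameter -/

section MonotoneParameter

variable {a b : ℝ} {X G κ ρ g : ℝ → ℝ}

lemma strictMonoOn_of_hasDerivAt_pos (hX : ContinuousOn X (Icc a b))
    (hX' : ∀ s ∈ Ioo a b, HasDerivAt X (ρ s) s) (hρ : ∀ s ∈ Ioo a b, 0 < ρ s) :
    StrictMonoOn X (Icc a b) :=
  strictMonoOn_of_deriv_pos (convex_Icc _ _) hX fun s hs => by
    rw [interior_Icc] at hs
    rw [(hX' s hs).deriv]
    exact hρ s hs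

lemma image_Icc_of_strictMonoOn (hab : a ≤ b) (hX : ContinuousOn X (Icc a b))
    (hmono : StrictMonoOn X (Icc a b)) : X '' Icc a b = Icc (X a) (X b) := by
  refine Subset.antisymm ?_ (intermediate_value_Icc hab hX)
  rintro _ ⟨s, hs, rfl⟩
  exact ⟨hmono.monotoneOn (left_mem_Icc.2 hab) hs hs.1,
    hmono.monotoneOn hs (right_mem_Icc.2 hab) hs.2⟩

/-- Cauchy's mean value theorem: the quotient of the two derivatives is κ. -/
lemma sub_eq_mul_of_ratio (hX : ContinuousOn X (Icc a b)) (hG : ContinuousOn G (Icc a b))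
    (hX' : ∀ s ∈ Ioo a b, HasDerivAt X (ρ s) s) (hρ : ∀ s ∈ Ioo a b, 0 < ρ s)
    (hG' : ∀ s ∈ Ioo a b, HasDerivAt G (κ s * ρ s) s) {s t : ℝ} (hs : s ∈ Icc a b)
    (ht : t ∈ Icc a b) (hst : s < t) :
    ∃ c ∈ Ioo s t, G t - G s = κ c * (X t - X s) := by
  have hsub : Icc s t ⊆ Icc a b := Icc_subset_Icc hs.1 ht.2
  have hsub' : Ioo s t ⊆ Ioo a b := Ioo_subset_Ioo hs.1 ht.2
  obtain ⟨c, hc, h⟩ := exists_ratio_hasDerivAt_eq_ratio_slope G (fun s => κ s * ρ s) hst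
    (hG.mono hsub) (fun x hx => hG' x (hsub' hx)) X ρ (hX.mono hsub)
    (fun x hx => hX' x (hsub' hx))
  refine ⟨c, hc, ?_⟩
  have := (hρ c (hsub' hc)).ne'
  apply mul_right_cancel₀ this
  linear_combination -h

/-- If G = g ∘ X and G' = κX', then g' = κ ∘ X⁻¹. The mean value form needs no positivity of X' at
the end points, where it vanishes in the application, and the inverse of X is continuous by
monotonicity. -/
lemma hasDerivWithinAt_of_ratio (hab : a < b) (hX : ContinuousOn X (Icc a b))
    (hG : ContinuousOn G (Icc a b)) (hκ : ContinuousOn κ (Icc a b))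
    (hX' : ∀ s ∈ Ioo a b, HasDerivAt X (ρ s) s) (hρ : ∀ s ∈ Ioo a b, 0 < ρ s)
    (hG' : ∀ s ∈ Ioo a b, HasDerivAt G (κ s * ρ s) s)
    (hg : ∀ s ∈ Icc a b, g (X s) = G s) :
    (∀ s ∈ Icc a b, HasDerivWithinAt g (κ s) (Icc (X a) (X b)) (X s)) ∧
      ContinuousOn (derivWithin g (Icc (X a) (X b))) (Icc (X a) (X b)) := by
  have hmono := strictMonoOn_of_hasDerivAt_pos hX hX' hρ
  have himg := image_Icc_of_strictMonoOn hab.le hX hmono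
  have hlt : X a < X b := hmono (left_mem_Icc.2 hab.le) (right_mem_Icc.2 hab.le) hab
  let e : Icc a b ≃o Icc (X a) (X b) :=
    (hmono.orderIso _ _).trans (OrderIso.setCongr _ _ himg)
  have he : ∀ s, (e s : ℝ) = X s := fun s => rfl
  have hec : Continuous e.symm := e.symm.continuous
  have hdiff : ∀ s t : Icc a b, ∃ c : Icc a b, dist c s ≤ dist t s ∧
      G t - G s = κ c * (X t - X s) := by
    intro s t
    rcases lt_trichotomy (s : ℝ) t with h | h | h
    · obtain ⟨c, hc, h1⟩ := sub_eq_mul_of_ratio hX hG hX' hρ hG' s.2 t.2 h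
      refine ⟨⟨c, s.2.1.trans hc.1.le, hc.2.le.trans t.2.2⟩, ?_, h1⟩
      rw [Subtype.dist_eq, Subtype.dist_eq, Real.dist_eq, Real.dist_eq,
        abs_of_pos (sub_pos.2 hc.1), abs_of_pos (sub_pos.2 h)]
      linarith [hc.2]
    · exact ⟨s, by simp, by rw [h]; ring⟩
    · obtain ⟨c, hc, h1⟩ := sub_eq_mul_of_ratio hX hG hX' hρ hG' t.2 s.2 h
      refine ⟨⟨c, t.2.1.trans hc.1.le, hc.2.le.trans s.2.2⟩, ?_, by linear_combination -h1⟩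
      rw [Subtype.dist_eq, Subtype.dist_eq, Real.dist_eq, Real.dist_eq,
        abs_of_neg (sub_neg.2 hc.2), abs_of_neg (sub_neg.2 h)]
      linarith [hc.1]
  have hder : ∀ s ∈ Icc a b, HasDerivWithinAt g (κ s) (Icc (X a) (X b)) (X s) := by
    intro s hs
    rw [hasDerivWithinAt_iff_isLittleO, Asymptotics.isLittleO_iff]
    intro ε hε
    obtain ⟨δ, hδ, hκδ⟩ := Metric.continuousWithinAt_iff.1 (hκ s hs) ε hε
    have h1 : ∀ᶠ y in 𝓝 (e ⟨s, hs⟩), dist (e.symm y) ⟨s, hs⟩ < δ := by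
      have := hec.tendsto (e ⟨s, hs⟩)
      rw [OrderIso.symm_apply_apply] at this
      exact this.eventually (Metric.ball_mem_nhds _ hδ)
    rw [nhds_subtype_eq_comap, Filter.eventually_comap] at h1
    rw [eventually_nhdsWithin_iff]
    filter_upwards [h1] with y hy hyI
    have hy' := hy ⟨y, hyI⟩ rfl
    set t := e.symm ⟨y, hyI⟩ with ht
    have hty : X t = y := by rw [← he, ht, OrderIso.apply_symm_apply]
    obtain ⟨c, hc, hG2⟩ := hdiff ⟨s, hs⟩ t
    rw [← hty, hg _ t.2, hg _ hs, hG2]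
    have h3 := hκδ c.2 (lt_of_le_of_lt hc hy')
    rw [Real.dist_eq] at h3
    have h4 : κ c * (X t - X s) - (X t - X s) • κ s = (κ c - κ s) * (X t - X s) := by
      rw [smul_eq_mul]; ring
    rw [h4, norm_mul, Real.norm_eq_abs (κ c - κ s)]
    exact mul_le_mul_of_nonneg_right h3.le (norm_nonneg _)
  refine ⟨hder, ?_⟩
  have hdw : ∀ y : Icc (X a) (X b), derivWithin g (Icc (X a) (X b)) y = κ (e.symm y) := by
    intro y
    have h1 := (hder _ (e.symm y).2).derivWithin
      ((uniqueDiffOn_Icc hlt) _ (by rw [← he]; exact (e (e.symm y)).2))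
    rwa [← he, OrderIso.apply_symm_apply] at h1
  rw [continuousOn_iff_continuous_domRestrict]
  have h2 : (Icc (X a) (X b)).domRestrict (derivWithin g (Icc (X a) (X b)))
      = (Icc a b).domRestrict κ ∘ e.symm := by
    funext y
    exact hdw y
  rw [h2]
  exact (continuousOn_iff_continuous_domRestrict.1 hκ).comp hec

end MonotoneParameter

namespace SurfaceOfRevolution

variable (S : SurfaceOfRevolution)

/-- Constant along the parallels. -/
def IsZonal (g : E3 → ℝ) : Prop := ∀ s ∈ Icc 0 S.L, ∀ θ, g (S.param s θ) = g (S.param s 0)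

lemma param_zero (θ : ℝ) : S.param 0 θ = S.param 0 0 := by
  simp [param, r_zero]

lemma param_L (θ : ℝ) : S.param S.L θ = S.param S.L 0 := by
  simp [param, r_L]

lemma isZonal_of_interior {g : E3 → ℝ}
    (h : ∀ s ∈ Ioo 0 S.L, ∀ θ, g (S.param s θ) = g (S.param s 0)) : S.IsZonal g := by
  intro s hs θ
  rcases eq_or_lt_of_le hs.1 with h0 | h0
  · rw [← h0, param_zero]
  rcases eq_or_lt_of_le hs.2 with h1 | h1
  · rw [h1, param_L]
  exact h s ⟨h0, h1⟩ θ

variable {S}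

lemma hasDerivAt_comp_param {g : E3 → ℝ} (hg : ContDiff ℝ ∞ g) (s θ : ℝ) :
    HasDerivAt (fun θ => g (S.param s θ)) (fderiv ℝ g (S.param s θ) (X3 (S.param s θ))) θ :=
  ((hg.differentiable (by simp)).differentiableAt.hasFDerivAt).comp_hasDerivAt θ
    (S.hasDerivAt_param s θ)

lemma hasDerivAt_comp_param_left {g : E3 → ℝ} (hg : ContDiff ℝ ∞ g) (s θ : ℝ) :
    HasDerivAt (fun s => g (S.param s θ)) (fderiv ℝ g (S.param s θ) (S.tangentS s θ)) s :=
  ((hg.differentiable (by simp)).differentiableAt.hasFDerivAt).comp_hasDerivAt s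
    (S.hasDerivAt_param_left s θ)

lemma isZonal_of_fderiv {g : E3 → ℝ} (hg : ContDiff ℝ ∞ g)
    (h : ∀ s ∈ Ioo 0 S.L, ∀ θ, fderiv ℝ g (S.param s θ) (X3 (S.param s θ)) = 0) :
    S.IsZonal g := by
  refine S.isZonal_of_interior fun s hs θ => ?_
  exact is_const_of_deriv_eq_zero
    (fun θ => (hasDerivAt_comp_param (S := S) hg s θ).differentiableAt)
    (fun θ => by rw [(hasDerivAt_comp_param (S := S) hg s θ).deriv, h s hs θ]) θ 0

lemma IsZonal.fderiv_X3 {g : E3 → ℝ} (hz : S.IsZonal g) (hg : ContDiff ℝ ∞ g) {s : ℝ}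
    (hs : s ∈ Icc 0 S.L) (θ : ℝ) : fderiv ℝ g (S.param s θ) (X3 (S.param s θ)) = 0 := by
  have h1 := hasDerivAt_comp_param (S := S) hg s θ
  rw [show (fun θ => g (S.param s θ)) = fun _ => g (S.param s 0) from funext (hz s hs)] at h1
  exact h1.unique (hasDerivAt_const _ _)

lemma IsZonal.fderiv_tangentS {g : E3 → ℝ} (hz : S.IsZonal g) (hg : ContDiff ℝ ∞ g) {s : ℝ}
    (hs : s ∈ Ioo 0 S.L) (θ : ℝ) :
    fderiv ℝ g (S.param s θ) (S.tangentS s θ) = deriv (fun s => g (S.param s 0)) s := by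
  rw [← (hasDerivAt_comp_param_left (S := S) hg s θ).deriv]
  refine Filter.EventuallyEq.deriv_eq ?_
  filter_upwards [Ioo_mem_nhds hs.1 hs.2] with t ht
  exact hz t (Ioo_subset_Icc_self ht) θ

variable (S)

lemma deriv_z_zero : deriv S.z 0 = 0 := by
  have h1 : deriv (fun x => S.z (-x)) 0 = -deriv S.z (-0) := deriv_comp_neg S.z 0
  rw [funext S.z_even] at h1
  simp at h1
  linarith

lemma deriv_z_L : deriv S.z S.L = 0 := by
  have h1 : deriv (fun x => S.z (2 * S.L - x)) S.L = -deriv S.z (2 * S.L - S.L) :=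
    deriv_comp_const_sub S.z (2 * S.L) S.L
  rw [funext S.z_even', show 2 * S.L - S.L = S.L by ring] at h1
  linarith

lemma deriv_r_zero : deriv S.r 0 ≠ 0 := by
  intro h
  have := S.arc_length 0
  rw [h, deriv_z_zero] at this
  norm_num at this

lemma deriv_r_L : deriv S.r S.L ≠ 0 := by
  intro h
  have := S.arc_length S.L
  rw [h, deriv_z_L] at this
  norm_num at this

variable {S}

/-- The quotient of functions vanishing at a point where the denominator has nonzero derivative. -/
lemma tendsto_div_of_hasDerivAt {u v : ℝ → ℝ} {a u' v' : ℝ} (hu : HasDerivAt u u' a)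
    (hv : HasDerivAt v v' a) (hu0 : u a = 0) (hv0 : v a = 0) (hv' : v' ≠ 0) :
    Filter.Tendsto (fun s => u s / v s) (𝓝[≠] a) (𝓝 (u' / v')) := by
  have h1 := (hasDerivAt_iff_tendsto_slope.1 hu).div (hasDerivAt_iff_tendsto_slope.1 hv) hv'
  refine h1.congr' ?_
  filter_upwards [self_mem_nhdsWithin] with s hs
  have : s - a ≠ 0 := sub_ne_zero.2 hs
  simp only [Pi.div_apply, slope_def_field, hu0, hv0, sub_zero]
  field_simp

/-- A function that is even about a point has a critical point there. -/
lemma deriv_eq_zero_of_even {G : ℝ → ℝ} {a : ℝ}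
    (h : ∀ᶠ s in 𝓝 a, G (2 * a - s) = G s) : deriv G a = 0 := by
  have h1 : deriv (fun x => G (2 * a - x)) a = -deriv G (2 * a - a) :=
    deriv_comp_const_sub G (2 * a) a
  rw [Filter.EventuallyEq.deriv_eq h, show 2 * a - a = a by ring] at h1
  linarith

/-- Along the meridian a zonal function is even about each pole, so its derivative vanishes there,
while r has a simple zero. The quotient therefore extends continuously to the poles. -/
lemma IsZonal.exists_ratio {g : E3 → ℝ} (hz : S.IsZonal g) (hg : ContDiff ℝ ∞ g) :
    ∃ κ : ℝ → ℝ, ContinuousOn κ (Icc 0 S.L) ∧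
      ∀ s ∈ Ioo 0 S.L, deriv (fun s => g (S.param s 0)) s = κ s * S.r s := by
  set G : ℝ → ℝ := fun s => g (S.param s 0) with hGdef
  have hp : ContDiff ℝ ∞ fun s => S.param s 0 := by
    have hr := S.r_smooth
    have hzs := S.z_smooth
    unfold param
    refine (PiLp.contDiff_toLp (p := 2)).comp (contDiff_pi.2 fun i => ?_)
    fin_cases i <;> simp <;> fun_prop
  have hG : ContDiff ℝ ∞ G := hg.comp hp
  have hG1 : ContDiff ℝ ∞ (deriv G) := ((contDiff_infty_iff_deriv).1 hG).2
  have hGd : ∀ s, HasDerivAt (deriv G) (deriv (deriv G) s) s := fun s =>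
    (hG1.differentiable (by simp)).differentiableAt.hasDerivAt
  -- Continued beyond a pole, the meridian θ = 0 becomes the opposite meridian θ = π, on which a
  -- zonal function takes the same values.
  have hneg : ∀ s, S.param (-s) 0 = S.param s Real.pi := by
    intro s
    simp [param, S.r_odd, S.z_even]
  have hrefl : ∀ s, S.param (2 * S.L - s) 0 = S.param s Real.pi := by
    intro s
    simp [param, S.r_odd', S.z_even']
  have hL := S.L_pos
  have e0 : deriv G 0 = 0 := by
    refine deriv_eq_zero_of_even ?_
    filter_upwards [Ioo_mem_nhds (show -S.L < 0 by linarith) hL] with s hs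
    simp only [hGdef, mul_zero, zero_sub]
    rcases le_total 0 s with h | h
    · rw [hneg, hz s ⟨h, hs.2.le⟩]
    · have := hz (-s) ⟨by linarith, by linarith [hs.1]⟩ Real.pi
      rw [← this, ← hneg, neg_neg]
  have eL : deriv G S.L = 0 := by
    refine deriv_eq_zero_of_even ?_
    filter_upwards [Ioo_mem_nhds hL (show S.L < 2 * S.L by linarith)] with s hs
    simp only [hGdef]
    rcases le_total s S.L with h | h
    · rw [hrefl, hz s ⟨hs.1.le, h⟩]
    · have := hz (2 * S.L - s) ⟨by linarith [hs.2], by linarith⟩ Real.pi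
      rw [← this, ← hrefl, sub_sub_cancel]
  refine ⟨extendFrom (Ioo 0 S.L) (fun s => deriv G s / S.r s),
    continuousOn_Icc_extendFrom_Ioo (fun s hs => ?_)
      ((tendsto_div_of_hasDerivAt (hGd 0) (S.hasDerivAt_r 0) e0 S.r_zero S.deriv_r_zero).mono_left
        (nhdsWithin_mono _ fun s (hs : 0 < s) => hs.ne'))
      ((tendsto_div_of_hasDerivAt (hGd S.L) (S.hasDerivAt_r S.L) eL S.r_L S.deriv_r_L).mono_left
        (nhdsWithin_mono _ fun s (hs : s < S.L) => hs.ne)), fun s hs => ?_⟩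
  · exact (hG1.continuous.continuousAt.div S.r_smooth.continuous.continuousAt
      (S.r_pos s hs).ne').continuousWithinAt
  · have hcont : ContinuousAt (fun s => deriv G s / S.r s) s :=
      hG1.continuous.continuousAt.div S.r_smooth.continuous.continuousAt (S.r_pos s hs).ne'
    rw [extendFrom_eq (by rw [closure_Ioo hL.ne]; exact Ioo_subset_Icc_self hs)
      (hcont.tendsto.mono_left nhdsWithin_le_nhds)]
    have := (S.r_pos s hs).ne'
    field_simp

/-- `ξ` is a potential of the rotation field: `J∇ξ = -X₃` on `M`. -/
def IsRotationPotential (S : SurfaceOfRevolution) (ξ : E3 → ℝ) : Prop :=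
  ∀ x ∈ S.carrier, S.J x (S.grad ξ x) = -X3 x

variable {ξ : E3 → ℝ}

lemma param_mem_carrier {s : ℝ} (hs : s ∈ Icc 0 S.L) (θ : ℝ) : S.param s θ ∈ S.carrier :=
  ⟨s, hs, θ, rfl⟩

lemma IsRotationPotential.isZonal (h : S.IsRotationPotential ξ) (hξ : ContDiff ℝ ∞ ξ) :
    S.IsZonal ξ :=
  isZonal_of_fderiv hξ fun _ hs θ => (S.fderiv_of_J_grad_eq_neg_X3 hs
    (h _ (param_mem_carrier (Ioo_subset_Icc_self hs) θ))).2

lemma IsRotationPotential.hasDerivAt (h : S.IsRotationPotential ξ) (hξ : ContDiff ℝ ∞ ξ) {s : ℝ}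
    (hs : s ∈ Ioo 0 S.L) : HasDerivAt (fun s => ξ (S.param s 0)) (S.r s) s := by
  have h1 := hasDerivAt_comp_param_left (S := S) hξ s 0
  rwa [(S.fderiv_of_J_grad_eq_neg_X3 hs
    (h _ (param_mem_carrier (Ioo_subset_Icc_self hs) 0))).1] at h1

lemma continuous_profile {g : E3 → ℝ} (hg : Continuous g) :
    Continuous fun s => g (S.param s 0) :=
  hg.comp (S.continuous_param.comp (by fun_prop : Continuous fun s : ℝ => (s, (0 : ℝ))))

lemma IsRotationPotential.strictMonoOn (h : S.IsRotationPotential ξ) (hξ : ContDiff ℝ ∞ ξ) :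
    StrictMonoOn (fun s => ξ (S.param s 0)) (Icc 0 S.L) :=
  strictMonoOn_of_hasDerivAt_pos (continuous_profile hξ.continuous).continuousOn
    (fun _ hs => h.hasDerivAt hξ hs) S.r_pos

lemma IsRotationPotential.image_carrier (h : S.IsRotationPotential ξ) (hξ : ContDiff ℝ ∞ ξ) :
    ξ '' S.carrier = Icc (ξ (S.param 0 0)) (ξ (S.param S.L 0)) := by
  rw [← image_Icc_of_strictMonoOn (X := fun s => ξ (S.param s 0)) S.L_pos.le
    (continuous_profile hξ.continuous).continuousOn (h.strictMonoOn hξ)]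
  ext y
  constructor
  · rintro ⟨_, ⟨s, hs, θ, rfl⟩, rfl⟩
    exact ⟨s, hs, (h.isZonal hξ s hs θ).symm⟩
  · rintro ⟨s, hs, rfl⟩
    exact ⟨_, param_mem_carrier hs 0, rfl⟩

/-- A smooth function `g = g₁(ξ)` on `M` has `g₁ ∈ C¹[α₀, α₁]` and `J∇g = -g₁'(ξ) X₃`. -/
lemma IsRotationPotential.profile (h : S.IsRotationPotential ξ) (hξ : ContDiff ℝ ∞ ξ) {α₀ α₁ : ℝ}
    (hα : ξ '' S.carrier = Icc α₀ α₁)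
    {g : E3 → ℝ} (hg : ContDiff ℝ ∞ g) {g₁ : ℝ → ℝ} (hg₁ : ∀ x ∈ S.carrier, g x = g₁ (ξ x)) :
    ContinuousOn (derivWithin g₁ (Icc α₀ α₁)) (Icc α₀ α₁) ∧
      ∀ s ∈ Ioo 0 S.L, ∀ θ, S.J (S.param s θ) (S.grad g (S.param s θ))
        = -(derivWithin g₁ (Icc α₀ α₁) (ξ (S.param s θ))) • X3 (S.param s θ) := by
  have hL := S.L_pos
  rw [← hα, h.image_carrier hξ]
  have hgz : S.IsZonal g := by
    intro s hs θ
    rw [hg₁ _ (param_mem_carrier hs θ), hg₁ _ (param_mem_carrier hs 0), h.isZonal hξ s hs θ]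
  obtain ⟨κ, hκ, hκr⟩ := hgz.exists_ratio hg
  have hgd : ∀ s, HasDerivAt (fun s => g (S.param s 0))
      (deriv (fun s => g (S.param s 0)) s) s := fun s =>
    (hasDerivAt_comp_param_left (S := S) hg s 0).differentiableAt.hasDerivAt
  have hX := continuous_profile (S := S) hξ.continuous
  obtain ⟨h1, h2⟩ := hasDerivWithinAt_of_ratio (g := g₁) (X := fun s => ξ (S.param s 0))
    (G := fun s => g (S.param s 0)) hL hX.continuousOn
    (continuous_profile hg.continuous).continuousOn hκ (fun s hs => h.hasDerivAt hξ hs) S.r_pos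
    (fun s hs => by rw [← hκr s hs]; exact hgd s)
    (fun s hs => (hg₁ _ (param_mem_carrier hs 0)).symm)
  refine ⟨h2, fun s hs θ => ?_⟩
  have hs' := Ioo_subset_Icc_self hs
  have hr := (S.r_pos s hs).ne'
  have hlt := h.strictMonoOn hξ (left_mem_Icc.2 hL.le) (right_mem_Icc.2 hL.le) hL
  have hmem : ξ (S.param s 0) ∈ Icc (ξ (S.param 0 0)) (ξ (S.param S.L 0)) := by
    rw [← h.image_carrier hξ]
    exact ⟨_, param_mem_carrier hs' 0, rfl⟩
  rw [S.J_grad_param hs (hgz.fderiv_X3 hg hs' θ), hgz.fderiv_tangentS hg hs, hκr s hs,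
    h.isZonal hξ s hs' θ, (h1 s hs').derivWithin (uniqueDiffOn_Icc hlt _ hmem),
    mul_div_cancel_right₀ _ hr]

/-- Along a meridian ξ is strictly increasing, so s is a function of ξ. -/
lemma IsRotationPotential.exists_profile (h : S.IsRotationPotential ξ) (hξ : ContDiff ℝ ∞ ξ)
    {g : E3 → ℝ} (hg : S.IsZonal g) : ∃ g₁ : ℝ → ℝ, ∀ x ∈ S.carrier, g x = g₁ (ξ x) := by
  refine ⟨fun y => g (S.param (Function.invFunOn (fun s => ξ (S.param s 0)) (Icc 0 S.L) y) 0), ?_⟩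
  rintro _ ⟨s, hs, θ, rfl⟩
  simp only
  rw [h.isZonal hξ s hs θ, hg s hs θ]
  have := (h.strictMonoOn hξ).injOn.leftInvOn_invFunOn hs
  rw [this]

lemma isZonal_laplacian {f w : E3 → ℝ} (hf : S.IsZonal f) (hw : S.IsLaplacian f w) :
    S.IsZonal w := by
  refine S.isZonal_of_interior fun s hs θ => ?_
  rw [hw s hs θ, hw s hs 0]
  have h1 : (fun τ => f (S.param s τ)) = fun _ => f (S.param s 0) :=
    funext (hf s (Ioo_subset_Icc_self hs))
  rw [h1]
  have h2 : ∀ t ∈ Ioo 0 S.L, deriv (fun t' => f (S.param t' θ)) t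
      = deriv (fun t' => f (S.param t' 0)) t := by
    intro t ht
    refine Filter.EventuallyEq.deriv_eq ?_
    filter_upwards [Ioo_mem_nhds ht.1 ht.2] with t' ht'
    exact hf t' (Ioo_subset_Icc_self ht') θ
  have h3 : deriv (fun t => S.r t * deriv (fun t' => f (S.param t' θ)) t) s
      = deriv (fun t => S.r t * deriv (fun t' => f (S.param t' 0)) t) s := by
    refine Filter.EventuallyEq.deriv_eq ?_
    filter_upwards [Ioo_mem_nhds hs.1 hs.2] with t ht
    rw [h2 t ht]
  rw [h3]
  simp only [iteratedDeriv_const]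

lemma isZonal_normal {χ : E3 → ℝ} (hχ : ∀ x ∈ S.carrier, χ x = S.normal x 2) : S.IsZonal χ := by
  intro s hs θ
  rw [hχ _ (param_mem_carrier hs θ), hχ _ (param_mem_carrier hs 0), S.normal_param hs,
    S.normal_param hs]
  simp [normalAt]

end SurfaceOfRevolution

/-! ### Weighted Poincaré inequalities -/

section Poincare

/-- Expand the nonnegative integral of (h - c)² with c the mean of h. -/
lemma sq_integral_le {s t : ℝ} (hst : s ≤ t) {h : ℝ → ℝ} (hh : Continuous h) :
    (∫ x in s..t, h x) ^ 2 ≤ (t - s) * ∫ x in s..t, h x ^ 2 := by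
  rcases eq_or_lt_of_le hst with rfl | hlt
  · simp
  have hpos : 0 < t - s := sub_pos.2 hlt
  set c := (∫ x in s..t, h x) / (t - s) with hc
  have h0 : 0 ≤ ∫ x in s..t, (h x - c) ^ 2 :=
    intervalIntegral.integral_nonneg hst fun x _ => sq_nonneg _
  have h1 : ∫ x in s..t, (h x - c) ^ 2
      = (∫ x in s..t, h x ^ 2) - 2 * c * (∫ x in s..t, h x) + (t - s) * c ^ 2 := by
    have : ∀ x, (h x - c) ^ 2 = h x ^ 2 - 2 * c * h x + c ^ 2 := fun x => by ring
    simp only [this]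
    rw [intervalIntegral.integral_add, intervalIntegral.integral_sub,
      intervalIntegral.integral_const_mul, intervalIntegral.integral_const, smul_eq_mul]
    all_goals exact Continuous.intervalIntegrable (by fun_prop) _ _
  rw [h1] at h0
  have h2 : (∫ x in s..t, h x) = c * (t - s) := by
    rw [hc]
    field_simp
  rw [h2] at h0 ⊢
  nlinarith

variable {a b R : ℝ} {ρ : ℝ → ℝ} {f f' : ℝ → ℂ}

/-- Cauchy–Schwarz bounds |f(s) - f(t)|² by the unweighted integral of |f'|² between s and t. The
hypothesis on ρ then exchanges the weights at the two ends for the weight under the integral, even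
where ρ vanishes at a or b. -/
lemma weight_mul_sq_sub_le (hab : a ≤ b) (hρ : Continuous ρ) (hρ0 : ∀ x ∈ Icc a b, 0 ≤ ρ x)
    (hR0 : 0 ≤ R)
    (hR : ∀ s ∈ Icc a b, ∀ t ∈ Icc a b, ∀ x ∈ Icc s t, ρ s * ρ t ≤ R * ρ x)
    (hf : ∀ x, HasDerivAt f (f' x) x) (hf' : Continuous f') {s t : ℝ} (hs : s ∈ Icc a b)
    (ht : t ∈ Icc a b) :
    ρ s * ρ t * ‖f s - f t‖ ^ 2 ≤ (b - a) * (R * ∫ x in a..b, ρ x * ‖f' x‖ ^ 2) := by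
  wlog hst : s ≤ t generalizing s t
  · have := this ht hs (le_of_not_ge hst)
    rwa [mul_comm (ρ t), norm_sub_rev] at this
  have hpos : 0 ≤ ρ s * ρ t := mul_nonneg (hρ0 s hs) (hρ0 t ht)
  have h1 : ‖f s - f t‖ ≤ ∫ x in s..t, ‖f' x‖ := by
    rw [norm_sub_rev, ← intervalIntegral.integral_eq_sub_of_hasDerivAt (fun x _ => hf x)
      (hf'.intervalIntegrable _ _)]
    exact intervalIntegral.norm_integral_le_integral_norm hst
  have h2 : ‖f s - f t‖ ^ 2 ≤ (t - s) * ∫ x in s..t, ‖f' x‖ ^ 2 :=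
    (pow_le_pow_left₀ (norm_nonneg _) h1 2).trans (sq_integral_le hst hf'.norm)
  have h3 : ρ s * ρ t * ∫ x in s..t, ‖f' x‖ ^ 2 ≤ R * ∫ x in a..b, ρ x * ‖f' x‖ ^ 2 := by
    rw [← intervalIntegral.integral_const_mul, ← intervalIntegral.integral_const_mul]
    calc ∫ x in s..t, ρ s * ρ t * ‖f' x‖ ^ 2
        ≤ ∫ x in s..t, R * (ρ x * ‖f' x‖ ^ 2) := by
          refine intervalIntegral.integral_mono_on hst
            (Continuous.intervalIntegrable (by fun_prop) _ _)
            (Continuous.intervalIntegrable (by fun_prop) _ _) fun x hx => ?_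
          rw [← mul_assoc]
          exact mul_le_mul_of_nonneg_right (hR s hs t ht x hx) (by positivity)
      _ ≤ ∫ x in a..b, R * (ρ x * ‖f' x‖ ^ 2) := by
          refine intervalIntegral.integral_mono_interval hs.1 hst ht.2 ?_
            (Continuous.intervalIntegrable (by fun_prop) _ _)
          refine (ae_restrict_iff' measurableSet_Ioc).2 (Filter.Eventually.of_forall fun x hx => ?_)
          exact mul_nonneg hR0 (mul_nonneg (hρ0 x (Ioc_subset_Icc_self hx)) (by positivity))
  have hE : 0 ≤ R * ∫ x in a..b, ρ x * ‖f' x‖ ^ 2 :=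
    mul_nonneg hR0 (intervalIntegral.integral_nonneg hab fun x hx =>
      mul_nonneg (hρ0 x hx) (by positivity))
  calc ρ s * ρ t * ‖f s - f t‖ ^ 2
      ≤ ρ s * ρ t * ((t - s) * ∫ x in s..t, ‖f' x‖ ^ 2) := mul_le_mul_of_nonneg_left h2 hpos
    _ = (t - s) * (ρ s * ρ t * ∫ x in s..t, ‖f' x‖ ^ 2) := by ring
    _ ≤ (t - s) * (R * ∫ x in a..b, ρ x * ‖f' x‖ ^ 2) :=
        mul_le_mul_of_nonneg_left h3 (sub_nonneg.2 hst)
    _ ≤ (b - a) * (R * ∫ x in a..b, ρ x * ‖f' x‖ ^ 2) :=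
        mul_le_mul_of_nonneg_right (by linarith [hs.1, ht.2]) hE

/-- The Poincaré inequality on an interval for a weight without interior minima. -/
lemma weighted_poincare (hab : a ≤ b) (hρ : Continuous ρ) (hρ0 : ∀ x ∈ Icc a b, 0 ≤ ρ x)
    (hR0 : 0 ≤ R)
    (hR : ∀ s ∈ Icc a b, ∀ t ∈ Icc a b, ∀ x ∈ Icc s t, ρ s * ρ t ≤ R * ρ x)
    (hf : ∀ x, HasDerivAt f (f' x) x) (hf' : Continuous f') :
    2 * (∫ x in a..b, ρ x) * ∫ x in a..b, ρ x * ‖f x‖ ^ 2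
      ≤ (b - a) ^ 3 * R * (∫ x in a..b, ρ x * ‖f' x‖ ^ 2)
        + 2 * ‖∫ x in a..b, (ρ x : ℂ) * f x‖ ^ 2 := by
  have hfc : Continuous f := continuous_iff_continuousAt.2 fun x => (hf x).continuousAt
  set m := ∫ x in a..b, ρ x
  set A := ∫ x in a..b, ρ x * ‖f x‖ ^ 2
  set B := ∫ x in a..b, (ρ x : ℂ) * f x with hB
  set E := ∫ x in a..b, ρ x * ‖f' x‖ ^ 2
  have hinner : ∀ w : ℂ, ∫ x in a..b, ρ x * inner ℝ (f x) w = inner ℝ B w := by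
    intro w
    have h1 := (innerSL ℝ w).intervalIntegral_comp_comm (μ := volume) (a := a) (b := b)
      (f := fun x => (ρ x : ℂ) * f x) (Continuous.intervalIntegrable (by fun_prop) _ _)
    rw [innerSL_apply_apply, ← hB, real_inner_comm] at h1
    rw [← h1]
    refine intervalIntegral.integral_congr fun x _ => ?_
    simp only [innerSL_apply_apply]
    rw [← Complex.real_smul, inner_smul_right, real_inner_comm]
  -- The double integral of ρ(s)ρ(t)|f(s) - f(t)|² equals 2mA - 2|B|²; it is computed here in s and
  -- below in t, and bounded pointwise afterwards.
  have hg : ∀ t, ∫ s in a..b, ρ s * ‖f s - f t‖ ^ 2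
      = A - 2 * inner ℝ B (f t) + m * ‖f t‖ ^ 2 := by
    intro t
    have : ∀ s, ρ s * ‖f s - f t‖ ^ 2
        = ρ s * ‖f s‖ ^ 2 - 2 * (ρ s * inner ℝ (f s) (f t)) + ρ s * ‖f t‖ ^ 2 := by
      intro s
      rw [norm_sub_sq_real]
      ring
    simp only [this]
    rw [intervalIntegral.integral_add, intervalIntegral.integral_sub,
      intervalIntegral.integral_const_mul, intervalIntegral.integral_mul_const, hinner]
    all_goals exact Continuous.intervalIntegrable (by fun_prop) _ _
  have hg2 : ∫ t in a..b, ρ t * (A - 2 * inner ℝ B (f t) + m * ‖f t‖ ^ 2)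
      = 2 * m * A - 2 * ‖B‖ ^ 2 := by
    have : ∀ t, ρ t * (A - 2 * inner ℝ B (f t) + m * ‖f t‖ ^ 2)
        = ρ t * A - 2 * (ρ t * inner ℝ (f t) B) + m * (ρ t * ‖f t‖ ^ 2) := by
      intro t
      rw [real_inner_comm]
      ring
    simp only [this]
    rw [intervalIntegral.integral_add, intervalIntegral.integral_sub,
      intervalIntegral.integral_const_mul, intervalIntegral.integral_const_mul,
      intervalIntegral.integral_mul_const, hinner, real_inner_self_eq_norm_sq]
    · ring
    all_goals exact Continuous.intervalIntegrable (by fun_prop) _ _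
  have hle : ∫ t in a..b, ρ t * (A - 2 * inner ℝ B (f t) + m * ‖f t‖ ^ 2)
      ≤ ∫ t in a..b, (b - a) * ((b - a) * (R * E)) := by
    refine intervalIntegral.integral_mono_on hab
      (Continuous.intervalIntegrable (by fun_prop) _ _) (by simp) fun t ht => ?_
    rw [← hg, ← intervalIntegral.integral_const_mul]
    calc ∫ s in a..b, ρ t * (ρ s * ‖f s - f t‖ ^ 2)
        ≤ ∫ s in a..b, (b - a) * (R * E) := by
          refine intervalIntegral.integral_mono_on hab
            (Continuous.intervalIntegrable (by fun_prop) _ _) (by simp) fun s hs => ?_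
          have := weight_mul_sq_sub_le hab hρ hρ0 hR0 hR hf hf' hs ht
          calc _ = ρ s * ρ t * ‖f s - f t‖ ^ 2 := by ring
            _ ≤ _ := this
      _ = _ := by rw [intervalIntegral.integral_const, smul_eq_mul]
  rw [hg2, intervalIntegral.integral_const, smul_eq_mul] at hle
  nlinarith

end Poincare

/-! ### Poincaré inequality on a coordinate rectangle -/

section Rectangle

variable {a b c d R Rm : ℝ} {ρ : ℝ → ℝ} {u us uθ : ℝ → ℝ → ℂ} {D : ℝ → ℝ → ℝ}

lemma hasDerivAt_weighted_integral (hρ : Continuous ρ)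
    (hu : Continuous fun p : ℝ × ℝ => u p.1 p.2)
    (huθ : Continuous fun p : ℝ × ℝ => uθ p.1 p.2)
    (hθ : ∀ s θ, HasDerivAt (fun θ => u s θ) (uθ s θ) θ) (θ : ℝ) :
    HasDerivAt (fun θ => ∫ s in a..b, (ρ s : ℂ) * u s θ)
      (∫ s in a..b, (ρ s : ℂ) * uθ s θ) θ := by
  have hK : IsCompact (uIcc a b ×ˢ Icc (θ - 1) (θ + 1)) := isCompact_uIcc.prod isCompact_Icc
  have hc : Continuous fun p : ℝ × ℝ => (ρ p.1 : ℂ) * uθ p.1 p.2 := by fun_prop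
  obtain ⟨C, hC⟩ := hK.exists_bound_of_continuousOn hc.continuousOn
  have hus : ∀ θ, Continuous fun s => (ρ s : ℂ) * u s θ := fun θ => by
    have : Continuous fun s : ℝ => u s θ := hu.comp (by fun_prop : Continuous fun s : ℝ => (s, θ))
    fun_prop
  have huθs : ∀ θ, Continuous fun s => (ρ s : ℂ) * uθ s θ := fun θ => by
    have : Continuous fun s : ℝ => uθ s θ :=
      huθ.comp (by fun_prop : Continuous fun s : ℝ => (s, θ))
    fun_prop
  refine (intervalIntegral.hasDerivAt_integral_of_dominated_loc_of_deriv_le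
    (F := fun θ s => (ρ s : ℂ) * u s θ) (F' := fun θ s => (ρ s : ℂ) * uθ s θ)
    (bound := fun _ => C) (s := Icc (θ - 1) (θ + 1))
    (Icc_mem_nhds (by linarith) (by linarith)) ?_ ?_ ?_ ?_ ?_ ?_).2
  · exact Filter.Eventually.of_forall fun θ => (hus θ).aestronglyMeasurable
  · exact (hus θ).intervalIntegrable _ _
  · exact (huθs θ).aestronglyMeasurable
  · exact Filter.Eventually.of_forall fun s hs t ht => hC (s, t) ⟨uIoc_subset_uIcc hs, ht⟩
  · exact intervalIntegrable_const
  · exact Filter.Eventually.of_forall fun s _ t _ => (hθ s t).const_mul _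

/-- A Poincaré inequality on a coordinate rectangle, with a sharp dependence on its sides. -/
lemma rectangle_poincare (hab : a ≤ b) (hcd : c < d) (hρ : Continuous ρ)
    (hρ0 : ∀ x ∈ Icc a b, 0 ≤ ρ x) (hR0 : 0 ≤ R)
    (hR : ∀ s ∈ Icc a b, ∀ t ∈ Icc a b, ∀ x ∈ Icc s t, ρ s * ρ t ≤ R * ρ x)
    (hRm : ∀ x ∈ Icc a b, ρ x ≤ R) (hm : 0 < ∫ x in a..b, ρ x)
    (hu : Continuous fun p : ℝ × ℝ => u p.1 p.2)
    (hus : Continuous fun p : ℝ × ℝ => us p.1 p.2)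
    (huθ : Continuous fun p : ℝ × ℝ => uθ p.1 p.2)
    (hD : Continuous fun p : ℝ × ℝ => D p.1 p.2)
    (hs : ∀ s θ, HasDerivAt (fun s => u s θ) (us s θ) s)
    (hθ : ∀ s θ, HasDerivAt (fun θ => u s θ) (uθ s θ) θ)
    (hsD : ∀ s ∈ Icc a b, ∀ θ, ‖us s θ‖ ≤ D s θ)
    (hθD : ∀ s ∈ Icc a b, ∀ θ, ‖uθ s θ‖ ≤ ρ s * D s θ) :
    ∫ θ in c..d, ∫ s in a..b, ρ s * ‖u s θ‖ ^ 2
      ≤ ((b - a) ^ 3 * R / (2 * ∫ x in a..b, ρ x) + (d - c) ^ 2 * R ^ 2) *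
          (∫ θ in c..d, ∫ s in a..b, ρ s * D s θ ^ 2)
        + (1 / ((∫ x in a..b, ρ x) * (d - c))) *
          ‖∫ θ in c..d, ∫ s in a..b, (ρ s : ℂ) * u s θ‖ ^ 2 := by
  set m := ∫ x in a..b, ρ x with hmdef
  have hdc : 0 < d - c := sub_pos.2 hcd
  have cu : Continuous (Function.uncurry fun θ s => ρ s * ‖u s θ‖ ^ 2) := by
    have : Continuous fun p : ℝ × ℝ => u p.2 p.1 := hu.comp continuous_swap
    simp only [Function.uncurry_def]
    fun_prop
  have cD : Continuous (Function.uncurry fun θ s => ρ s * D s θ ^ 2) := by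
    have : Continuous fun p : ℝ × ℝ => D p.2 p.1 := hD.comp continuous_swap
    simp only [Function.uncurry_def]
    fun_prop
  have cv : Continuous (Function.uncurry fun θ s => (ρ s : ℂ) * u s θ) := by
    have : Continuous fun p : ℝ × ℝ => u p.2 p.1 := hu.comp continuous_swap
    simp only [Function.uncurry_def]
    fun_prop
  have cvθ : Continuous (Function.uncurry fun θ s => (ρ s : ℂ) * uθ s θ) := by
    have : Continuous fun p : ℝ × ℝ => uθ p.2 p.1 := huθ.comp continuous_swap
    simp only [Function.uncurry_def]
    fun_prop
  have sl : ∀ {F : ℝ → ℝ → ℂ}, Continuous (fun p : ℝ × ℝ => F p.1 p.2) → ∀ θ,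
      Continuous fun s => F s θ := fun h θ =>
    h.comp (by fun_prop : Continuous fun s : ℝ => (s, θ))
  have slD : ∀ θ, Continuous fun s => D s θ := fun θ =>
    hD.comp (by fun_prop : Continuous fun s : ℝ => (s, θ))
  have Iu := intervalIntegral.continuous_parametric_intervalIntegral_of_continuous' (μ := volume)
    cu a b
  have ID := intervalIntegral.continuous_parametric_intervalIntegral_of_continuous' (μ := volume)
    cD a b
  have Iv := intervalIntegral.continuous_parametric_intervalIntegral_of_continuous' (μ := volume)
    cv a b
  have Ivθ := intervalIntegral.continuous_parametric_intervalIntegral_of_continuous' (μ := volume)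
    cvθ a b
  set v : ℝ → ℂ := fun θ => ∫ s in a..b, (ρ s : ℂ) * u s θ
  set v' : ℝ → ℂ := fun θ => ∫ s in a..b, (ρ s : ℂ) * uθ s θ
  set E : ℝ → ℝ := fun θ => ∫ s in a..b, ρ s * D s θ ^ 2
  -- For fixed θ the weighted inequality in s leaves only the average v(θ), to which the inequality
  -- in θ with weight 1 is applied next.
  have step1 : ∀ θ, ∫ s in a..b, ρ s * ‖u s θ‖ ^ 2
      ≤ (b - a) ^ 3 * R / (2 * m) * E θ + 1 / m * ‖v θ‖ ^ 2 := by
    intro θ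
    have h1 := weighted_poincare hab hρ hρ0 hR0 hR (fun s => hs s θ) (sl hus θ)
    have h2 : ∫ s in a..b, ρ s * ‖us s θ‖ ^ 2 ≤ E θ := by
      have hu1 := sl hus θ
      have hD1 := slD θ
      refine intervalIntegral.integral_mono_on hab
        (Continuous.intervalIntegrable (by fun_prop) _ _)
        (Continuous.intervalIntegrable (by fun_prop) _ _) fun s hs' => ?_
      exact mul_le_mul_of_nonneg_left (pow_le_pow_left₀ (norm_nonneg _) (hsD s hs' θ) 2)
        (hρ0 s hs')
    have h3 : 0 ≤ (b - a) ^ 3 * R := mul_nonneg (pow_nonneg (sub_nonneg.2 hab) 3) hR0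
    have h4 : 2 * m * ∫ s in a..b, ρ s * ‖u s θ‖ ^ 2
        ≤ (b - a) ^ 3 * R * E θ + 2 * ‖v θ‖ ^ 2 :=
      h1.trans (add_le_add_left (mul_le_mul_of_nonneg_left h2 h3) _)
    have h5 : (b - a) ^ 3 * R / (2 * m) * E θ + 1 / m * ‖v θ‖ ^ 2
        = ((b - a) ^ 3 * R * E θ + 2 * ‖v θ‖ ^ 2) / (2 * m) := by
      field_simp
    rw [h5, le_div_iff₀ (by positivity)]
    linarith
  have hv' : ∀ θ, ‖v' θ‖ ^ 2 ≤ m * R ^ 2 * E θ := by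
    intro θ
    have hu1 := sl huθ θ
    have hD1 := slD θ
    have h1 : ‖v' θ‖ ≤ ∫ s in a..b, ρ s * (R * D s θ) := by
      refine (intervalIntegral.norm_integral_le_integral_norm hab).trans ?_
      refine intervalIntegral.integral_mono_on hab
        (Continuous.intervalIntegrable (by fun_prop) _ _)
        (Continuous.intervalIntegrable (by fun_prop) _ _) fun s hs' => ?_
      rw [norm_mul, Complex.norm_real, Real.norm_of_nonneg (hρ0 s hs')]
      refine mul_le_mul_of_nonneg_left ((hθD s hs' θ).trans ?_) (hρ0 s hs')
      exact mul_le_mul_of_nonneg_right (hRm s hs') ((norm_nonneg _).trans (hsD s hs' θ))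
    have h2 : (∫ s in a..b, ρ s * (R * D s θ)) ^ 2 ≤ m * (R ^ 2 * E θ) := by
      -- Cauchy–Schwarz for the weight ρ: a nonnegative quadratic in x, evaluated at its minimum I /
      -- m.
      have key : ∀ x : ℝ, 0 ≤ m * x ^ 2 - 2 * (∫ s in a..b, ρ s * (R * D s θ)) * x
          + R ^ 2 * E θ := by
        intro x
        have h0 : 0 ≤ ∫ s in a..b, ρ s * (x - R * D s θ) ^ 2 :=
          intervalIntegral.integral_nonneg hab fun s hs' =>
            mul_nonneg (hρ0 s hs') (sq_nonneg _)
        have : ∀ s, ρ s * (x - R * D s θ) ^ 2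
            = ρ s * x ^ 2 - 2 * x * (ρ s * (R * D s θ)) + R ^ 2 * (ρ s * D s θ ^ 2) :=
          fun s => by ring
        simp only [this] at h0
        rw [intervalIntegral.integral_add, intervalIntegral.integral_sub,
          intervalIntegral.integral_mul_const, intervalIntegral.integral_const_mul,
          intervalIntegral.integral_const_mul] at h0
        · linarith
        all_goals exact Continuous.intervalIntegrable (by fun_prop) _ _
      generalize (∫ s in a..b, ρ s * (R * D s θ)) = I at key ⊢
      have h3 := key (I / m)
      have h4 : m * (I / m) ^ 2 - 2 * I * (I / m) + R ^ 2 * E θ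
          = (m * (R ^ 2 * E θ) - I ^ 2) / m := by
        field_simp
        ring
      rw [h4, le_div_iff₀ hm] at h3
      linarith
    calc ‖v' θ‖ ^ 2 ≤ (∫ s in a..b, ρ s * (R * D s θ)) ^ 2 :=
          pow_le_pow_left₀ (norm_nonneg _) h1 2
      _ ≤ m * (R ^ 2 * E θ) := h2
      _ = _ := by ring
  have step2 : ∫ θ in c..d, ‖v θ‖ ^ 2
      ≤ (d - c) ^ 2 * (m * R ^ 2 * ∫ θ in c..d, E θ) + 1 / (d - c) * ‖∫ θ in c..d, v θ‖ ^ 2 := by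
    have h1 := weighted_poincare (a := c) (b := d) (R := 1) (ρ := fun _ => 1) (f := v) (f' := v')
      hcd.le continuous_const (fun _ _ => zero_le_one) zero_le_one (fun _ _ _ _ _ _ => le_rfl)
      (fun θ => hasDerivAt_weighted_integral hρ hu huθ hθ θ) Ivθ
    simp only [intervalIntegral.integral_const, smul_eq_mul, mul_one, one_mul,
      Complex.ofReal_one] at h1
    have h2 : ∫ θ in c..d, ‖v' θ‖ ^ 2 ≤ m * R ^ 2 * ∫ θ in c..d, E θ := by
      rw [← intervalIntegral.integral_const_mul]
      exact intervalIntegral.integral_mono_on hcd.le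
        (Continuous.intervalIntegrable (by fun_prop) _ _)
        (Continuous.intervalIntegrable (by fun_prop) _ _) fun θ _ => hv' θ
    have hE0 : 0 ≤ ∫ θ in c..d, ‖v' θ‖ ^ 2 :=
      intervalIntegral.integral_nonneg hcd.le fun θ _ => by positivity
    -- A factor 2 is given away here; only the order in d - c matters.
    have h3 : (d - c) ^ 3 * (∫ θ in c..d, ‖v' θ‖ ^ 2)
        ≤ 2 * ((d - c) ^ 3 * (m * R ^ 2 * ∫ θ in c..d, E θ)) := by
      have h5 : (d - c) ^ 3 * (∫ θ in c..d, ‖v' θ‖ ^ 2)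
        ≤ (d - c) ^ 3 * (m * R ^ 2 * ∫ θ in c..d, E θ) :=
        mul_le_mul_of_nonneg_left h2 (pow_nonneg hdc.le 3)
      have h6 : 0 ≤ (d - c) ^ 3 * (∫ θ in c..d, ‖v' θ‖ ^ 2) :=
        mul_nonneg (pow_nonneg hdc.le 3) hE0
      linarith
    have h4 : (d - c) * ∫ θ in c..d, ‖v θ‖ ^ 2
        ≤ (d - c) ^ 3 * (m * R ^ 2 * ∫ θ in c..d, E θ) + ‖∫ θ in c..d, v θ‖ ^ 2 := by
      linarith
    have h5 : (d - c) ^ 2 * (m * R ^ 2 * ∫ θ in c..d, E θ) + 1 / (d - c) * ‖∫ θ in c..d, v θ‖ ^ 2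
        = ((d - c) ^ 3 * (m * R ^ 2 * ∫ θ in c..d, E θ) + ‖∫ θ in c..d, v θ‖ ^ 2) / (d - c) := by
      field_simp
    rw [h5, le_div_iff₀ hdc]
    linarith
  calc ∫ θ in c..d, ∫ s in a..b, ρ s * ‖u s θ‖ ^ 2
      ≤ ∫ θ in c..d, ((b - a) ^ 3 * R / (2 * m) * E θ + 1 / m * ‖v θ‖ ^ 2) :=
        intervalIntegral.integral_mono_on hcd.le (Iu.intervalIntegrable _ _)
          (Continuous.intervalIntegrable (by fun_prop) _ _) fun θ _ => step1 θ
    _ = (b - a) ^ 3 * R / (2 * m) * (∫ θ in c..d, E θ) + 1 / m * ∫ θ in c..d, ‖v θ‖ ^ 2 := by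
        rw [intervalIntegral.integral_add, intervalIntegral.integral_const_mul,
          intervalIntegral.integral_const_mul]
        all_goals exact Continuous.intervalIntegrable (by fun_prop) _ _
    _ ≤ (b - a) ^ 3 * R / (2 * m) * (∫ θ in c..d, E θ) + 1 / m *
          ((d - c) ^ 2 * (m * R ^ 2 * ∫ θ in c..d, E θ) + 1 / (d - c) * ‖∫ θ in c..d, v θ‖ ^ 2) :=
        add_le_add_right (mul_le_mul_of_nonneg_left step2 (by positivity)) _
    _ = _ := by
        generalize (∫ θ in c..d, E θ) = I
        field_simp
        ring

end Rectangle

/-! ### Iterated integrals over rectangles -/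

section IteratedIntegrals

lemma setIntegral_rectangle {E : Type*} [NormedAddCommGroup E] [NormedSpace ℝ E]
    {a b c d : ℝ} (hab : a ≤ b) (hcd : c ≤ d) {F : ℝ × ℝ → E} (hF : Continuous F) :
    ∫ p in Ioc a b ×ˢ Ioc c d, F p = ∫ θ in c..d, ∫ s in a..b, F (s, θ) := by
  have hI : IntegrableOn F (Ioc a b ×ˢ Ioc c d) :=
    (hF.continuousOn.integrableOn_compact (isCompact_Icc.prod isCompact_Icc)).mono_set
      (prod_mono Ioc_subset_Icc_self Ioc_subset_Icc_self)
  rw [IntegrableOn, Measure.volume_eq_prod, ← Measure.prod_restrict] at hI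
  rw [Measure.volume_eq_prod, ← Measure.prod_restrict, integral_prod_symm _ hI,
    intervalIntegral.integral_of_le hcd]
  simp only [intervalIntegral.integral_of_le hab]

lemma sum_integral_rectangles {F : ℝ → ℝ → ℝ} (hF : Continuous (Function.uncurry F))
    (α β : ℕ → ℝ) (n m : ℕ) :
    ∑ i ∈ Finset.range n, ∑ j ∈ Finset.range m,
        ∫ θ in β j..β (j + 1), ∫ s in α i..α (i + 1), F θ s
      = ∫ θ in β 0..β m, ∫ s in α 0..α n, F θ s := by
  have hc : ∀ x y, Continuous fun θ => ∫ s in x..y, F θ s := fun x y =>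
    intervalIntegral.continuous_parametric_intervalIntegral_of_continuous' hF x y
  have h1 : ∀ i, ∑ j ∈ Finset.range m, ∫ θ in β j..β (j + 1), ∫ s in α i..α (i + 1), F θ s
      = ∫ θ in β 0..β m, ∫ s in α i..α (i + 1), F θ s := fun i =>
    intervalIntegral.sum_integral_adjacent_intervals
      fun k _ => (hc (α i) (α (i + 1))).intervalIntegrable _ _
  simp only [h1]
  rw [← intervalIntegral.integral_finsetSum fun i _ => (hc _ _).intervalIntegrable _ _]
  refine intervalIntegral.integral_congr fun θ _ => ?_
  exact intervalIntegral.sum_integral_adjacent_intervals fun k _ =>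
    (hF.comp (by fun_prop : Continuous fun s : ℝ => (θ, s))).intervalIntegrable _ _

lemma continuous_weight_mul_sq {ρ : ℝ → ℝ} {D : ℝ → ℝ → ℝ} (hρ : Continuous ρ)
    (hD : Continuous fun p : ℝ × ℝ => D p.1 p.2) :
    Continuous (Function.uncurry fun θ s => ρ s * D s θ ^ 2) := by
  have : Continuous fun p : ℝ × ℝ => D p.2 p.1 := hD.comp continuous_swap
  simp only [Function.uncurry_def]
  fun_prop

end IteratedIntegrals

/-! ### Concavity of the radius and the Poincaré inequality on cells of M -/

namespace SurfaceOfRevolution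

variable (S : SurfaceOfRevolution)

/-- The Gauss curvature is -r''/r away from the poles, so its positivity gives r'' < 0 there. -/
lemma concaveOn_r : ConcaveOn ℝ (Icc 0 S.L) S.r := by
  have hd : ContDiff ℝ ∞ (deriv S.r) := ((contDiff_infty_iff_deriv).1 S.r_smooth).2
  refine concaveOn_of_deriv2_nonpos (convex_Icc _ _) S.r_smooth.continuous.continuousOn
    (S.r_smooth.differentiable (by simp)).differentiableOn
    (hd.differentiable (by simp)).differentiableOn fun s hs => ?_
  rw [interior_Icc] at hs
  have h := S.curvature_pos s (Ioo_subset_Icc_self hs)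
  have hr := S.r_pos s hs
  rw [if_neg hr.ne', iteratedDeriv_eq_iterate] at h
  have := (div_pos_iff_of_pos_right hr).1 h
  linarith

lemma exists_r_le : ∃ R : ℝ, 0 < R ∧ ∀ s ∈ Icc 0 S.L, S.r s ≤ R := by
  obtain ⟨C, hC⟩ := isCompact_Icc.exists_bound_of_continuousOn
    (S.r_smooth.continuous.continuousOn (s := Icc 0 S.L))
  refine ⟨|C| + 1, by positivity, fun s hs => ?_⟩
  have := hC s hs
  rw [Real.norm_eq_abs] at this
  linarith [le_abs_self (S.r s), le_abs_self C]

/-- By concavity r(x) is at least the smaller of the two end values, and the larger one is at most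
R. -/
lemma r_mul_r_le {R : ℝ} (hR : ∀ s ∈ Icc 0 S.L, S.r s ≤ R) {s t x : ℝ} (hs : s ∈ Icc 0 S.L)
    (ht : t ∈ Icc 0 S.L) (hx : x ∈ Icc s t) : S.r s * S.r t ≤ R * S.r x := by
  have h1 := S.concaveOn_r.min_le_of_mem_Icc hs ht hx
  have h2 : S.r s * S.r t = max (S.r s) (S.r t) * min (S.r s) (S.r t) := (max_mul_min _ _).symm
  rw [h2]
  exact mul_le_mul (max_le (hR s hs) (hR t ht)) h1
    (le_min (S.r_nonneg hs) (S.r_nonneg ht)) ((S.r_nonneg hs).trans (hR s hs))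

/-- The concave function r lies above its chords from the poles to the midpoint L/2. -/
lemma exists_le_r : ∃ c : ℝ, 0 < c ∧ ∀ s ∈ Icc 0 S.L, c * min s (S.L - s) ≤ S.r s := by
  have hL := S.L_pos
  have hmid := S.r_pos (S.L / 2) ⟨by linarith, by linarith⟩
  have hM : S.L / 2 ∈ Icc 0 S.L := ⟨by linarith, by linarith⟩
  refine ⟨S.r (S.L / 2) * (2 / S.L), by positivity, fun s hs => ?_⟩
  rcases le_total s (S.L / 2) with h | h
  · rw [min_eq_left (by linarith)]
    have h1 := S.concaveOn_r.2 (left_mem_Icc.2 hL.le) hM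
      (show 0 ≤ 1 - s * (2 / S.L) by
        have : s * (2 / S.L) ≤ S.L / 2 * (2 / S.L) :=
          mul_le_mul_of_nonneg_right h (by positivity)
        have h2 : S.L / 2 * (2 / S.L) = 1 := by field_simp
        linarith) (show 0 ≤ s * (2 / S.L) from mul_nonneg hs.1 (by positivity)) (by ring)
    rw [S.r_zero] at h1
    simp only [smul_eq_mul, mul_zero, zero_add] at h1
    have h3 : s * (2 / S.L) * (S.L / 2) = s := by field_simp
    rw [h3] at h1
    linarith
  · rw [min_eq_right (by linarith)]
    have h1 := S.concaveOn_r.2 (right_mem_Icc.2 hL.le) hM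
      (show 0 ≤ 1 - (S.L - s) * (2 / S.L) by
        have : (S.L - s) * (2 / S.L) ≤ S.L / 2 * (2 / S.L) :=
          mul_le_mul_of_nonneg_right (by linarith) (by positivity)
        have h2 : S.L / 2 * (2 / S.L) = 1 := by field_simp
        linarith) (show 0 ≤ (S.L - s) * (2 / S.L) from
        mul_nonneg (by linarith [hs.2]) (by positivity)) (by ring)
    rw [S.r_L] at h1
    simp only [smul_eq_mul, mul_zero, zero_add] at h1
    have h3 : (1 - (S.L - s) * (2 / S.L)) * S.L + (S.L - s) * (2 / S.L) * (S.L / 2) = s := by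
      field_simp
      ring
    rw [h3] at h1
    linarith

/-- On the middle half of [a, b], of length (b - a)/2, the distance to both 0 and L is at least (b -
a)/4. So the mass of a cell is at least quadratic in its width, also next to a pole. -/
lemma le_integral_r {c : ℝ} (hc : 0 < c) (hr : ∀ s ∈ Icc 0 S.L, c * min s (S.L - s) ≤ S.r s)
    {a b : ℝ} (ha : 0 ≤ a) (hab : a ≤ b) (hb : b ≤ S.L) :
    c * (b - a) ^ 2 / 8 ≤ ∫ s in a..b, S.r s := by
  have hrc := S.r_smooth.continuous
  have h1 : ∫ s in (a + (b - a) / 4)..(b - (b - a) / 4), c * ((b - a) / 4)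
      ≤ ∫ s in (a + (b - a) / 4)..(b - (b - a) / 4), S.r s := by
    refine intervalIntegral.integral_mono_on (by linarith) (by simp)
      (hrc.intervalIntegrable _ _) fun s hs => ?_
    have hs' : s ∈ Icc 0 S.L := ⟨by linarith [hs.1], by linarith [hs.2]⟩
    refine le_trans (mul_le_mul_of_nonneg_left ?_ hc.le) (hr s hs')
    exact le_min (by linarith [hs.1]) (by linarith [hs.2])
  have h2 : ∫ s in (a + (b - a) / 4)..(b - (b - a) / 4), S.r s ≤ ∫ s in a..b, S.r s := by
    refine intervalIntegral.integral_mono_interval (by linarith) (by linarith) (by linarith) ?_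
      (hrc.intervalIntegrable _ _)
    refine (ae_restrict_iff' measurableSet_Ioc).2 (Filter.Eventually.of_forall fun s hs => ?_)
    exact S.r_nonneg ⟨by linarith [hs.1], by linarith [hs.2]⟩
  rw [intervalIntegral.integral_const, smul_eq_mul] at h1
  refine le_trans (le_of_eq ?_) (h1.trans h2)
  ring

lemma continuous_tangentS : Continuous fun p : ℝ × ℝ => S.tangentS p.1 p.2 := by
  have hr : Continuous (deriv S.r) := S.r_smooth.continuous_deriv (by simp)
  have hz : Continuous (deriv S.z) := S.z_smooth.continuous_deriv (by simp)
  unfold tangentS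
  refine (PiLp.continuous_toLp 2 _).comp (continuous_pi fun i => ?_)
  fin_cases i <;> simp <;> fun_prop

lemma integral_area_eq_iterated {F : E3 → ℝ} (hF : ContinuousOn F S.carrier) :
    ∫ x, F x ∂S.area = ∫ θ in (0 : ℝ)..2 * Real.pi, ∫ s in (0 : ℝ)..S.L,
      S.r s * F (S.param (projIcc 0 S.L S.L_pos.le s) θ) := by
  have hL := S.L_pos.le
  have hc : Continuous fun p : ℝ × ℝ => F (S.param (projIcc 0 S.L hL p.1) p.2) :=
    hF.comp_continuous (S.continuous_param.comp
      (by fun_prop : Continuous fun p : ℝ × ℝ => ((projIcc 0 S.L hL p.1 : ℝ), p.2)))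
      fun p => param_mem_carrier (projIcc 0 S.L hL p.1).2 p.2
  have hr := S.r_smooth.continuous
  rw [S.integral_area (S.aestronglyMeasurable_of_continuousOn hF),
    ← setIntegral_rectangle (F := fun p : ℝ × ℝ =>
      S.r p.1 * F (S.param (projIcc 0 S.L S.L_pos.le p.1) p.2)) hL Real.two_pi_pos.le
      ((hr.comp continuous_fst).mul hc)]
  refine setIntegral_congr_fun S.measurableSet_box fun p hp => ?_
  simp only [smul_eq_mul]
  rw [projIcc_of_mem hL (Ioc_subset_Icc_self hp.1)]

set_option maxHeartbeats 400000 in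
/-- The Poincaré inequality on `M` relative to a decomposition into `n²` coordinate rectangles. -/
lemma cell_poincare {R c : ℝ} (hR0 : 0 < R) (hR : ∀ s ∈ Icc 0 S.L, S.r s ≤ R) (hc0 : 0 < c)
    (hc : ∀ s ∈ Icc 0 S.L, c * min s (S.L - s) ≤ S.r s) {n : ℕ} (hn : 0 < n)
    {φ : E3 → ℂ} (hφ : ContDiff ℝ ∞ φ) :
    ∫ x, ‖φ x‖ ^ 2 ∂S.area
      ≤ (4 * R / c * (S.L / n) + (2 * Real.pi / n) ^ 2 * R ^ 2)
          * ∫ x, ‖S.gradC φ x‖ ^ 2 ∂S.area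
        + (1 / (c * (S.L / n) ^ 2 / 8 * (2 * Real.pi / n))) *
          ∑ i ∈ Finset.range n, ∑ j ∈ Finset.range n,
            ‖∫ p in Ioc (S.L / n * i) (S.L / n * (i + 1)) ×ˢ
              Ioc (2 * Real.pi / n * j) (2 * Real.pi / n * (j + 1)),
              φ (S.param p.1 p.2) ∂S.paramMeasure‖ ^ 2 := by
  have hL := S.L_pos
  have hn' : (0 : ℝ) < n := Nat.cast_pos.2 hn
  have hpi := Real.two_pi_pos
  set h := S.L / n with hh
  set k := 2 * Real.pi / n with hk
  have hh0 : 0 < h := by positivity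
  have hk0 : 0 < k := by positivity
  -- Continuity of the gradient is available only on M, so s is clamped to [0, L].
  let D : ℝ → ℝ → ℝ := fun s θ => ‖S.gradC φ (S.param (projIcc 0 S.L hL.le s) θ)‖
  let u : ℝ → ℝ → ℂ := fun s θ => φ (S.param s θ)
  let us : ℝ → ℝ → ℂ := fun s θ => fderiv ℝ φ (S.param s θ) (S.tangentS s θ)
  let uθ : ℝ → ℝ → ℂ := fun s θ => fderiv ℝ φ (S.param s θ) (X3 (S.param s θ))
  have hr := S.r_smooth.continuous
  have hDc : Continuous fun p : ℝ × ℝ => D p.1 p.2 := by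
    refine ((S.continuousOn_gradC hφ).comp_continuous (S.continuous_param.comp
      (by fun_prop : Continuous fun p : ℝ × ℝ => ((projIcc 0 S.L hL.le p.1 : ℝ), p.2)))
      fun p => param_mem_carrier (projIcc 0 S.L hL.le p.1).2 p.2).norm
  have huc : Continuous fun p : ℝ × ℝ => u p.1 p.2 := hφ.continuous.comp S.continuous_param
  have husc : Continuous fun p : ℝ × ℝ => us p.1 p.2 :=
    ((hφ.continuous_fderiv (by simp)).comp S.continuous_param).clm_apply S.continuous_tangentS
  have huθc : Continuous fun p : ℝ × ℝ => uθ p.1 p.2 :=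
    (continuous_X3_deriv hφ).comp S.continuous_param
  have hus : ∀ s θ, HasDerivAt (fun s => u s θ) (us s θ) s := fun s θ =>
    ((hφ.differentiable (by simp)).differentiableAt.hasFDerivAt).comp_hasDerivAt s
      (S.hasDerivAt_param_left s θ)
  have huθ : ∀ s θ, HasDerivAt (fun θ => u s θ) (uθ s θ) θ := fun s θ =>
    ((hφ.differentiable (by simp)).differentiableAt.hasFDerivAt).comp_hasDerivAt θ
      (S.hasDerivAt_param s θ)
  have husD : ∀ s ∈ Icc 0 S.L, ∀ θ, ‖us s θ‖ ≤ D s θ := by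
    intro s hs θ
    have h1 := S.norm_fderiv_le_gradC (φ := φ) (S.inner_normal_tangentS hs θ)
    rw [norm_tangentS, one_mul] at h1
    simp only [D, us]
    rwa [projIcc_of_mem hL.le hs]
  have huθD : ∀ s ∈ Icc 0 S.L, ∀ θ, ‖uθ s θ‖ ≤ S.r s * D s θ := by
    intro s hs θ
    have h1 := S.norm_fderiv_le_gradC (φ := φ) (S.inner_normal_X3 (param_mem_carrier hs θ))
    rw [S.norm_X3_param hs] at h1
    simp only [D, uθ]
    rwa [projIcc_of_mem hL.le hs]
  have hφ2 : ∫ x, ‖φ x‖ ^ 2 ∂S.area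
      = ∫ θ in (0 : ℝ)..2 * Real.pi, ∫ s in (0 : ℝ)..S.L, S.r s * ‖u s θ‖ ^ 2 := by
    rw [S.integral_area_eq_iterated (F := fun x => ‖φ x‖ ^ 2)
      (hφ.continuous.norm.pow 2).continuousOn]
    refine intervalIntegral.integral_congr fun θ _ => ?_
    refine intervalIntegral.integral_congr fun s hs => ?_
    rw [uIcc_of_le hL.le] at hs
    simp only [u]
    rw [projIcc_of_mem hL.le hs]
  have hD2 : ∫ x, ‖S.gradC φ x‖ ^ 2 ∂S.area
      = ∫ θ in (0 : ℝ)..2 * Real.pi, ∫ s in (0 : ℝ)..S.L, S.r s * D s θ ^ 2 :=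
    S.integral_area_eq_iterated ((S.continuousOn_gradC hφ).norm.pow 2)
  have cu : Continuous (Function.uncurry fun θ s => S.r s * ‖u s θ‖ ^ 2) :=
    continuous_weight_mul_sq (D := fun s θ => ‖u s θ‖) hr huc.norm
  have cD : Continuous (Function.uncurry fun θ s => S.r s * D s θ ^ 2) :=
    continuous_weight_mul_sq hr hDc
  let α : ℕ → ℝ := fun i => h * i
  let β : ℕ → ℝ := fun j => k * j
  have hα0 : α 0 = 0 := by simp [α]
  have hαn : α n = S.L := by simp only [α, hh]; field_simp
  have hβ0 : β 0 = 0 := by simp [β]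
  have hβn : β n = 2 * Real.pi := by simp only [β, hk]; field_simp
  have hsumu := sum_integral_rectangles cu α β n n
  have hsumD := sum_integral_rectangles cD α β n n
  rw [hα0, hαn, hβ0, hβn] at hsumu hsumD
  rw [hφ2, hD2, ← hsumu, ← hsumD, Finset.mul_sum, Finset.mul_sum, ← Finset.sum_add_distrib]
  refine Finset.sum_le_sum fun i hi => ?_
  rw [Finset.mul_sum, Finset.mul_sum, ← Finset.sum_add_distrib]
  refine Finset.sum_le_sum fun j hj => ?_
  rw [Finset.mem_range] at hi hj
  have hcast : ∀ l : ℕ, l < n → (l : ℝ) + 1 ≤ n := fun l hl => by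
    rw [← Nat.cast_add_one]
    exact Nat.cast_le.2 hl
  have hi' := hcast i hi
  have hj' := hcast j hj
  have hα1 : α (i + 1) = h * (i + 1) := by simp [α]
  have hβ1 : β (j + 1) = k * (j + 1) := by simp [β]
  have ha0 : 0 ≤ α i := by positivity
  have hb0 : 0 ≤ β j := by positivity
  have hab : α i ≤ α (i + 1) := by rw [hα1]; simp only [α]; nlinarith
  have hcd : β j < β (j + 1) := by rw [hβ1]; simp only [β]; nlinarith
  have hbL : α (i + 1) ≤ S.L := by
    rw [hα1, ← hαn]
    exact mul_le_mul_of_nonneg_left hi' hh0.le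
  have hdpi : β (j + 1) ≤ 2 * Real.pi := by
    rw [hβ1, ← hβn]
    exact mul_le_mul_of_nonneg_left hj' hk0.le
  have hsubI : Icc (α i) (α (i + 1)) ⊆ Icc 0 S.L := Icc_subset_Icc ha0 hbL
  have hm := S.le_integral_r hc0 hc ha0 hab hbL
  have hlen : α (i + 1) - α i = h := by rw [hα1]; simp only [α]; ring
  have hlen' : β (j + 1) - β j = k := by rw [hβ1]; simp only [β]; ring
  rw [hlen] at hm
  have hm0 : 0 < c * h ^ 2 / 8 := by positivity
  have hrect := rectangle_poincare (u := u) (us := us) (uθ := uθ) (D := D) hab hcd hr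
    (fun x hx => S.r_nonneg (hsubI hx)) hR0.le
    (fun s hs t ht x hx => S.r_mul_r_le hR (hsubI hs) (hsubI ht) hx)
    (fun x hx => hR x (hsubI hx)) (hm0.trans_le hm) huc husc huθc hDc hus huθ
    (fun s hs θ => husD s (hsubI hs) θ) (fun s hs θ => huθD s (hsubI hs) θ)
  rw [hlen, hlen'] at hrect
  have hQ : ∫ p in Ioc (h * i) (h * (i + 1)) ×ˢ Ioc (k * j) (k * (j + 1)),
      φ (S.param p.1 p.2) ∂S.paramMeasure
      = ∫ θ in β j..β (j + 1), ∫ s in α i..α (i + 1), (S.r s : ℂ) * u s θ := by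
    rw [← hα1, ← hβ1]
    rw [S.integral_paramMeasure _ _ (measurableSet_Ioc.prod measurableSet_Ioc)
      (prod_mono (Ioc_subset_Ioc ha0 hbL) (Ioc_subset_Ioc hb0 hdpi)),
      ← setIntegral_rectangle (F := fun p : ℝ × ℝ => (S.r p.1 : ℂ) * u p.1 p.2) hab hcd.le
        (by fun_prop)]
    simp only [Complex.real_smul, α, β, u]
  rw [hQ]
  have hED : 0 ≤ ∫ θ in β j..β (j + 1), ∫ s in α i..α (i + 1), S.r s * D s θ ^ 2 :=
    intervalIntegral.integral_nonneg hcd.le fun θ _ =>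
      intervalIntegral.integral_nonneg hab fun s hs =>
        mul_nonneg (S.r_nonneg (hsubI hs)) (by positivity)
  refine hrect.trans (add_le_add (mul_le_mul_of_nonneg_right (add_le_add_left ?_ _) hED)
    (mul_le_mul_of_nonneg_right ?_ (by positivity)))
  -- Dividing h³ by a mass of at least ch²/8 leaves a bound linear in h, uniform over all cells.
  · calc h ^ 3 * R / (2 * ∫ x in α i..α (i + 1), S.r x) ≤ h ^ 3 * R / (2 * (c * h ^ 2 / 8)) :=
          div_le_div_of_nonneg_left (by positivity) (by positivity) (by linarith)
      _ = 4 * R / c * h := by field_simp; ring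
  · exact one_div_le_one_div_of_le (by positivity) (mul_le_mul_of_nonneg_right hm hk0.le)

end SurfaceOfRevolution

/-! ### A compactness criterion -/

/-- An operator that is, up to an arbitrarily small error, controlled by finitely many functionals
is compact. -/
lemma isCompactOperator_of_finite_control {H H' : Type*} [NormedAddCommGroup H] [NormedSpace ℂ H]
    [NormedAddCommGroup H'] [NormedSpace ℂ H'] [CompleteSpace H'] (T : H →L[ℂ] H')
    (h : ∀ ε > 0, ∃ (ι : Type) (_ : Fintype ι) (C : ℝ) (M : ι → H →L[ℂ] ℂ), 0 ≤ C ∧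
      ∀ x, ‖T x‖ ^ 2 ≤ ε * ‖x‖ ^ 2 + C * ∑ i, ‖M i x‖ ^ 2) : IsCompactOperator T := by
  refine (isCompactOperator_iff_isCompact_closure_image_closedBall (T : H →ₗ[ℂ] H')
    one_pos).2 ?_
  refine (TotallyBounded.closure ?_).isCompact_of_isClosed isClosed_closure
  rw [Metric.totallyBounded_iff]
  intro δ hδ
  -- Two points of the unit ball differ by at most 2, so the first term contributes at most δ²/4.
  -- The mesh δ/(2(n + 1)) below makes the functionals contribute at most another δ²/4.
  obtain ⟨ι, hι, C, M, hC, hM⟩ := h (δ ^ 2 / 16) (by positivity)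
  let P : H →L[ℂ] (ι → ℂ) := ContinuousLinearMap.pi M
  have hb : TotallyBounded (P '' Metric.closedBall 0 1) :=
    (P.lipschitz.isBounded_image
      Metric.isBounded_closedBall).isCompact_closure.totallyBounded.subset subset_closure
  set n : ℝ := C * Fintype.card ι + 1 with hn
  have hn0 : 0 < n := by positivity
  obtain ⟨t, hts, htf, htc⟩ := Metric.finite_approx_of_totallyBounded hb (δ / (2 * (n + 1)))
    (by positivity)
  have hts' : ∀ y ∈ t, ∃ x, x ∈ Metric.closedBall (0 : H) 1 ∧ P x = y := fun y hy => hts hy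
  choose! g hg1 hg2 using hts'
  refine ⟨(fun y => T (g y)) '' t, htf.image _, ?_⟩
  rintro _ ⟨x, hx, rfl⟩
  have hxP := htc ⟨x, hx, rfl⟩
  simp only [mem_iUnion, Metric.mem_ball, exists_prop] at hxP ⊢
  obtain ⟨y, hy, hxy⟩ := hxP
  refine ⟨_, ⟨y, hy, rfl⟩, ?_⟩
  have hgy := hg1 y hy
  rw [← hg2 y hy, dist_eq_norm, ← map_sub] at hxy
  rw [dist_eq_norm]
  have hTs : (T : H →ₗ[ℂ] H') x - T (g y) = T (x - g y) := (map_sub T _ _).symm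
  rw [hTs]
  refine lt_of_pow_lt_pow_left₀ 2 hδ.le ?_
  have h1 := hM (x - g y)
  have h2 : ‖x - g y‖ ≤ 2 := by
    have h3 := norm_sub_le x (g y)
    rw [mem_closedBall_zero_iff] at hx hgy
    linarith
  have h3 : ∀ i, ‖M i (x - g y)‖ ^ 2 ≤ (δ / (2 * (n + 1))) ^ 2 := fun i =>
    pow_le_pow_left₀ (norm_nonneg _) ((norm_le_pi_norm (P (x - g y)) i).trans hxy.le) 2
  have h4 : ∑ i, ‖M i (x - g y)‖ ^ 2 ≤ Fintype.card ι * (δ / (2 * (n + 1))) ^ 2 := by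
    have := Finset.sum_le_card_nsmul Finset.univ _ _ fun i _ => h3 i
    simpa using this
  have h5 : C * ∑ i, ‖M i (x - g y)‖ ^ 2 ≤ n * (δ / (2 * (n + 1))) ^ 2 := by
    calc _ ≤ C * (Fintype.card ι * (δ / (2 * (n + 1))) ^ 2) := mul_le_mul_of_nonneg_left h4 hC
      _ = (C * Fintype.card ι) * (δ / (2 * (n + 1))) ^ 2 := by ring
      _ ≤ _ := mul_le_mul_of_nonneg_right (by linarith) (by positivity)
  have h6 : n * (δ / (2 * (n + 1))) ^ 2 ≤ δ ^ 2 / 4 := by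
    rw [div_pow, mul_div_assoc', div_le_div_iff₀ (by positivity) (by positivity)]
    have : n ≤ (n + 1) ^ 2 := by nlinarith
    nlinarith [sq_nonneg δ]
  have h7 : δ ^ 2 / 16 * ‖x - g y‖ ^ 2 ≤ δ ^ 2 / 16 * 2 ^ 2 :=
    mul_le_mul_of_nonneg_left (pow_le_pow_left₀ (norm_nonneg _) h2 2) (by positivity)
  nlinarith [sq_pos_of_pos hδ]

lemma isClosed_control {X Y K : Type*} [NormedAddCommGroup X] [NormedSpace ℂ X]
    [NormedAddCommGroup Y] [Fintype K] (A C : ℝ) (M : K → X →L[ℂ] ℂ) :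
    IsClosed {q : X × Y | ‖q.1‖ ^ 2 ≤ A * ‖q.2‖ ^ 2 + C * ∑ i, ‖M i q.1‖ ^ 2} :=
  isClosed_le (by fun_prop) (by fun_prop)

lemma le_of_mem_closure {X Y K : Type*} [NormedAddCommGroup X] [NormedSpace ℂ X]
    [NormedAddCommGroup Y] [Fintype K] {A C : ℝ} {M : K → X →L[ℂ] ℂ} {D : Set (X × Y)}
    (h : ∀ q ∈ D, ‖q.1‖ ^ 2 ≤ A * ‖q.2‖ ^ 2 + C * ∑ i, ‖M i q.1‖ ^ 2) {x : X} {y : Y}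
    (hq : (x, y) ∈ closure D) : ‖x‖ ^ 2 ≤ A * ‖y‖ ^ 2 + C * ∑ i, ‖M i x‖ ^ 2 :=
  closure_minimal h (isClosed_control A C M) hq

namespace SurfaceOfRevolution

variable (S : SurfaceOfRevolution)

/-! ### Functionals and multiplication operators on `L²` -/

/-- `L²` vector fields. -/
abbrev LG : Type := Lp (EuclideanSpace ℂ (Fin 3)) 2 S.area

variable {S} in
lemma norm_sq_Lp {E : Type*} [NormedAddCommGroup E] [InnerProductSpace ℂ E]
    (ζ : Lp E 2 S.area) : ‖ζ‖ ^ 2 = ∫ x, ‖ζ x‖ ^ 2 ∂S.area := by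
  have h := L2.inner_def (𝕜 := ℂ) ζ ζ
  have h2 : ∀ x, inner ℂ (ζ x) (ζ x) = ((‖ζ x‖ ^ 2 : ℝ) : ℂ) := fun x => by
    rw [inner_self_eq_norm_sq_to_K]
    simp
  simp only [h2] at h
  rw [inner_self_eq_norm_sq_to_K, integral_complex_ofReal] at h
  apply Complex.ofReal_injective
  rw [← h]
  simp

variable {S} in
lemma norm_sq_toLp {E : Type*} [NormedAddCommGroup E] [InnerProductSpace ℂ E] {u : E3 → E}
    (hu : MemLp u 2 S.area) : ‖hu.toLp‖ ^ 2 = ∫ x, ‖u x‖ ^ 2 ∂S.area := by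
  rw [norm_sq_Lp]
  refine integral_congr_ae ?_
  filter_upwards [hu.coeFn_toLp] with x hx
  rw [hx]

/-- The class in `L²` of a function continuous on `M`. -/
def cls {E : Type*} [NormedAddCommGroup E] (u : E3 → E) (hu : ContinuousOn u S.carrier) :
    Lp E 2 S.area :=
  (S.memLp_of_continuousOn hu).toLp

lemma cls_coeFn {E : Type*} [NormedAddCommGroup E] {u : E3 → E} (hu : ContinuousOn u S.carrier) :
    S.cls u hu =ᵐ[S.area] u :=
  (S.memLp_of_continuousOn hu).coeFn_toLp

/-- The functional `ζ ↦ ∫ ζ u` on `L²`. -/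
def pairing (u : E3 → ℂ) (hu : Continuous u) : S.L2 →L[ℂ] ℂ :=
  -- The conjugation compensates the conjugate linearity of the inner product in its first argument.
  innerSL ℂ (S.cls (fun x => star (u x)) hu.star.continuousOn)

lemma pairing_apply {u : E3 → ℂ} (hu : Continuous u) (ζ : S.L2) :
    S.pairing u hu ζ = ∫ x, ζ x * u x ∂S.area := by
  rw [pairing, innerSL_apply_apply, L2.inner_def]
  refine integral_congr_ae ?_
  filter_upwards [S.cls_coeFn (u := fun x => star (u x)) hu.star.continuousOn] with x hx
  rw [hx]
  simp

lemma inner_cls {E : Type*} [NormedAddCommGroup E] [InnerProductSpace ℂ E] {u : E3 → E}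
    (hu : ContinuousOn u S.carrier) (G : Lp E 2 S.area) :
    inner ℂ (S.cls u hu) G = ∫ x, inner ℂ (u x) (G x) ∂S.area := by
  rw [L2.inner_def]
  refine integral_congr_ae ?_
  filter_upwards [S.cls_coeFn hu] with x hx
  rw [hx]

section MulOp

variable {E F : Type*} [NormedAddCommGroup E] [InnerProductSpace ℂ E] [NormedAddCommGroup F]
  [InnerProductSpace ℂ F]

lemma memLp_clm_apply {u : E3 → E →L[ℂ] F} (hu : ContinuousOn u S.carrier)
    (ζ : Lp E 2 S.area) : MemLp (fun x => u x (ζ x)) 2 S.area := by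
  obtain ⟨C, hC⟩ := S.isCompact_carrier.exists_bound_of_continuousOn hu
  have hm : AEStronglyMeasurable (fun x => u x (ζ x)) S.area :=
    (isBoundedBilinearMap_apply (𝕜 := ℂ) (E := E) (F := F)).continuous.comp_aestronglyMeasurable
      ((S.aestronglyMeasurable_of_continuousOn hu).prodMk (Lp.aestronglyMeasurable ζ))
  refine MemLp.of_le_mul (c := C) (Lp.memLp ζ) hm ?_
  filter_upwards [S.ae_mem_carrier] with x hx
  exact (u x).le_of_opNorm_le (hC x hx) _

lemma norm_clm_apply_le {u : E3 → E →L[ℂ] F} (hu : ContinuousOn u S.carrier) {C : ℝ}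
    (hC : ∀ x ∈ S.carrier, ‖u x‖ ≤ C) (ζ : Lp E 2 S.area) :
    ‖(S.memLp_clm_apply hu ζ).toLp‖ ≤ C * ‖ζ‖ := by
  refine Lp.norm_le_mul_norm_of_ae_le_mul ?_
  filter_upwards [(S.memLp_clm_apply hu ζ).coeFn_toLp, S.ae_mem_carrier] with x hx hxc
  rw [hx]
  exact (u x).le_of_opNorm_le (hC x hxc) _

/-- The operator `ζ ↦ (x ↦ u x (ζ x))` on `L²` for a continuous field `u` of operators on `M`. -/
def mulOp (u : E3 → E →L[ℂ] F) (hu : ContinuousOn u S.carrier) :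
    Lp E 2 S.area →L[ℂ] Lp F 2 S.area :=
  LinearMap.mkContinuousOfExistsBound
    { toFun := fun ζ => (S.memLp_clm_apply hu ζ).toLp
      map_add' := by
        intro ζ η
        refine Lp.ext ?_
        filter_upwards [(S.memLp_clm_apply hu (ζ + η)).coeFn_toLp,
          (S.memLp_clm_apply hu ζ).coeFn_toLp, (S.memLp_clm_apply hu η).coeFn_toLp,
          Lp.coeFn_add ζ η, Lp.coeFn_add (S.memLp_clm_apply hu ζ).toLp
            (S.memLp_clm_apply hu η).toLp] with x h1 h2 h3 h4 h5
        rw [h1, h5, Pi.add_apply, h2, h3, h4, Pi.add_apply, map_add]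
      map_smul' := by
        intro c ζ
        refine Lp.ext ?_
        filter_upwards [(S.memLp_clm_apply hu (c • ζ)).coeFn_toLp,
          (S.memLp_clm_apply hu ζ).coeFn_toLp, Lp.coeFn_smul c ζ,
          Lp.coeFn_smul c (S.memLp_clm_apply hu ζ).toLp] with x h1 h2 h3 h4
        rw [h1, RingHom.id_apply, h4, Pi.smul_apply, h2, h3, Pi.smul_apply, map_smul] }
    (by
      obtain ⟨C, hC⟩ := S.isCompact_carrier.exists_bound_of_continuousOn hu
      exact ⟨|C|, fun ζ => S.norm_clm_apply_le hu
        (fun x hx => (hC x hx).trans (le_abs_self C)) ζ⟩)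

lemma mulOp_coeFn {u : E3 → E →L[ℂ] F} (hu : ContinuousOn u S.carrier) (ζ : Lp E 2 S.area) :
    S.mulOp u hu ζ =ᵐ[S.area] fun x => u x (ζ x) :=
  (S.memLp_clm_apply hu ζ).coeFn_toLp

lemma norm_mulOp_le {u : E3 → E →L[ℂ] F} (hu : ContinuousOn u S.carrier) {C : ℝ}
    (hC : ∀ x ∈ S.carrier, ‖u x‖ ≤ C) (ζ : Lp E 2 S.area) :
    ‖S.mulOp u hu ζ‖ ≤ C * ‖ζ‖ :=
  S.norm_clm_apply_le hu hC ζ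

end MulOp

/-! ### The Poincaré inequality in `H¹` -/

/-- The inequality is a closed condition on pairs, so it passes from smooth functions to their L²
limits. -/
lemma HasH1Grad.norm_sq_le {K : Type} [Fintype K] {A C : ℝ} {M : K → S.L2 →L[ℂ] ℂ}
    (h : ∀ (φ : E3 → ℂ) (hφ : ContDiff ℝ ∞ φ),
      ∫ x, ‖φ x‖ ^ 2 ∂S.area ≤ A * ∫ x, ‖S.gradC φ x‖ ^ 2 ∂S.area
        + C * ∑ i, ‖M i (S.cls φ hφ.continuous.continuousOn)‖ ^ 2)
    {η : S.L2} {G : S.LG} (hG : S.HasH1Grad η G) :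
    ‖η‖ ^ 2 ≤ A * ‖G‖ ^ 2 + C * ∑ i, ‖M i η‖ ^ 2 := by
  unfold HasH1Grad at hG
  refine le_of_mem_closure (M := M) ?_ hG
  rintro ⟨ζ, F⟩ ⟨φ, hφ, h1, h2⟩
  have e1 : ζ = S.cls φ hφ.continuous.continuousOn :=
    Lp.ext (h1.trans (S.cls_coeFn _).symm)
  have e2 : F = S.cls (S.gradC φ) (S.continuousOn_gradC hφ) :=
    Lp.ext (h2.trans (S.cls_coeFn _).symm)
  have h3 := h φ hφ
  rw [e1, e2]
  simp only [cls] at h3 ⊢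
  rwa [norm_sq_toLp, norm_sq_toLp]

/-- The functional `ζ ↦ ∫_Q ζ`, for a set `Q` of parameters. -/
def cellMean (Q : Set (ℝ × ℝ)) (hQ : MeasurableSet Q) : S.L2 →L[ℂ] ℂ :=
  (innerSL ℂ (indicatorConstLp 2 hQ (measure_ne_top S.paramMeasure Q) (1 : ℂ))).comp
    (Lp.compMeasurePreservingₗᵢ ℂ _ S.measurePreserving_param).toContinuousLinearMap

lemma cellMean_cls {Q : Set (ℝ × ℝ)} (hQ : MeasurableSet Q) {φ : E3 → ℂ}
    (hφ : ContinuousOn φ S.carrier) :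
    S.cellMean Q hQ (S.cls φ hφ) = ∫ p in Q, φ (S.param p.1 p.2) ∂S.paramMeasure := by
  change inner ℂ _ (Lp.compMeasurePreserving _ S.measurePreserving_param (S.cls φ hφ)) = _
  rw [L2.inner_indicatorConstLp_one]
  refine integral_congr_ae (ae_restrict_of_ae ?_)
  refine (Lp.coeFn_compMeasurePreserving _ S.measurePreserving_param).trans ?_
  exact S.measurePreserving_param.quasiMeasurePreserving.ae_eq_comp (S.cls_coeFn hφ)

/-- A quantitative form of Rellich's theorem: on a fine enough grid the gradient coefficient is
below ε, and the remaining terms are the n² cell integrals. -/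
lemma exists_finite_control {ε : ℝ} (hε : 0 < ε) :
    ∃ (K : Type) (_ : Fintype K) (C : ℝ) (M : K → S.L2 →L[ℂ] ℂ), 0 ≤ C ∧
      ∀ (η : S.L2) (G : S.LG), S.HasH1Grad η G →
        ‖η‖ ^ 2 ≤ ε * ‖G‖ ^ 2 + C * ∑ i, ‖M i η‖ ^ 2 := by
  obtain ⟨R, hR0, hR⟩ := S.exists_r_le
  obtain ⟨c, hc0, hc⟩ := S.exists_le_r
  have hL := S.L_pos
  have hlim : Filter.Tendsto (fun n : ℕ => 4 * R / c * (S.L / n) + (2 * Real.pi / n) ^ 2 * R ^ 2)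
      Filter.atTop (𝓝 (4 * R / c * 0 + 0 ^ 2 * R ^ 2)) :=
    ((tendsto_const_div_atTop_nhds_zero_nat _).const_mul _).add
      (((tendsto_const_div_atTop_nhds_zero_nat _).pow 2).mul_const _)
  rw [show 4 * R / c * 0 + 0 ^ 2 * R ^ 2 = (0 : ℝ) by ring] at hlim
  obtain ⟨n, hn, hn0⟩ := ((hlim.eventually (gt_mem_nhds hε)).and
    (Filter.eventually_gt_atTop 0)).exists
  refine ⟨Fin n × Fin n, inferInstance,
    1 / (c * (S.L / n) ^ 2 / 8 * (2 * Real.pi / n)), fun k => S.cellMean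
      (Ioc (S.L / n * k.1) (S.L / n * (k.1 + 1)) ×ˢ
        Ioc (2 * Real.pi / n * k.2) (2 * Real.pi / n * (k.2 + 1)))
      (measurableSet_Ioc.prod measurableSet_Ioc), by positivity, fun η G hG => ?_⟩
  refine HasH1Grad.norm_sq_le S (fun φ hφ => ?_) hG
  have h1 := S.cell_poincare hR0 hR hc0 hc hn0 hφ
  simp only [cellMean_cls]
  rw [Fintype.sum_prod_type]
  simp only [Finset.sum_range] at h1
  refine h1.trans (add_le_add_left (mul_le_mul_of_nonneg_right hn.le ?_) _)
  exact integral_nonneg fun x => by positivity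

/-- The Poincaré inequality. -/
lemma exists_poincare : ∃ C : ℝ, 0 < C ∧ ∀ (η : S.L2b) (G : S.LG), S.HasH1Grad η G →
    ‖η‖ ^ 2 ≤ C * ‖G‖ ^ 2 := by
  obtain ⟨R, hR0, hR⟩ := S.exists_r_le
  obtain ⟨c, hc0, hc⟩ := S.exists_le_r
  have hL := S.L_pos
  have hpi := Real.pi_pos
  refine ⟨4 * R / c * S.L + (2 * Real.pi) ^ 2 * R ^ 2, by positivity, fun η G hG => ?_⟩
  have h0 : S.pairing (fun _ => 1) continuous_const (η : S.L2) = 0 := by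
    rw [pairing_apply]
    simp only [mul_one]
    exact η.2
  -- The case of a single cell: its only functional is the integral over M, which vanishes on L²_b.
  have h := HasH1Grad.norm_sq_le (K := Unit) S (A := 4 * R / c * S.L + (2 * Real.pi) ^ 2 * R ^ 2)
    (C := 1 / (c * S.L ^ 2 / 8 * (2 * Real.pi)))
    (M := fun _ => S.pairing (fun _ => 1) continuous_const) (fun φ hφ => ?_) hG
  · simpa [h0] using h
  · have h1 := S.cell_poincare hR0 hR hc0 hc one_pos hφ
    simp only [Nat.cast_one, div_one, Finset.range_one, Finset.sum_singleton, Nat.cast_zero,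
      mul_zero, zero_add, mul_one] at h1
    have h2 : ∫ p in Ioc 0 S.L ×ˢ Ioc 0 (2 * Real.pi), φ (S.param p.1 p.2) ∂S.paramMeasure
        = S.pairing (fun _ => 1) continuous_const (S.cls φ hφ.continuous.continuousOn) := by
      rw [pairing_apply]
      have h3 : ∫ x, S.cls φ hφ.continuous.continuousOn x * 1 ∂S.area = ∫ x, φ x ∂S.area := by
        refine integral_congr_ae ?_
        filter_upwards [S.cls_coeFn hφ.continuous.continuousOn] with x hx
        rw [hx, mul_one]
      rw [h3, S.integral_area hφ.continuous.aestronglyMeasurable,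
        S.integral_paramMeasure _ _ (measurableSet_Ioc.prod measurableSet_Ioc) subset_rfl]
      rfl
    rw [h2] at h1
    simpa using h1

end SurfaceOfRevolution

/-! ### Variational solution of the weak Laplace equation -/

section WeakInverse

variable {X Y : Type*} [NormedAddCommGroup X] [InnerProductSpace ℂ X] [CompleteSpace X]
  [NormedAddCommGroup Y] [InnerProductSpace ℂ Y] [CompleteSpace Y]

/-- Lax–Milgram for the form `⟪p₂ v, p₂ w⟫` on a Hilbert space. -/
lemma exists_variational_inverse {W : Type*} [NormedAddCommGroup W] [InnerProductSpace ℂ W]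
    [CompleteSpace W] (p₁ : W →L[ℂ] X) (p₂ : W →L[ℂ] Y) {C : ℝ} (hC : 0 < C)
    (h : ∀ w, ‖w‖ ^ 2 ≤ C * ‖p₂ w‖ ^ 2) :
    ∃ Q : X →L[ℂ] W, ∀ ζ w, inner ℂ (p₂ w) (p₂ (Q ζ)) = inner ℂ (p₁ w) ζ := by
  have hunit : IsUnit ((ContinuousLinearMap.adjoint p₂).comp p₂) := by
    refine ContinuousLinearMap.isUnit_of_forall_le_norm_inner_map _
      (c := Real.toNNReal (1 / C)) (Real.toNNReal_pos.2 (by positivity)) fun w => ?_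
    rw [ContinuousLinearMap.comp_apply, ContinuousLinearMap.adjoint_inner_left,
      inner_self_eq_norm_sq_to_K, norm_pow]
    rw [Real.coe_toNNReal _ (by positivity), RCLike.norm_ofReal, abs_norm, mul_one_div, div_le_iff₀ hC, mul_comm]
    exact h w
  obtain ⟨u, hu⟩ := hunit
  refine ⟨(↑u⁻¹ : W →L[ℂ] W).comp (ContinuousLinearMap.adjoint p₁), fun ζ w => ?_⟩
  have h1 : ∀ v, (ContinuousLinearMap.adjoint p₂) (p₂ ((↑u⁻¹ : W →L[ℂ] W) v)) = v := by
    intro v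
    have h2 := congrArg (fun T : W →L[ℂ] W => T v) u.mul_inv
    rw [hu] at h2
    exact h2
  rw [← ContinuousLinearMap.adjoint_inner_right, ContinuousLinearMap.comp_apply, h1,
    ContinuousLinearMap.adjoint_inner_right]

/-- Solvability of the weak equation `∇*∇ x = -ζ` for a closed gradient relation `N` satisfying a
Poincaré inequality on the closed subspace `B`. -/
lemma exists_weak_inverse (N : Submodule ℂ (X × Y)) (hN : IsClosed (N : Set (X × Y)))
    (B : Submodule ℂ X) (hB : IsClosed (B : Set X)) [CompleteSpace B] {C : ℝ} (hC : 0 < C)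
    (hP : ∀ x ∈ B, ∀ y, (x, y) ∈ N → ‖x‖ ^ 2 ≤ C * ‖y‖ ^ 2) :
    ∃ (T : B →L[ℂ] B) (Gr : B →L[ℂ] Y), ∀ ζ : B, ((T ζ : X), Gr ζ) ∈ N ∧
      ∀ x (hx : x ∈ B) (y : Y), (x, y) ∈ N →
        inner ℂ y (Gr ζ) = -inner ℂ (⟨x, hx⟩ : B) ζ := by
  -- W plays the role of H¹ with mean zero: the pairs of N with first component in B, under the
  -- Hilbert norm of the product. Elements are pairs, so N need not be known to be single valued.
  obtain ⟨W, hW, hWm⟩ : ∃ W : Submodule ℂ (WithLp 2 (X × Y)), 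
      IsClosed (W : Set (WithLp 2 (X × Y))) ∧ ∀ v, v ∈ W ↔ (v.fst, v.snd) ∈ N ∧ v.fst ∈ B :=
    ⟨(N ⊓ B.comap (LinearMap.fst ℂ X Y)).comap (WithLp.linearEquiv 2 ℂ (X × Y)).toLinearMap,
      (hN.inter (hB.preimage continuous_fst)).preimage
        (WithLp.prodContinuousLinearEquiv 2 ℂ X Y).continuous, fun v => Iff.rfl⟩
  have : CompleteSpace W := hW.completeSpace_coe
  obtain ⟨q, hq⟩ : ∃ q : W →L[ℂ] X, ∀ w, q w = (w : WithLp 2 (X × Y)).fst :=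
    ⟨(ContinuousLinearMap.fst ℂ X Y).comp
      ((WithLp.prodContinuousLinearEquiv 2 ℂ X Y).toContinuousLinearMap.comp W.subtypeL),
      fun w => rfl⟩
  obtain ⟨p₂, hp₂⟩ : ∃ q : W →L[ℂ] Y, ∀ w, q w = (w : WithLp 2 (X × Y)).snd :=
    ⟨(ContinuousLinearMap.snd ℂ X Y).comp
      ((WithLp.prodContinuousLinearEquiv 2 ℂ X Y).toContinuousLinearMap.comp W.subtypeL),
      fun w => rfl⟩
  have hqB : ∀ w, q w ∈ B := fun w => by rw [hq]; exact ((hWm _).1 w.2).2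
  obtain ⟨p₁, hp₁⟩ : ∃ p : W →L[ℂ] B, ∀ w, (p w : X) = q w := ⟨q.codRestrict B hqB, fun _ => rfl⟩
  have hmem : ∀ w : W, ((p₁ w : X), p₂ w) ∈ N := fun w => by
    rw [hp₁, hq, hp₂]
    exact ((hWm _).1 w.2).1
  have hnorm : ∀ w : W, ‖w‖ ^ 2 = ‖q w‖ ^ 2 + ‖p₂ w‖ ^ 2 := fun w => by
    rw [hq, hp₂]
    exact WithLp.prod_norm_sq_eq_of_L2 (w : WithLp 2 (X × Y))
  -- The squared norm of a pair is ‖x‖² + ‖y‖², hence the constant C + 1.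
  obtain ⟨Q, hQ⟩ := exists_variational_inverse p₁ p₂ (C := C + 1) (by positivity) fun w => by
    have h2 := hP _ (p₁ w).2 _ (hmem w)
    rw [hp₁] at h2
    rw [hnorm]
    linarith
  refine ⟨-(p₁.comp Q), -(p₂.comp Q), fun ζ => ⟨N.neg_mem (hmem (Q ζ)), fun x hx y hxy => ?_⟩⟩
  obtain ⟨w, hw1, hw2⟩ : ∃ w : W, p₁ w = ⟨x, hx⟩ ∧ p₂ w = y := by
    refine ⟨⟨WithLp.toLp 2 (x, y), (hWm _).2 ⟨hxy, hx⟩⟩, Subtype.ext ?_, ?_⟩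
    · rw [hp₁, hq]
      rfl
    · rw [hp₂]
      rfl
  rw [← hw1, ← hw2, neg_apply, inner_neg_right, ContinuousLinearMap.comp_apply,
    hQ]

end WeakInverse

/-- Vectors orthogonal to the second components of a relation are orthogonal to those of its
closure. -/
lemma inner_eq_of_mem_closure {X Y : Type*} [NormedAddCommGroup X] [InnerProductSpace ℂ X]
    [NormedAddCommGroup Y] [InnerProductSpace ℂ Y] {D : Set (X × Y)} {g : Y} {e : X} (h : ∀ q ∈ D, inner ℂ q.2 g
    = inner ℂ q.1 e) {x : X} {y : Y} (hq : (x, y) ∈ closure D) :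
    inner ℂ y g = inner ℂ x e :=
  closure_minimal h (isClosed_eq (by fun_prop) (by fun_prop) :
    IsClosed {q : X × Y | inner ℂ q.2 g = inner ℂ q.1 e}) hq

lemma prodMap_mem_closure {X Y X' Y' : Type*} [TopologicalSpace X] [TopologicalSpace Y]
    [TopologicalSpace X'] [TopologicalSpace Y']
    {D : Set (X × Y)} {D' : Set (X' × Y')} {f : X → X'} {g : Y → Y'}
    (hf : Continuous f) (hg : Continuous g) (h : ∀ q ∈ D, (f q.1, g q.2) ∈ D') {x : X} {y : Y}
    (hq : (x, y) ∈ closure D) : (f x, g y) ∈ closure D' :=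
  map_mem_closure (f := fun q : X × Y => (f q.1, g q.2)) (by fun_prop) hq h

namespace SurfaceOfRevolution

variable (S : SurfaceOfRevolution)

/-! ### The inverse Laplacian -/

/-- The pairs `(φ, ∇φ)` with `φ` smooth. -/
def smoothPairs : Submodule ℂ (S.L2 × S.LG) where
  carrier := {q | ∃ φ : E3 → ℂ, ContDiff ℝ ∞ φ ∧ q.1 =ᵐ[S.area] φ ∧ q.2 =ᵐ[S.area] S.gradC φ}
  zero_mem' := by
    refine ⟨fun _ => 0, contDiff_const, Lp.coeFn_zero _ _ _, ?_⟩
    have h : S.gradC (fun _ => (0 : ℂ)) = 0 := by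
      funext x
      ext i
      simp [gradC]
    rw [h]
    exact Lp.coeFn_zero _ _ _
  add_mem' := by
    rintro ⟨ζ, G⟩ ⟨ζ', G'⟩ ⟨φ, hφ, h1, h2⟩ ⟨ψ, hψ, h3, h4⟩
    refine ⟨fun y => φ y + ψ y, hφ.add hψ, ?_, ?_⟩
    · filter_upwards [h1, h3, Lp.coeFn_add ζ ζ'] with x e1 e2 e3
      rw [Prod.mk_add_mk, e3, Pi.add_apply, ← e1, ← e2]
    · filter_upwards [h2, h4, Lp.coeFn_add G G'] with x e1 e2 e3
      rw [Prod.mk_add_mk, e3, Pi.add_apply, gradC_add S hφ hψ, ← e1, ← e2]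
  smul_mem' := by
    rintro c ⟨ζ, G⟩ ⟨φ, hφ, h1, h2⟩
    refine ⟨fun y => c * φ y, contDiff_const.mul hφ, ?_, ?_⟩
    · filter_upwards [h1, Lp.coeFn_smul c ζ] with x e1 e2
      rw [Prod.smul_mk, e2, Pi.smul_apply, smul_eq_mul, ← e1]
    · filter_upwards [h2, Lp.coeFn_smul c G] with x e1 e2
      rw [Prod.smul_mk, e2, Pi.smul_apply, gradC_const_mul S hφ, ← e1]

lemma mem_L2b_iff (ζ : S.L2) :
    ζ ∈ S.L2b ↔ S.pairing (fun _ => 1) continuous_const ζ = 0 := by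
  rw [pairing_apply]
  simp only [mul_one]
  rfl

lemma isClosed_L2b : IsClosed (S.L2b : Set S.L2) := by
  have : (S.L2b : Set S.L2) = (S.pairing (fun _ => 1) continuous_const) ⁻¹' {0} := by
    ext ζ
    exact S.mem_L2b_iff ζ
  rw [this]
  exact isClosed_singleton.preimage (S.pairing _ _).continuous

instance : CompleteSpace S.L2b := S.isClosed_L2b.completeSpace_coe

lemma exists_invLaplacian : ∃ (T : S.L2b →L[ℂ] S.L2b) (Gr : S.L2b →L[ℂ] S.LG), ∀ ζ : S.L2b,
    S.HasH1Grad (T ζ) (Gr ζ) ∧ ∀ (x : S.L2b) (y : S.LG), S.HasH1Grad x y →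
      inner ℂ y (Gr ζ) = -inner ℂ x ζ := by
  obtain ⟨C, hC, hP⟩ := S.exists_poincare
  obtain ⟨T, Gr, h⟩ := exists_weak_inverse S.smoothPairs.topologicalClosure
    S.smoothPairs.isClosed_topologicalClosure S.L2b S.isClosed_L2b hC
    (fun x hx y hxy => hP ⟨x, hx⟩ y hxy)
  exact ⟨T, Gr, fun ζ => ⟨(h ζ).1, fun x y hxy => (h ζ).2 x x.2 y hxy⟩⟩

/-- The operator `Δ⁻¹` on `L²_b(M)`. -/
def invLap : S.L2b →L[ℂ] S.L2b := S.exists_invLaplacian.choose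

/-- The operator `∇Δ⁻¹` on `L²_b(M)`. -/
def gradInvLap : S.L2b →L[ℂ] S.LG := S.exists_invLaplacian.choose_spec.choose

lemma hasH1Grad_invLap (ζ : S.L2b) : S.HasH1Grad (S.invLap ζ) (S.gradInvLap ζ) :=
  (S.exists_invLaplacian.choose_spec.choose_spec ζ).1

lemma inner_gradInvLap {x : S.L2b} {y : S.LG} (h : S.HasH1Grad x y) (ζ : S.L2b) :
    inner ℂ y (S.gradInvLap ζ) = -inner ℂ x ζ :=
  (S.exists_invLaplacian.choose_spec.choose_spec ζ).2 x y h

lemma area_univ_pos : 0 < S.area.real univ := by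
  have h : S.area.real univ = ∫ _, (1 : ℝ) ∂S.area := by simp
  rw [h, S.integral_area_of_continuous continuous_const]
  simp only [intervalIntegral.integral_const, sub_zero, smul_eq_mul, mul_one]
  rw [← intervalIntegral.integral_of_le S.L_pos.le, intervalIntegral.integral_mul_const]
  refine mul_pos ?_ Real.two_pi_pos
  exact intervalIntegral.intervalIntegral_pos_of_pos_on
    (S.r_smooth.continuous.intervalIntegrable _ _) S.r_pos S.L_pos

lemma hasH1Grad_of_smooth {φ : E3 → ℂ} (hφ : ContDiff ℝ ∞ φ) :
    S.HasH1Grad (S.cls φ hφ.continuous.continuousOn) (S.cls (S.gradC φ) (S.continuousOn_gradC hφ)) :=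
  S.smoothPairs.le_topologicalClosure ⟨φ, hφ, S.cls_coeFn hφ.continuous.continuousOn,
    S.cls_coeFn (S.continuousOn_gradC hφ)⟩

lemma integral_cls {u : E3 → ℂ} (hu : ContinuousOn u S.carrier) :
    ∫ x, S.cls u hu x ∂S.area = ∫ x, u x ∂S.area :=
  integral_congr_ae (S.cls_coeFn hu)

/-- The variational equation only admits test functions of mean zero. Subtracting the mean of φ
changes neither its gradient nor its pairing with ζ, which has integral 0. -/
lemma isInvLaplacian_invLap (ζ : S.L2b) : S.IsInvLaplacian ζ (S.invLap ζ) := by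
  refine ⟨S.gradInvLap ζ, S.hasH1Grad_invLap ζ, fun φ hφ => ?_⟩
  set c : ℂ := (∫ x, φ x ∂S.area) / (S.area.real univ : ℂ) with hc
  have hψ : ContDiff ℝ ∞ fun y => φ y - c := hφ.sub contDiff_const
  have harea : (S.area.real univ : ℂ) ≠ 0 := by exact_mod_cast S.area_univ_pos.ne'
  have hmem : S.cls (fun y => φ y - c) hψ.continuous.continuousOn ∈ S.L2b := by
    change ∫ x, S.cls _ _ x ∂S.area = 0
    have hint : Integrable φ S.area :=
      (S.memLp_of_continuousOn hφ.continuous.continuousOn).integrable (by norm_num)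
    rw [integral_cls, integral_sub hint (integrable_const _), integral_const, hc,
      Complex.real_smul, mul_div_cancel₀ _ harea, sub_self]
  have h1 := S.inner_gradInvLap (x := ⟨_, hmem⟩) (S.hasH1Grad_of_smooth hψ) ζ
  rw [inner_cls, Submodule.coe_inner, inner_cls] at h1
  simp only [gradC_sub_const] at h1
  rw [h1, neg_neg]
  have h2 : ∀ x, inner ℂ (φ x - c) ((ζ : S.L2) x)
      = inner ℂ (φ x) ((ζ : S.L2) x) - (starRingEnd ℂ) c * (ζ : S.L2) x := by
    intro x
    simp
    ring
  simp only [h2]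
  have hi : Integrable (fun x => inner ℂ (φ x) ((ζ : S.L2) x)) S.area := by
    simpa [mul_comm] using S.integrable_L2_mul (ζ : S.L2) (u := fun x => (starRingEnd ℂ) (φ x))
      (Complex.continuous_conj.comp hφ.continuous)
  rw [integral_sub hi ((S.integrable_L2 _).const_mul _), integral_const_mul,
    show ∫ x, (ζ : S.L2) x ∂S.area = 0 from ζ.2, mul_zero, sub_zero]

lemma IsInvLaplacian.inner_eq {ζ : S.L2b} {G : S.LG}
    (h : ∀ φ : E3 → ℂ, ContDiff ℝ ∞ φ →
      -∫ x, inner ℂ (S.gradC φ x) (G x) ∂S.area = ∫ x, inner ℂ (φ x) ((ζ : S.L2) x) ∂S.area)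
    {x : S.L2} {y : S.LG} (hxy : S.HasH1Grad x y) : inner ℂ y G = inner ℂ x (-(ζ : S.L2)) := by
  refine inner_eq_of_mem_closure (fun q hq => ?_) hxy
  obtain ⟨φ, hφ, h1, h2⟩ := hq
  rw [inner_neg_right, L2.inner_def, L2.inner_def]
  have e1 : ∫ x, inner ℂ (q.2 x) (G x) ∂S.area = ∫ x, inner ℂ (S.gradC φ x) (G x) ∂S.area := by
    refine integral_congr_ae ?_
    filter_upwards [h2] with x hx
    rw [hx]
  have e2 : ∫ x, inner ℂ (q.1 x) ((ζ : S.L2) x) ∂S.area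
      = ∫ x, inner ℂ (φ x) ((ζ : S.L2) x) ∂S.area := by
    refine integral_congr_ae ?_
    filter_upwards [h1] with x hx
    rw [hx]
  rw [e1, e2, ← h φ hφ, neg_neg]

/-- Uniqueness: the difference of two solutions is itself admissible as a test pair, so the
gradients agree, and then the Poincaré inequality makes the functions agree. -/
lemma isInvLaplacian_iff (ζ η : S.L2b) : S.IsInvLaplacian ζ η ↔ η = S.invLap ζ := by
  constructor
  · rintro ⟨G, hG, h⟩
    obtain ⟨C, hC, hP⟩ := S.exists_poincare
    have hd : S.HasH1Grad ((η - S.invLap ζ : S.L2b) : S.L2) (G - S.gradInvLap ζ) :=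
      S.smoothPairs.topologicalClosure.sub_mem hG (S.hasH1Grad_invLap ζ)
    have h1 := IsInvLaplacian.inner_eq S h hd
    have h2 := S.inner_gradInvLap hd ζ
    have h3 : inner ℂ (G - S.gradInvLap ζ) (G - S.gradInvLap ζ) = 0 := by
      rw [inner_sub_right, h1, h2, inner_neg_right, Submodule.coe_inner, sub_self]
    have h4 := hP _ _ hd
    rw [inner_self_eq_zero.1 h3, norm_zero] at h4
    have h5 : ‖η - S.invLap ζ‖ ^ 2 = 0 := le_antisymm (by simpa using h4) (by positivity)
    exact sub_eq_zero.1 (norm_eq_zero.1 (pow_eq_zero_iff (two_ne_zero) |>.1 h5))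
  · rintro rfl
    exact S.isInvLaplacian_invLap ζ

/-- The weak equation tested with its own solution. -/
lemma norm_gradInvLap_sq_le (ζ : S.L2b) : ‖S.gradInvLap ζ‖ ^ 2 ≤ ‖S.invLap ζ‖ * ‖ζ‖ := by
  have h := S.inner_gradInvLap (S.hasH1Grad_invLap ζ) ζ
  rw [inner_self_eq_norm_sq_to_K] at h
  have h2 := congrArg norm h
  rw [norm_neg, norm_pow, RCLike.norm_ofReal, abs_norm] at h2
  rw [h2]
  exact norm_inner_le_norm (𝕜 := ℂ) (S.invLap ζ) ζ

/-- The energy bound controls ∇Δ⁻¹ζ by ζ, so finite control in H¹ becomes the compactness criterion;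
the added 1 only keeps the divisor positive. -/
lemma isCompactOperator_invLap : IsCompactOperator S.invLap := by
  refine isCompactOperator_of_finite_control _ fun ε hε => ?_
  obtain ⟨K, hK, C, M, hC, h⟩ := S.exists_finite_control
    (ε := ε / (‖S.invLap‖ + 1)) (by positivity)
  refine ⟨K, hK, C, fun i => (M i).comp (S.L2b.subtypeL.comp S.invLap), hC, fun ζ => ?_⟩
  have h1 := h _ _ (S.hasH1Grad_invLap ζ)
  refine h1.trans (add_le_add_left ?_ _)
  have h2 : ‖S.gradInvLap ζ‖ ^ 2 ≤ (‖S.invLap‖ + 1) * ‖ζ‖ ^ 2 := by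
    refine (S.norm_gradInvLap_sq_le ζ).trans ?_
    have h3 := S.invLap.le_opNorm ζ
    nlinarith [norm_nonneg ζ, norm_nonneg S.invLap]
  calc _ ≤ ε / (‖S.invLap‖ + 1) * ((‖S.invLap‖ + 1) * ‖ζ‖ ^ 2) :=
        mul_le_mul_of_nonneg_left h2 (by positivity)
    _ = ε * ‖ζ‖ ^ 2 := by field_simp

/-! ### Rotation invariance of the inverse Laplacian -/

lemma U_mem_L2b {ζ : S.L2} (h : ζ ∈ S.L2b) (t : ℝ) : S.U t ζ ∈ S.L2b := by
  rw [mem_L2b_iff, pairing_apply] at h ⊢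
  rw [integral_U_mul]
  exact h

/-- The action of rotations on `L²` vector fields. -/
def UG (t : ℝ) : S.LG →L[ℂ] S.LG :=
  (S.mulOp (fun _ => rotC (-t)) continuousOn_const).comp
    (Lp.compMeasurePreservingₗᵢ ℂ (rot t) (S.measurePreserving_rot t)).toContinuousLinearMap

lemma UG_coeFn (t : ℝ) (G : S.LG) :
    S.UG t G =ᵐ[S.area] fun x => rotC (-t) (G (rot t x)) := by
  filter_upwards [S.mulOp_coeFn (u := fun _ => rotC (-t)) continuousOn_const
    (Lp.compMeasurePreserving (rot t) (S.measurePreserving_rot t) G),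
    Lp.coeFn_compMeasurePreserving G (S.measurePreserving_rot t)] with x h1 h2
  change S.mulOp (fun _ => rotC (-t)) continuousOn_const (Lp.compMeasurePreserving (rot t) (S.measurePreserving_rot t) G) x = _
  rw [h1, h2]
  rfl

lemma HasH1Grad.rotate {η : S.L2} {G : S.LG} (h : S.HasH1Grad η G) (t : ℝ) :
    S.HasH1Grad (S.U t η) (S.UG t G) := by
  refine prodMap_mem_closure (S.U t).continuous (S.UG t).continuous (fun q hq => ?_) h
  obtain ⟨φ, hφ, h1, h2⟩ := hq
  have hq := (S.measurePreserving_rot t).quasiMeasurePreserving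
  refine ⟨fun y => φ (rot t y), hφ.comp (rot t).contDiff,
    (S.U_coeFn t q.1).trans (hq.ae_eq_comp h1), ?_⟩
  filter_upwards [S.UG_coeFn t q.2, hq.ae_eq_comp h2, S.ae_mem_carrier] with x e1 e2 e3
  have e2' : q.2 (rot t x) = S.gradC φ (rot t x) := e2
  rw [e1, S.gradC_comp_rot hφ t e3, e2']

lemma integral_inner_UG (t : ℝ) (G : S.LG) {φ : E3 → ℂ} (hφ : ContDiff ℝ ∞ φ) :
    ∫ x, inner ℂ (S.gradC φ x) (S.UG t G x) ∂S.area
      = ∫ x, inner ℂ (S.gradC (fun y => φ (rot (-t) y)) x) (G x) ∂S.area := by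
  rw [← (S.measurePreserving_rot t).integral_comp (measurableEmbedding_rot t)
    fun x => inner ℂ (S.gradC (fun y => φ (rot (-t) y)) x) (G x)]
  refine integral_congr_ae ?_
  filter_upwards [S.UG_coeFn t G, S.ae_mem_carrier] with x h1 h2
  rw [h1, S.gradC_comp_rot hφ (-t) (S.rot_mem_carrier h2 t), rot_neg_rot, inner_rotC_neg, neg_neg]

lemma integral_inner_U (t : ℝ) (ζ : S.L2) (φ : E3 → ℂ) :
    ∫ x, inner ℂ (φ x) (S.U t ζ x) ∂S.area = ∫ x, inner ℂ (φ (rot (-t) x)) (ζ x) ∂S.area := by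
  simpa [mul_comm] using S.integral_U_mul t ζ fun x => (starRingEnd ℂ) (φ x)

/-- The rotated solution solves the equation with rotated right-hand side; uniqueness finishes the
argument. -/
lemma invLap_U (ζ : S.L2b) (t : ℝ) :
    S.invLap ⟨S.U t ζ, S.U_mem_L2b ζ.2 t⟩ = ⟨S.U t (S.invLap ζ), S.U_mem_L2b (S.invLap ζ).2 t⟩ := by
  symm
  rw [← isInvLaplacian_iff]
  obtain ⟨G, hG, h⟩ := S.isInvLaplacian_invLap ζ
  refine ⟨S.UG t G, HasH1Grad.rotate S hG t, fun φ hφ => ?_⟩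
  rw [integral_inner_UG S t G hφ, integral_inner_U]
  exact h (fun y => φ (rot (-t) y)) (hφ.comp (rot (-t)).contDiff)

lemma mem_V_iff (k : ℤ) (ζ : S.L2b) : ζ ∈ S.V k ↔ S.IsWeakEigen k (ζ : S.L2) := Iff.rfl

lemma invLap_mem_V {k : ℤ} {ζ : S.L2b} (h : ζ ∈ S.V k) : S.invLap ζ ∈ S.V k := by
  rw [mem_V_iff, isWeakEigen_iff] at h ⊢
  intro t
  have h1 := S.invLap_U ζ t
  have h2 : (⟨S.U t ζ, S.U_mem_L2b ζ.2 t⟩ : S.L2b) = Complex.exp (Complex.I * k * t) • ζ :=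
    Subtype.ext (h t)
  rw [h2, map_smul] at h1
  exact (congrArg Subtype.val h1).symm

/-! ### The angular derivative in `H¹` -/

/-- The weak angular derivative of `η`, computed from its gradient. -/
def angular : S.LG →L[ℂ] S.L2 :=
  S.mulOp (fun x => innerSL ℂ (toC3 (X3 x)))
    ((innerSL ℂ).continuous.comp ((PiLp.continuous_toLp 2 _).comp (continuous_pi fun i => by
      have := continuous_X3
      fun_prop))).continuousOn

lemma angular_coeFn (G : S.LG) :
    S.angular G =ᵐ[S.area] fun x => inner ℂ (toC3 (X3 x)) (G x) :=
  S.mulOp_coeFn _ G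

lemma norm_angular_le {R : ℝ} (hR : ∀ s ∈ Icc 0 S.L, S.r s ≤ R) (G : S.LG) :
    ‖S.angular G‖ ≤ R * ‖G‖ := by
  refine S.norm_mulOp_le _ (fun x hx => ?_) G
  rw [innerSL_apply_norm, norm_toC3]
  obtain ⟨s, hs, θ, rfl⟩ := hx
  rw [S.norm_X3_param hs]
  exact hR s hs

lemma integral_X3_mul {φ ψ : E3 → ℂ} (hφ : ContDiff ℝ ∞ φ) (hψ : ContDiff ℝ ∞ ψ) :
    ∫ x, fderiv ℝ φ x (X3 x) * ψ x ∂S.area = -∫ x, φ x * fderiv ℝ ψ x (X3 x) ∂S.area := by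
  have h := S.integral_X3_deriv (hφ.mul hψ)
  have h1 : ∀ x, fderiv ℝ (fun y => φ y * ψ y) x (X3 x)
      = φ x * fderiv ℝ ψ x (X3 x) + fderiv ℝ φ x (X3 x) * ψ x := by
    intro x
    have h2 : fderiv ℝ (fun y => φ y * ψ y) x = φ x • fderiv ℝ ψ x + ψ x • fderiv ℝ φ x :=
      fderiv_mul (hφ.differentiable (by simp)).differentiableAt
        (hψ.differentiable (by simp)).differentiableAt
    rw [h2]
    simp [mul_comm]
  have hi : ∀ {u : E3 → ℂ}, Continuous u → Integrable u S.area := fun hu =>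
    (S.memLp_of_continuousOn hu.continuousOn).integrable (by norm_num)
  have h3 : ∫ x, fderiv ℝ (fun y => φ y * ψ y) x (X3 x) ∂S.area = 0 := h
  simp only [h1] at h3
  rw [integral_add (f := fun x => φ x * fderiv ℝ ψ x (X3 x))
    (g := fun x => fderiv ℝ φ x (X3 x) * ψ x)
    (hi (hφ.continuous.mul (continuous_X3_deriv hψ)))
    (hi ((continuous_X3_deriv hφ).mul hψ.continuous))] at h3
  linear_combination h3

/-- For smooth functions this is integration by parts along X₃. Both sides are continuous in the
pair, so the identity persists on the closure. -/
lemma HasH1Grad.angular_eq {η : S.L2} {G : S.LG} (h : S.HasH1Grad η G) {ψ : E3 → ℂ}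
    (hψ : ContDiff ℝ ∞ ψ) :
    S.pairing ψ hψ.continuous (S.angular G)
      = -S.pairing (fun x => fderiv ℝ ψ x (X3 x)) (continuous_X3_deriv hψ) η := by
  have hsub : S.smoothPairs ≤ LinearMap.ker
      (((S.pairing ψ hψ.continuous).comp S.angular).comp (ContinuousLinearMap.snd ℂ S.L2 S.LG)
        + (S.pairing (fun x => fderiv ℝ ψ x (X3 x)) (continuous_X3_deriv hψ)).comp
          (ContinuousLinearMap.fst ℂ S.L2 S.LG)).toLinearMap := by
    rintro ⟨ζ, F⟩ ⟨φ, hφ, h1, h2⟩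
    have e1 : S.pairing ψ hψ.continuous (S.angular F)
        = ∫ x, fderiv ℝ φ x (X3 x) * ψ x ∂S.area := by
      rw [pairing_apply]
      refine integral_congr_ae ?_
      filter_upwards [S.angular_coeFn F, h2, S.ae_mem_carrier] with x a1 a2 a3
      have a2' : F x = S.gradC φ x := a2
      rw [a1, a2', ← S.fderiv_eq_inner_gradC (S.inner_normal_X3 a3)]
    have e2 : S.pairing (fun x => fderiv ℝ ψ x (X3 x)) (continuous_X3_deriv hψ) ζ
        = ∫ x, φ x * fderiv ℝ ψ x (X3 x) ∂S.area := by
      rw [pairing_apply]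
      refine integral_congr_ae ?_
      filter_upwards [h1] with x a1
      have a1' : ζ x = φ x := a1
      rw [a1']
    change S.pairing ψ hψ.continuous (S.angular F)
      + S.pairing (fun x => fderiv ℝ ψ x (X3 x)) (continuous_X3_deriv hψ) ζ = 0
    rw [e1, e2, S.integral_X3_mul hφ hψ, neg_add_cancel]
  have h1 := S.smoothPairs.topologicalClosure_minimal hsub
    (ContinuousLinearMap.isClosed_ker _) h
  exact eq_neg_of_add_eq_zero_left h1

/-- The angular derivative ⟨X₃, ∇η⟩ equals ikη, and |X₃| = r ≤ R on M. -/
lemma norm_eigen_le {R : ℝ} (hR : ∀ s ∈ Icc 0 S.L, S.r s ≤ R) {k : ℤ} {η : S.L2} {G : S.LG}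
    (h : S.HasH1Grad η G) (hη : S.IsWeakEigen k η) : |(k : ℝ)| * ‖η‖ ≤ R * ‖G‖ := by
  have h1 : (Complex.I * k) • η = S.angular G := by
    refine S.integral_mul_eq_of_smooth fun φ hφ => ?_
    rw [← S.pairing_apply hφ.continuous, ← S.pairing_apply hφ.continuous, map_smul,
      HasH1Grad.angular_eq S h hφ, pairing_apply, pairing_apply, smul_eq_mul, hη φ hφ]
  have h2 := S.norm_angular_le hR G
  rw [← h1, norm_smul] at h2
  simpa using h2

/-- On `V_k` the inverse Laplacian has norm `O(k⁻²)`. -/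
lemma norm_invLap_le {R : ℝ} (hR : ∀ s ∈ Icc 0 S.L, S.r s ≤ R) {k : ℤ} {ζ : S.L2b}
    (h : ζ ∈ S.V k) : (k : ℝ) ^ 2 * ‖S.invLap ζ‖ ≤ R ^ 2 * ‖ζ‖ := by
  have h1 : |(k : ℝ)| * ‖S.invLap ζ‖ ≤ R * ‖S.gradInvLap ζ‖ :=
    S.norm_eigen_le hR (S.hasH1Grad_invLap ζ) (S.invLap_mem_V h)
  have h2 := S.norm_gradInvLap_sq_le ζ
  have h3 : (k : ℝ) ^ 2 * ‖S.invLap ζ‖ ^ 2 ≤ R ^ 2 * ‖S.gradInvLap ζ‖ ^ 2 := by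
    have := pow_le_pow_left₀ (by positivity) h1 2
    rwa [mul_pow, mul_pow, sq_abs] at this
  rcases eq_or_lt_of_le (norm_nonneg (S.invLap ζ)) with h0 | h0
  · rw [← h0, mul_zero]
    positivity
  · have h4 : (k : ℝ) ^ 2 * ‖S.invLap ζ‖ ^ 2 ≤ R ^ 2 * (‖S.invLap ζ‖ * ‖ζ‖) :=
      h3.trans (mul_le_mul_of_nonneg_left h2 (sq_nonneg R))
    refine le_of_mul_le_mul_right ?_ h0
    linarith

end SurfaceOfRevolution

namespace SurfaceOfRevolution

variable (S : SurfaceOfRevolution)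

/-! ### Multiplication by zonal functions -/

/-- Multiplication by a continuous real function. -/
def mulR (a : E3 → ℝ) (ha : Continuous a) : S.L2 →L[ℂ] S.L2 :=
  S.mulOp (fun x => (a x : ℂ) • ContinuousLinearMap.id ℂ ℂ)
    ((Complex.continuous_ofReal.comp ha).smul continuous_const).continuousOn

lemma mulR_coeFn {a : E3 → ℝ} (ha : Continuous a) (ζ : S.L2) :
    S.mulR a ha ζ =ᵐ[S.area] fun x => (a x : ℂ) * ζ x :=
  S.mulOp_coeFn (u := fun x => (a x : ℂ) • ContinuousLinearMap.id ℂ ℂ)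
    ((Complex.continuous_ofReal.comp ha).smul continuous_const).continuousOn ζ

lemma norm_mulR_le {a : E3 → ℝ} (ha : Continuous a) {C : ℝ} (hC : ∀ x ∈ S.carrier, |a x| ≤ C)
    (ζ : S.L2) : ‖S.mulR a ha ζ‖ ≤ C * ‖ζ‖ := by
  refine Lp.norm_le_mul_norm_of_ae_le_mul ?_
  filter_upwards [S.mulR_coeFn ha ζ, S.ae_mem_carrier] with x h1 h2
  rw [h1, norm_mul, Complex.norm_real]
  exact mul_le_mul_of_nonneg_right (hC x h2) (norm_nonneg _)

variable {S} in
lemma IsZonal.comp_rot {a : E3 → ℝ} (hz : S.IsZonal a) {x : E3} (hx : x ∈ S.carrier) (t : ℝ) :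
    a (rot t x) = a x := by
  obtain ⟨s, hs, θ, rfl⟩ := hx
  rw [rot_param, hz s hs, hz s hs θ]

variable {S} in
-- The function a is only continuous, so it cannot be moved onto the test function; its rotation
-- invariance suffices.
lemma IsWeakEigen.mulR {a : E3 → ℝ} (ha : Continuous a) (hz : S.IsZonal a) {k : ℤ} {ζ : S.L2}
    (h : S.IsWeakEigen k ζ) : S.IsWeakEigen k (S.mulR a ha ζ) := by
  rw [isWeakEigen_iff] at h ⊢
  intro t
  refine Lp.ext ?_
  have hq := (S.measurePreserving_rot t).quasiMeasurePreserving
  filter_upwards [S.U_coeFn t (S.mulR a ha ζ), hq.ae_eq_comp (S.mulR_coeFn ha ζ), S.U_coeFn t ζ,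
    Lp.coeFn_smul (Complex.exp (Complex.I * k * t)) (S.mulR a ha ζ),
    Lp.coeFn_smul (Complex.exp (Complex.I * k * t)) ζ, S.mulR_coeFn ha ζ,
    S.ae_mem_carrier] with x h1 h2 h3 h4 h5 h6 h7
  have h2' : S.mulR a ha ζ (rot t x) = a (rot t x) * ζ (rot t x) := h2
  rw [h1, h2', ← h3, h t, h4, h5, Pi.smul_apply, Pi.smul_apply, h6, hz.comp_rot h7, smul_eq_mul,
    smul_eq_mul]
  ring

variable {S} in
-- Test with the constant 1. The factor ik covers k = 0, where the integral of ζ itself need not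
-- vanish.
lemma IsWeakEigen.smul_mem_L2b {k : ℤ} {ζ : S.L2} (h : S.IsWeakEigen k ζ) :
    (Complex.I * k) • ζ ∈ S.L2b := by
  have h1 := h (fun _ => 1) contDiff_const
  rw [mem_L2b_iff, map_smul, pairing_apply, smul_eq_mul, ← h1]
  simp

lemma isClosed_V (k : ℤ) : IsClosed (S.V k : Set S.L2b) := by
  have h : (S.V k : Set S.L2b)
      = ⋂ t : ℝ, {ζ : S.L2b | S.U t ζ = Complex.exp (Complex.I * k * t) • (ζ : S.L2)} := by
    ext ζ
    rw [mem_iInter]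
    exact S.isWeakEigen_iff k ζ
  rw [h]
  refine isClosed_iInter fun t => isClosed_eq ?_ ?_
  · exact (S.U t).continuous.comp continuous_subtype_val
  · exact (continuous_subtype_val (p := fun ζ => ζ ∈ S.L2b)).const_smul
      (Complex.exp (Complex.I * k * t))

instance (k : ℤ) : CompleteSpace (S.V k) := (S.isClosed_V k).completeSpace_coe

/-- The operator `ζ ↦ i k a ζ` on `V_k` for a zonal function `a`. -/
def zonalMul (k : ℤ) (a : E3 → ℝ) (ha : Continuous a) (hz : S.IsZonal a) : S.V k →L[ℂ] S.V k :=
  ((((Complex.I * k) • S.mulR a ha).comp (S.L2b.subtypeL.comp (S.V k).subtypeL)).codRestrict S.L2b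
    fun ζ => IsWeakEigen.smul_mem_L2b (IsWeakEigen.mulR ha hz ζ.2)).codRestrict (S.V k) fun ζ =>
      (S.isWeakEigen_iff k _).2 fun t => by
        change S.U t ((Complex.I * k) • S.mulR a ha ((ζ : S.L2b) : S.L2))
          = Complex.exp (Complex.I * k * t) • ((Complex.I * k) • S.mulR a ha ((ζ : S.L2b) : S.L2))
        rw [map_smul, (S.isWeakEigen_iff k _).1 (IsWeakEigen.mulR ha hz ζ.2) t, smul_comm]

/-- The multiplication operator by `i k a` on `L²`. -/
def imagMul (k : ℤ) (a : E3 → ℝ) (ha : Continuous a) : S.L2 →L[ℂ] S.L2 :=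
  (Complex.I * k) • S.mulR a ha

lemma imagMul_sub_smul_coeFn {k : ℤ} {a : E3 → ℝ} (ha : Continuous a) (μ : ℂ) (ζ : S.L2) :
    (S.imagMul k a ha - μ • 1 : S.L2 →L[ℂ] S.L2) ζ
      =ᵐ[S.area] fun x => (Complex.I * k * a x - μ) * ζ x := by
  change (Complex.I * k) • S.mulR a ha ζ - μ • ζ =ᵐ[S.area] _
  filter_upwards [S.mulR_coeFn ha ζ, Lp.coeFn_smul (Complex.I * k) (S.mulR a ha ζ),
    Lp.coeFn_sub ((Complex.I * k) • S.mulR a ha ζ) (μ • ζ), Lp.coeFn_smul μ ζ] with x h1 h2 h3 h4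
  rw [h3, Pi.sub_apply, h2, h4, Pi.smul_apply, Pi.smul_apply, h1, smul_eq_mul, smul_eq_mul]
  ring

lemma quadOp_imagMul_coeFn {k : ℤ} {a : E3 → ℝ} (ha : Continuous a) (δ μ ν : ℂ) (ζ : S.L2) :
    quadOp δ μ ν (S.imagMul k a ha) ζ =ᵐ[S.area] fun x =>
      (1 + δ * ((Complex.I * k * a x - μ) * (Complex.I * k * a x - ν))) * ζ x := by
  set A := S.imagMul k a ha with hA
  set η : S.L2 := (A - ν • 1) ζ with hη
  set κ : S.L2 := (A - μ • 1) η with hκ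
  change ζ + δ • κ =ᵐ[S.area] _
  filter_upwards [S.imagMul_sub_smul_coeFn ha ν ζ, S.imagMul_sub_smul_coeFn ha μ η,
    Lp.coeFn_add ζ (δ • κ), Lp.coeFn_smul δ κ] with x h1 h2 h3 h4
  rw [h3, Pi.add_apply, h4, Pi.smul_apply, hκ, h2, hη, h1, smul_eq_mul]
  ring

/-- Take ν = -conj μ and δ = 1/E². For imaginary z the quadratic is q(z) = 1 - |z - μ|²/E², and d ≤
|z - μ| ≤ E on ikA puts it in [0, 1 - d²/E²]. -/
lemma quadBoundOff_imagMul (k : ℤ) {a : E3 → ℝ} (ha : Continuous a)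
    {A : Set ℝ} (hA : IsCompact A) (haA : ∀ x ∈ S.carrier, a x ∈ A) :
    QuadBoundOff (S.imagMul k a ha) (ikSet k A) := by
  intro μ hμ
  have hK : IsCompact (ikSet k A) := hA.image (by fun_prop)
  obtain ⟨d, hd, hdist⟩ := Metric.nhds_basis_ball.mem_iff.1
    (hK.isClosed.isOpen_compl.mem_nhds hμ)
  obtain ⟨D, hD⟩ := hK.exists_bound_of_continuousOn (f := fun z => z - μ) (by fun_prop)
  set E : ℝ := max D d with hE
  have hEd : d ≤ E := le_max_right _ _
  have hE0 : 0 < E := hd.trans_le hEd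
  have hc0 : 0 ≤ 1 - d ^ 2 / E ^ 2 := by
    rw [sub_nonneg, div_le_one (by positivity)]
    exact pow_le_pow_left₀ hd.le hEd 2
  refine ⟨((1 / E ^ 2 : ℝ) : ℂ), -(starRingEnd ℂ) μ, ?_⟩
  have hlt : 1 - d ^ 2 / E ^ 2 < 1 := by
    have : 0 < d ^ 2 / E ^ 2 := by positivity
    linarith
  refine (ContinuousLinearMap.opNorm_le_bound _ hc0 fun ζ => ?_).trans_lt hlt
  refine Lp.norm_le_mul_norm_of_ae_le_mul ?_
  filter_upwards [S.quadOp_imagMul_coeFn ha ((1 / E ^ 2 : ℝ) : ℂ) μ (-(starRingEnd ℂ) μ) ζ,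
    S.ae_mem_carrier] with x h1 h2
  rw [h1, norm_mul]
  refine mul_le_mul_of_nonneg_right ?_ (norm_nonneg _)
  set z : ℂ := Complex.I * k * a x with hz
  have hzm : z ∈ ikSet k A := ⟨a x, haA x h2, rfl⟩
  have hz1 : ‖z - μ‖ ≤ E := (hD z hzm).trans (le_max_left _ _)
  have hz2 : d ≤ ‖z - μ‖ := by
    by_contra hcon
    exact hdist (show z ∈ Metric.ball μ d by rw [Metric.mem_ball, dist_eq_norm]; linarith) hzm
  have hconj : (starRingEnd ℂ) z = -z := by
    simp [hz]
  -- Here conj z = -z, so the second factor is -conj(z - μ).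
  have hprod : (z - μ) * (z - -(starRingEnd ℂ) μ) = -((‖z - μ‖ ^ 2 : ℝ) : ℂ) := by
    rw [← Complex.normSq_eq_norm_sq, Complex.normSq_eq_conj_mul_self, map_sub, hconj]
    ring
  rw [hprod, show (1 : ℂ) + ((1 / E ^ 2 : ℝ) : ℂ) * -((‖z - μ‖ ^ 2 : ℝ) : ℂ)
    = ((1 - ‖z - μ‖ ^ 2 / E ^ 2 : ℝ) : ℂ) by push_cast; ring, Complex.norm_real, Real.norm_eq_abs,
    abs_of_nonneg]
  · gcongr
  · rw [sub_nonneg, div_le_one (by positivity)]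
    gcongr

end SurfaceOfRevolution

/-- Restricting to an isometrically embedded invariant subspace cannot increase the norm of a
polynomial in the operator. -/
lemma QuadBoundOff.of_intertwine {H H' : Type*} [NormedAddCommGroup H] [InnerProductSpace ℂ H]
    [NormedAddCommGroup H'] [InnerProductSpace ℂ H'] {A : H →L[ℂ] H} {M : H' →L[ℂ] H'} {C : Set ℂ}
    (hM : QuadBoundOff M C) (ι : H →ₗᵢ[ℂ] H') (h : ∀ x, ι (A x) = M (ι x)) :
    QuadBoundOff A C := by
  intro μ hμ
  obtain ⟨δ, ν, hlt⟩ := hM μ hμ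
  refine ⟨δ, ν, lt_of_le_of_lt ?_ hlt⟩
  refine ContinuousLinearMap.opNorm_le_bound _ (norm_nonneg _) fun x => ?_
  have h1 : ι (quadOp δ μ ν A x) = quadOp δ μ ν M (ι x) := by
    simp [quadOp, h]
  rw [← ι.norm_map, h1, ← ι.norm_map x]
  exact ContinuousLinearMap.le_opNorm _ _

namespace SurfaceOfRevolution

variable (S : SurfaceOfRevolution)

lemma quadBoundOff_zonalMul (k : ℤ) {a : E3 → ℝ} (ha : Continuous a) (hz : S.IsZonal a)
    {A : Set ℝ} (hA : IsCompact A) (haA : ∀ x ∈ S.carrier, a x ∈ A) :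
    QuadBoundOff (H := S.V k) (S.zonalMul k a ha hz) (ikSet k A) :=
  (S.quadBoundOff_imagMul k ha hA haA).of_intertwine (H := S.V k)
    (S.L2b.subtypeₗᵢ.comp (S.V k).subtypeₗᵢ) fun _ => rfl

/-- The restriction of `Δ⁻¹` to `V_k`. -/
def invLapV (k : ℤ) : S.V k →L[ℂ] S.V k :=
  (S.invLap.comp (S.V k).subtypeL).codRestrict (S.V k) fun ζ => S.invLap_mem_V ζ.2

lemma isCompactOperator_invLapV (k : ℤ) : IsCompactOperator (S.invLapV k) :=
  (S.isCompactOperator_invLap.comp_clm (S.V k).subtypeL).codRestrict _ (S.isClosed_V k)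

end SurfaceOfRevolution

namespace SurfaceOfRevolution

variable (S : SurfaceOfRevolution)

/-! ### The linearized vorticity operator -/

/-- The poles are the points of M on the axis, and they correspond to a null set of parameters. -/
lemma ae_exists_param : ∀ᵐ x ∂S.area, ∃ s ∈ Ioo 0 S.L, ∃ θ, S.param s θ = x := by
  have hp : MeasurableSet {x : E3 | x 0 ^ 2 + x 1 ^ 2 ≠ 0} :=
    (isOpen_ne_fun (by fun_prop) (by fun_prop)).measurableSet
  have h : ∀ᵐ x : E3 ∂S.area, x 0 ^ 2 + x 1 ^ 2 ≠ 0 := by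
    unfold area
    rw [ae_map_iff S.continuous_param.measurable.aemeasurable hp]
    refine (withDensity_absolutelyContinuous _ _).ae_le ?_
    have h0 : ∀ᵐ q : ℝ × ℝ, q.1 ≠ S.L := by
      have : (volume : Measure (ℝ × ℝ)) ({S.L} ×ˢ univ) = 0 := by
        rw [Measure.volume_eq_prod, Measure.prod_prod]
        simp
      refine measure_mono_null (fun q hq => ?_) this
      simpa using hq
    filter_upwards [ae_restrict_mem (measurableSet_Ioc.prod measurableSet_Ioc),
      ae_restrict_of_ae h0] with q hq hq0
    have hr := S.r_pos q.1 ⟨hq.1.1, lt_of_le_of_ne hq.1.2 hq0⟩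
    have h1 : S.param q.1 q.2 0 ^ 2 + S.param q.1 q.2 1 ^ 2 = S.r q.1 ^ 2 := by
      simp only [param, PiLp.toLp_apply, Matrix.cons_val_zero, Matrix.cons_val_one]
      linear_combination S.r q.1 ^ 2 * Real.sin_sq_add_cos_sq q.2
    rw [h1]
    positivity
  filter_upwards [h, S.ae_mem_carrier] with x hx hxc
  obtain ⟨s, hs, θ, rfl⟩ := hxc
  refine ⟨s, ⟨lt_of_le_of_ne hs.1 ?_, lt_of_le_of_ne hs.2 ?_⟩, θ, rfl⟩
  · rintro rfl
    exact hx (by simp [param, r_zero])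
  · rintro rfl
    exact hx (by simp [param, r_L])

/-- The field `J∇g` equals `-a X₃` away from the poles. -/
def IsStreamRate (g a : E3 → ℝ) : Prop :=
  ∀ s ∈ Ioo 0 S.L, ∀ θ, S.J (S.param s θ) (S.grad g (S.param s θ))
    = -(a (S.param s θ)) • X3 (S.param s θ)

variable {S} in
lemma IsStreamRate.integral_mul {g a : E3 → ℝ} (h : S.IsStreamRate g a) (ha : Continuous a)
    (ζ : S.L2) (φ : E3 → ℂ) :
    ∫ x, ζ x * fderiv ℝ φ x (S.J x (S.grad g x)) ∂S.area
      = -∫ x, S.mulR a ha ζ x * fderiv ℝ φ x (X3 x) ∂S.area := by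
  rw [← integral_neg]
  refine integral_congr_ae ?_
  filter_upwards [S.ae_exists_param, S.mulR_coeFn ha ζ] with x h1 h2
  obtain ⟨s, hs, θ, rfl⟩ := h1
  rw [h2, h s hs θ, map_smul, Complex.real_smul]
  push_cast
  ring

/-- The pairs `(u, v)` such that `u ∈ L²` has the weak derivative `v ∈ L²` along `X₃`. -/
def weakX3 : Submodule ℂ (S.L2 × S.L2) :=
  ⨅ φ : {φ : E3 → ℂ // ContDiff ℝ ∞ φ}, LinearMap.ker
    ((S.pairing φ φ.2.continuous).comp (ContinuousLinearMap.snd ℂ S.L2 S.L2)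
      + (S.pairing (fun x => fderiv ℝ φ x (X3 x)) (continuous_X3_deriv φ.2)).comp
        (ContinuousLinearMap.fst ℂ S.L2 S.L2)).toLinearMap

lemma mem_weakX3_iff (u v : S.L2) : (u, v) ∈ S.weakX3 ↔ ∀ φ : E3 → ℂ, ContDiff ℝ ∞ φ →
    ∫ x, v x * φ x ∂S.area = -∫ x, u x * fderiv ℝ φ x (X3 x) ∂S.area := by
  rw [weakX3, Submodule.mem_iInf, Subtype.forall]
  refine forall₂_congr fun φ hφ => ?_
  rw [← S.pairing_apply hφ.continuous, ← S.pairing_apply (continuous_X3_deriv hφ)]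
  exact eq_neg_iff_add_eq_zero.symm

lemma isClosed_weakX3 : IsClosed (S.weakX3 : Set (S.L2 × S.L2)) := by
  rw [weakX3, Submodule.coe_iInf]
  exact isClosed_iInter fun φ => ContinuousLinearMap.isClosed_ker _

variable {S} in
lemma weakX3_unique {u v v' : S.L2} (h : (u, v) ∈ S.weakX3) (h' : (u, v') ∈ S.weakX3) :
    v = v' := by
  rw [mem_weakX3_iff] at h h'
  exact S.integral_mul_eq_of_smooth fun φ hφ => (h φ hφ).trans (h' φ hφ).symm

lemma isWeakEigen_iff_mem_weakX3 (k : ℤ) (u : S.L2) :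
    S.IsWeakEigen k u ↔ (u, (Complex.I * k) • u) ∈ S.weakX3 := by
  rw [mem_weakX3_iff]
  refine forall₂_congr fun φ hφ => ?_
  rw [← S.pairing_apply hφ.continuous ((Complex.I * k) • u), map_smul, smul_eq_mul,
    S.pairing_apply, eq_comm]

/-- The bounded operator `ζ ↦ a ζ - b Δ⁻¹ ζ`. -/
def transport (a b : E3 → ℝ) (ha : Continuous a) (hb : Continuous b) : S.L2b →L[ℂ] S.L2 :=
  (S.mulR a ha).comp S.L2b.subtypeL - (S.mulR b hb).comp (S.L2b.subtypeL.comp S.invLap)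

lemma transport_apply {a b : E3 → ℝ} (ha : Continuous a) (hb : Continuous b) (ζ : S.L2b) :
    S.transport a b ha hb ζ = S.mulR a ha ζ - S.mulR b hb (S.invLap ζ) := rfl

variable {S} in
/-- `Γ ζ` is the weak derivative of `a ζ - b Δ⁻¹ ζ` along `X₃`. -/
lemma mem_gammaGraph_iff {f w χ : E3 → ℝ} {Ω : ℝ} {a b : E3 → ℝ} (ha : Continuous a)
    (hb : Continuous b) (hf : S.IsStreamRate f a)
    (hw : S.IsStreamRate (fun y => w y - Ω * χ y) b) (ζ g : S.L2b) :
    (ζ, g) ∈ S.gammaGraph f w χ Ω ↔ (S.transport a b ha hb ζ, (g : S.L2)) ∈ S.weakX3 := by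
  have h1 : (ζ, g) ∈ S.gammaGraph f w χ Ω ↔ ∀ φ : E3 → ℂ, ContDiff ℝ ∞ φ →
      ∫ x, (g : S.L2) x * φ x ∂S.area =
        ∫ x, (ζ : S.L2) x * fderiv ℝ φ x (S.J x (S.grad f x)) ∂S.area
        - ∫ x, (S.invLap ζ : S.L2) x *
            fderiv ℝ φ x (S.J x (S.grad (fun y => w y - Ω * χ y) x)) ∂S.area := by
    constructor
    · rintro ⟨η, hη, h⟩
      rwa [(S.isInvLaplacian_iff ζ η).1 hη] at h
    · exact fun h => ⟨S.invLap ζ, S.isInvLaplacian_invLap ζ, h⟩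
  rw [h1, mem_weakX3_iff]
  refine forall₂_congr fun φ hφ => ?_
  rw [hf.integral_mul ha, hw.integral_mul hb, ← S.pairing_apply (continuous_X3_deriv hφ),
    ← S.pairing_apply (continuous_X3_deriv hφ), ← S.pairing_apply (continuous_X3_deriv hφ),
    transport_apply, map_sub]
  rw [neg_sub_neg, neg_sub]

/-- The operator `Γ_k` on `V_k`. -/
def gammaK (a b : E3 → ℝ) (ha : Continuous a) (hb : Continuous b) (hza : S.IsZonal a)
    (hzb : S.IsZonal b) (k : ℤ) : S.V k →L[ℂ] S.V k :=
  S.zonalMul k a ha hza + -((S.zonalMul k b hb hzb).comp (S.invLapV k))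

lemma isCompactOperator_gammaK_sub {b : E3 → ℝ} (hb : Continuous b) (hzb : S.IsZonal b) (k : ℤ) :
    IsCompactOperator (-((S.zonalMul k b hb hzb).comp (S.invLapV k))) :=
  ((S.isCompactOperator_invLapV k).clm_comp (S.zonalMul k b hb hzb)).neg

variable {a b : E3 → ℝ} (ha : Continuous a) (hb : Continuous b)

lemma coe_gammaK (hza : S.IsZonal a) (hzb : S.IsZonal b) (k : ℤ) (ζ : S.V k) : ((S.gammaK a b ha hb hza hzb k ζ : S.L2b) : S.L2)
    = (Complex.I * k) • S.transport a b ha hb ζ := by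
  rw [transport_apply, smul_sub, sub_eq_add_neg]
  rfl

/-- Each of a, b and Δ⁻¹ preserves the angular frequency k. -/
lemma isWeakEigen_transport (hza : S.IsZonal a) (hzb : S.IsZonal b) {k : ℤ} {ζ : S.L2b} (h : ζ ∈ S.V k) :
    S.IsWeakEigen k (S.transport a b ha hb ζ) := by
  have h1 := (S.isWeakEigen_iff_mem_weakX3 k _).1 (IsWeakEigen.mulR ha hza h)
  have h2 := (S.isWeakEigen_iff_mem_weakX3 k _).1 (IsWeakEigen.mulR hb hzb (S.invLap_mem_V h))
  rw [isWeakEigen_iff_mem_weakX3, transport_apply, smul_sub]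
  exact S.weakX3.sub_mem h1 h2

/-- On frequency k the derivative X₃ is multiplication by ik, and weak derivatives are unique. -/
lemma transport_mem_weakX3_iff (hza : S.IsZonal a) (hzb : S.IsZonal b) {k : ℤ} (ζ : S.V k) (g : S.L2b) :
    (S.transport a b ha hb ζ, (g : S.L2)) ∈ S.weakX3
      ↔ g = (S.gammaK a b ha hb hza hzb k ζ : S.L2b) := by
  have h := (S.isWeakEigen_iff_mem_weakX3 k _).1 (S.isWeakEigen_transport ha hb hza hzb ζ.2)
  rw [← S.coe_gammaK ha hb hza hzb] at h
  constructor
  · exact fun hg => Subtype.ext (weakX3_unique hg h)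
  · rintro rfl
    exact h

end SurfaceOfRevolution

namespace SurfaceOfRevolution

variable (S : SurfaceOfRevolution)

/-- The rate is g₁'(ξ). Clamping ξ to [α₀, α₁] makes it continuous on all of ℝ³ without changing it
on M. -/
lemma IsRotationPotential.exists_rate {S : SurfaceOfRevolution} {ξ : E3 → ℝ}
    (h : S.IsRotationPotential ξ) (hξ : ContDiff ℝ ∞ ξ)
    {α₀ α₁ : ℝ} (hα : ξ '' S.carrier = Icc α₀ α₁) (hle : α₀ ≤ α₁) {g : E3 → ℝ}
    (hg : ContDiff ℝ ∞ g) {g₁ : ℝ → ℝ} (hg₁ : ∀ x ∈ S.carrier, g x = g₁ (ξ x)) :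
    ∃ a : E3 → ℝ, Continuous a ∧ S.IsZonal a ∧ S.IsStreamRate g a ∧
      (∀ x ∈ S.carrier, a x ∈ derivRange g₁ α₀ α₁) ∧ IsCompact (derivRange g₁ α₀ α₁) := by
  obtain ⟨hc, hJ⟩ := h.profile hξ hα hg hg₁
  have hproj : ∀ x ∈ S.carrier, (projIcc α₀ α₁ hle (ξ x) : ℝ) = ξ x := fun x hx => by
    rw [projIcc_of_mem hle (hα ▸ mem_image_of_mem ξ hx)]
  refine ⟨fun x => derivWithin g₁ (Icc α₀ α₁) (projIcc α₀ α₁ hle (ξ x)), ?_, ?_, ?_, ?_,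
    isCompact_Icc.image_of_continuousOn hc⟩
  · exact hc.comp_continuous (continuous_subtype_val.comp (continuous_projIcc.comp hξ.continuous))
      fun x => (projIcc α₀ α₁ hle (ξ x)).2
  · intro s hs θ
    simp only
    rw [h.isZonal hξ s hs θ]
  · intro s hs θ
    simp only
    rw [hproj _ (param_mem_carrier (Ioo_subset_Icc_self hs) θ)]
    exact hJ s hs θ
  · exact fun x _ => ⟨_, (projIcc α₀ α₁ hle (ξ x)).2, rfl⟩

/-! ### Smooth eigenfunctions of the rotation field -/

/-- `φ` is smooth and `X₃ φ = i k φ`. -/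
def IsSmoothEigen (k : ℤ) (φ : E3 → ℂ) : Prop :=
  ContDiff ℝ ∞ φ ∧ ∀ x, fderiv ℝ φ x (X3 x) = Complex.I * k * φ x

lemma IsSmoothEigen.mul {k l : ℤ} {φ ψ : E3 → ℂ} (hφ : IsSmoothEigen k φ)
    (hψ : IsSmoothEigen l ψ) : IsSmoothEigen (k + l) fun x => φ x * ψ x := by
  refine ⟨hφ.1.mul hψ.1, fun x => ?_⟩
  have h2 : fderiv ℝ (fun y => φ y * ψ y) x = φ x • fderiv ℝ ψ x + ψ x • fderiv ℝ φ x :=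
    fderiv_mul (hφ.1.differentiable (by simp)).differentiableAt
      (hψ.1.differentiable (by simp)).differentiableAt
  rw [h2]
  simp only [add_apply, smul_apply, smul_eq_mul, hφ.2, hψ.2]
  push_cast
  ring

lemma IsSmoothEigen.conj {k : ℤ} {φ : E3 → ℂ} (hφ : IsSmoothEigen k φ) :
    IsSmoothEigen (-k) fun x => (starRingEnd ℂ) (φ x) := by
  refine ⟨Complex.conjCLE.contDiff.comp hφ.1, fun x => ?_⟩
  have h : HasFDerivAt (fun x => (starRingEnd ℂ) (φ x)) _ x :=
    (Complex.conjCLE.hasFDerivAt (x := φ x)).comp x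
      (hφ.1.differentiable (by simp)).differentiableAt.hasFDerivAt
  rw [h.fderiv]
  change (starRingEnd ℂ) (fderiv ℝ φ x (X3 x)) = _
  rw [hφ.2]
  simp

lemma isSmoothEigen_const (c : ℂ) : IsSmoothEigen 0 fun _ => c :=
  ⟨contDiff_const, fun x => by simp⟩

lemma isSmoothEigen_horizontal : IsSmoothEigen 1 fun x => (x 0 : ℂ) + Complex.I * x 1 := by
  let ℓ : E3 →L[ℝ] ℂ := Complex.ofRealCLM.comp (EuclideanSpace.proj 0)
    + Complex.I • Complex.ofRealCLM.comp (EuclideanSpace.proj 1)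
  have h : (fun x : E3 => (x 0 : ℂ) + Complex.I * x 1) = ℓ := rfl
  rw [h]
  refine ⟨ℓ.contDiff, fun x => ?_⟩
  rw [ℓ.fderiv]
  change ((X3 x 0 : ℝ) : ℂ) + Complex.I * ((X3 x 1 : ℝ) : ℂ) = Complex.I * (1 : ℤ) *
    ((x 0 : ℂ) + Complex.I * x 1)
  simp only [X3, PiLp.toLp_apply, Matrix.cons_val_zero, Matrix.cons_val_one]
  push_cast
  linear_combination -(x 1 : ℂ) * Complex.I_mul_I

lemma isSmoothEigen_vertical : IsSmoothEigen 0 fun x => (x 2 : ℂ) := by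
  let ℓ : E3 →L[ℝ] ℂ := Complex.ofRealCLM.comp (EuclideanSpace.proj 2)
  have h : (fun x : E3 => (x 2 : ℂ)) = ℓ := rfl
  rw [h]
  refine ⟨ℓ.contDiff, fun x => ?_⟩
  rw [ℓ.fderiv]
  change ((X3 x 2 : ℝ) : ℂ) = _
  simp [X3]

instance : CompactSpace S.carrier := isCompact_iff_compactSpace.1 S.isCompact_carrier

/-- The restrictions to `M` of smooth eigenfunctions. -/
def eigenMonoid : Submonoid C(S.carrier, ℂ) where
  carrier := {c | ∃ (k : ℤ) (φ : E3 → ℂ), IsSmoothEigen k φ ∧ ∀ x : S.carrier, c x = φ x}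
  one_mem' := ⟨0, _, isSmoothEigen_const 1, fun _ => rfl⟩
  mul_mem' := by
    rintro c d ⟨k, φ, hφ, h⟩ ⟨l, ψ, hψ, h'⟩
    exact ⟨k + l, _, hφ.mul hψ, fun x => by simp [h, h']⟩

/-- The star algebra spanned by the smooth eigenfunctions. -/
def eigenAlgebra : StarSubalgebra ℂ C(S.carrier, ℂ) where
  toSubalgebra := Algebra.adjoin ℂ S.eigenMonoid
  star_mem' := by
    change Algebra.adjoin ℂ (S.eigenMonoid : Set C(S.carrier, ℂ))
      ≤ star (Algebra.adjoin ℂ (S.eigenMonoid : Set C(S.carrier, ℂ)))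
    refine Algebra.adjoin_le ?_
    rintro c ⟨k, φ, hφ, h⟩
    refine Algebra.subset_adjoin ⟨-k, _, hφ.conj, fun x => ?_⟩
    simp [h]

/-- The functions x₁ + ix₂, of frequency 1, and x₃, of frequency 0, already determine a point. -/
lemma eigenAlgebra_separatesPoints : S.eigenAlgebra.SeparatesPoints := by
  intro x y hxy
  by_contra hcon
  push Not at hcon
  have key : ∀ (k : ℤ) (φ : E3 → ℂ), IsSmoothEigen k φ → φ x = φ y := by
    intro k φ hφ
    refine hcon (fun z : S.carrier => φ z) ⟨⟨fun z : S.carrier => φ z,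
      hφ.1.continuous.comp continuous_subtype_val⟩, ?_, rfl⟩
    exact Algebra.subset_adjoin ⟨k, φ, hφ, fun _ => rfl⟩
  have h1 := key 1 _ isSmoothEigen_horizontal
  have h2 := key 0 _ isSmoothEigen_vertical
  refine hxy (Subtype.ext ?_)
  ext i
  fin_cases i
  · simpa using congrArg Complex.re h1
  · simpa using congrArg Complex.im h1
  · simpa using congrArg Complex.re h2

lemma eigenAlgebra_closure : S.eigenAlgebra.topologicalClosure = ⊤ :=
  ContinuousMap.starSubalgebra_topologicalClosure_eq_top_of_separatesPoints _
    S.eigenAlgebra_separatesPoints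

/-- The extension by `0` of a function on `M`. -/
def extendZero (c : C(S.carrier, ℂ)) (x : E3) : ℂ := by
  classical exact if h : x ∈ S.carrier then c ⟨x, h⟩ else 0

lemma continuousOn_extendZero (c : C(S.carrier, ℂ)) :
    ContinuousOn (S.extendZero c) S.carrier := by
  rw [continuousOn_iff_continuous_domRestrict]
  convert c.continuous using 1
  ext x
  simp [extendZero]

/-- `L²` functions orthogonal to all smooth eigenfunctions vanish. -/
lemma eq_zero_of_integral_eigen {v : S.L2}
    (h : ∀ (k : ℤ) (φ : E3 → ℂ), IsSmoothEigen k φ → ∫ x, v x * φ x ∂S.area = 0) : v = 0 := by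
  have hint : ∀ c : C(S.carrier, ℂ), Integrable (fun x => v x * S.extendZero c x) S.area := by
    intro c
    refine (S.integrable_L2 v).mul_bdd (c := ‖c‖)
      (S.aestronglyMeasurable_of_continuousOn (S.continuousOn_extendZero c)) ?_
    filter_upwards [S.ae_mem_carrier] with x hx
    simp only [extendZero, hx, dif_pos]
    exact c.norm_coe_le_norm _
  let Λ : C(S.carrier, ℂ) →L[ℂ] ℂ := LinearMap.mkContinuous
    { toFun := fun c => ∫ x, v x * S.extendZero c x ∂S.area
      map_add' := by
        intro c d
        rw [← integral_add (hint c) (hint d)]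
        refine integral_congr_ae ?_
        filter_upwards [S.ae_mem_carrier] with x hx
        simp [extendZero, hx, mul_add]
      map_smul' := by
        intro r c
        rw [RingHom.id_apply, smul_eq_mul, ← integral_const_mul]
        refine integral_congr_ae ?_
        filter_upwards [S.ae_mem_carrier] with x hx
        simp [extendZero, hx]
        ring }
    (∫ x, ‖v x‖ ∂S.area) (by
      intro c
      refine (norm_integral_le_integral_norm _).trans ?_
      rw [← integral_mul_const]
      refine integral_mono_ae (hint c).norm ((S.integrable_L2 v).norm.mul_const _) ?_
      filter_upwards [S.ae_mem_carrier] with x hx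
      simp only [extendZero, hx, dif_pos, norm_mul]
      exact mul_le_mul_of_nonneg_left (c.norm_coe_le_norm _) (norm_nonneg _))
  have hΛ : ∀ (c : C(S.carrier, ℂ)) (φ : E3 → ℂ), (∀ x : S.carrier, c x = φ x) →
      Λ c = ∫ x, v x * φ x ∂S.area := by
    intro c φ hc
    refine integral_congr_ae ?_
    filter_upwards [S.ae_mem_carrier] with x hx
    simp [extendZero, hx, hc]
  have hspan : ∀ c ∈ S.eigenAlgebra, Λ c = 0 := by
    intro c hc
    -- The eigenfunctions are closed under products, so the algebra they generate is just their
    -- linear span.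
    have hc' : c ∈ Submodule.span ℂ (S.eigenMonoid : Set C(S.carrier, ℂ)) := by
      have h1 : c ∈ (Algebra.adjoin ℂ (S.eigenMonoid : Set C(S.carrier, ℂ))).toSubmodule := hc
      rwa [Algebra.adjoin_eq_span, Submonoid.closure_eq] at h1
    have hle : Submodule.span ℂ (S.eigenMonoid : Set C(S.carrier, ℂ))
        ≤ LinearMap.ker Λ.toLinearMap := by
      refine Submodule.span_le.2 ?_
      rintro d ⟨k, φ, hφ, hd⟩
      exact (hΛ d φ hd).trans (h k φ hφ)
    exact hle hc'
  have hall : ∀ c, Λ c = 0 := by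
    intro c
    have hc : c ∈ closure (S.eigenAlgebra : Set C(S.carrier, ℂ)) := by
      have h1 : c ∈ S.eigenAlgebra.topologicalClosure := by
        rw [eigenAlgebra_closure]
        trivial
      exact h1
    exact closure_minimal (t := {c | Λ c = 0}) hspan
      (isClosed_eq Λ.continuous continuous_const) hc
  refine S.integral_mul_eq_of_smooth fun φ hφ => ?_
  rw [← hΛ ⟨fun x : S.carrier => φ x, hφ.continuous.comp continuous_subtype_val⟩ φ fun _ => rfl,
    hall]
  symm
  refine integral_eq_zero_of_ae ?_
  filter_upwards [Lp.coeFn_zero ℂ 2 S.area] with x hx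
  rw [hx]
  simp

end SurfaceOfRevolution

namespace SurfaceOfRevolution

variable (S : SurfaceOfRevolution)

/-! ### Orthogonal decomposition into the spaces `V_k` -/

/-- Rotation by t = π/(l - k) preserves the inner product and also multiplies it by e^{iπ} = -1. -/
lemma inner_eq_zero_of_weakEigen {k l : ℤ} (hkl : k ≠ l) {ζ η : S.L2} (hζ : S.IsWeakEigen k ζ)
    (hη : S.IsWeakEigen l η) : inner ℂ ζ η = 0 := by
  rw [isWeakEigen_iff] at hζ hη
  have hd : ((l : ℝ) - k) ≠ 0 := sub_ne_zero.2 (by exact_mod_cast hkl.symm)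
  set t : ℝ := Real.pi / (l - k) with ht
  have h1 := (S.U t).inner_map_map ζ η
  rw [hζ, hη, inner_smul_left, inner_smul_right, ← mul_assoc, ← Complex.exp_conj,
    ← Complex.exp_add] at h1
  have h2 : (starRingEnd ℂ) (Complex.I * k * t) + Complex.I * l * t = Real.pi * Complex.I := by
    have h3 : ((l : ℝ) - k) * t = Real.pi := by rw [ht]; field_simp
    have h4 : ((l : ℂ) - k) * t = Real.pi := by exact_mod_cast h3
    simp only [map_mul, Complex.conj_I, Complex.conj_ofReal, map_intCast]
    linear_combination Complex.I * h4
  rw [h2, Complex.exp_pi_mul_I] at h1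
  have h5 : (2 : ℂ) * inner ℂ ζ η = 0 := by linear_combination -h1
  simpa using h5

/-- The pairing is bilinear, without conjugation, so frequencies must add up to 0 to contribute. -/
lemma integral_smoothEigen_eq_zero {k l : ℤ} (hkl : k + l ≠ 0) {ζ : S.L2}
    (hζ : S.IsWeakEigen k ζ) {φ : E3 → ℂ} (hφ : IsSmoothEigen l φ) :
    ∫ x, ζ x * φ x ∂S.area = 0 := by
  have h1 := hζ φ hφ.1
  have h2 : ∀ x, ζ x * fderiv ℝ φ x (X3 x) = Complex.I * l * (ζ x * φ x) := fun x => by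
    rw [hφ.2]
    ring
  simp only [h2] at h1
  rw [integral_const_mul] at h1
  have h3 : ((k : ℂ) + l) ≠ 0 := by exact_mod_cast hkl
  have h4 : Complex.I * ((k : ℂ) + l) * ∫ x, ζ x * φ x ∂S.area = 0 := by linear_combination -h1
  simpa [h3] using h4

lemma isWeakEigen_cls {k : ℤ} {φ : E3 → ℂ} (hφ : IsSmoothEigen k φ) :
    S.IsWeakEigen k (S.cls φ hφ.1.continuous.continuousOn) := by
  intro ψ hψ
  have h : ∀ u : E3 → ℂ, ∫ x, S.cls φ hφ.1.continuous.continuousOn x * u x ∂S.area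
      = ∫ x, φ x * u x ∂S.area := fun u => by
    refine integral_congr_ae ?_
    filter_upwards [S.cls_coeFn hφ.1.continuous.continuousOn] with x hx
    rw [hx]
  rw [h, h, ← S.integral_X3_mul hφ.1 hψ, ← integral_const_mul]
  refine integral_congr_ae (Filter.Eventually.of_forall fun x => ?_)
  simp only
  rw [hφ.2]
  ring

/-- Only frequency 0 needs its mean removed; for k ≠ 0 the integral vanishes automatically. -/
lemma exists_sub_const_mem_L2b {k : ℤ} {φ : E3 → ℂ} (hφ : IsSmoothEigen k φ) :
    ∃ (m : ℂ) (hψ : IsSmoothEigen k fun x => φ x - m),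
      S.cls (fun x => φ x - m) hψ.1.continuous.continuousOn ∈ S.L2b := by
  rcases eq_or_ne k 0 with rfl | hk
  · refine ⟨(∫ x, φ x ∂S.area) / (S.area.real univ : ℂ), ⟨hφ.1.sub contDiff_const, fun x => ?_⟩, ?_⟩
    · rw [fderiv_sub_const]
      simpa using hφ.2 x
    · have harea : (S.area.real univ : ℂ) ≠ 0 := by exact_mod_cast S.area_univ_pos.ne'
      change ∫ x, S.cls _ _ x ∂S.area = 0
      have hint : Integrable φ S.area :=
        (S.memLp_of_continuousOn hφ.1.continuous.continuousOn).integrable (by norm_num)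
      rw [integral_cls, integral_sub hint (integrable_const _), integral_const,
        Complex.real_smul, mul_div_cancel₀ _ harea, sub_self]
  · have hψ : IsSmoothEigen k fun x => φ x - 0 := by simpa using hφ
    refine ⟨0, hψ, ?_⟩
    have h := IsWeakEigen.smul_mem_L2b (S.isWeakEigen_cls hψ)
    have hk' : Complex.I * (k : ℂ) ≠ 0 := by simpa using hk
    exact (S.L2b.smul_mem_iff hk').1 h

/-- The conjugate of a smooth eigenfunction of frequency k, made mean free, lies in V_{-k}; removing
its mean is harmless since v has integral 0. So v pairs to 0 with all smooth eigenfunctions. -/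
lemma eq_zero_of_orthogonal_V {v : S.L2b} (h : ∀ (k : ℤ), ∀ ζ ∈ S.V k, inner ℂ ζ v = 0) :
    v = 0 := by
  refine Subtype.ext (S.eq_zero_of_integral_eigen fun k φ hφ => ?_)
  obtain ⟨m, hψ, hm⟩ := S.exists_sub_const_mem_L2b hφ.conj
  have h1 := h (-k) ⟨_, hm⟩ (S.isWeakEigen_cls hψ)
  rw [Submodule.coe_inner, inner_cls] at h1
  have h2 : ∀ x, inner ℂ ((starRingEnd ℂ) (φ x) - m) ((v : S.L2) x)
      = (v : S.L2) x * φ x - (starRingEnd ℂ) m * (v : S.L2) x := by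
    intro x
    simp
    ring
  simp only [h2] at h1
  rw [integral_sub (S.integrable_L2_mul _ hφ.1.continuous) ((S.integrable_L2 _).const_mul _),
    integral_const_mul, show ∫ x, (v : S.L2) x ∂S.area = 0 from v.2, mul_zero, sub_zero] at h1
  exact h1

lemma isHilbertSum_V :
    IsHilbertSum ℂ (fun k : ℤ => S.V k) (fun k => (S.V k).subtypeₗᵢ) := by
  refine IsHilbertSum.mkInternal S.V (OrthogonalFamily.of_pairwise fun k l hkl => ?_) ?_
  · exact Submodule.isOrtho_iff_inner_eq.2 fun ζ hζ η hη =>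
      S.inner_eq_zero_of_weakEigen hkl hζ hη
  · rw [top_le_iff, Submodule.topologicalClosure_eq_top_iff, Submodule.eq_bot_iff]
    intro v hv
    refine S.eq_zero_of_orthogonal_V fun k ζ hζ => ?_
    exact hv ζ (Submodule.mem_iSup_of_mem k hζ)

end SurfaceOfRevolution

/-! ### Diagonal operators on a Hilbert sum -/

section HilbertSum

variable {ι H : Type*} [NormedAddCommGroup H] [InnerProductSpace ℂ H] [CompleteSpace H]
  {F : ι → Submodule ℂ H}

lemma IsHilbertSum.hasSum_component (hF : IsHilbertSum ℂ (fun i => F i) fun i => (F i).subtypeₗᵢ)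
    (h : H) : HasSum (fun i => (hF.linearIsometryEquiv h i : H)) h := by
  have h1 := hF.hasSum_linearIsometryEquiv_symm (hF.linearIsometryEquiv h)
  rw [LinearIsometryEquiv.symm_apply_apply] at h1
  exact h1

lemma IsHilbertSum.ext_component (hF : IsHilbertSum ℂ (fun i => F i) fun i => (F i).subtypeₗᵢ)
    {x y : H} (h : ∀ i, hF.linearIsometryEquiv x i = hF.linearIsometryEquiv y i) : x = y :=
  hF.linearIsometryEquiv.injective (lp.ext (funext h))

/-- A uniformly bounded family of operators on the summands of a Hilbert sum defines a diagonal
operator. -/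
lemma IsHilbertSum.exists_diagonal (hF : IsHilbertSum ℂ (fun i => F i) fun i => (F i).subtypeₗᵢ)
    (T : ∀ i, F i →L[ℂ] F i) {C : ℝ} (hC : ∀ i x, ‖T i x‖ ≤ C * ‖x‖) :
    ∃ R : H →L[ℂ] H, ∀ h i, hF.linearIsometryEquiv (R h) i = T i (hF.linearIsometryEquiv h i) := by
  have h2 : (0 : ℝ) < (2 : ENNReal).toReal := by norm_num
  have hC' : ∀ i x, ‖T i x‖ ≤ |C| * ‖x‖ := fun i x =>
    (hC i x).trans (mul_le_mul_of_nonneg_right (le_abs_self C) (norm_nonneg x))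
  have hb : ∀ (w : lp (fun i => F i) 2) i, ‖T i (w i)‖ ^ (2 : ENNReal).toReal
      ≤ |C| ^ (2 : ENNReal).toReal * ‖w i‖ ^ (2 : ENNReal).toReal := fun w i => by
    rw [← Real.mul_rpow (abs_nonneg C) (norm_nonneg _)]
    exact Real.rpow_le_rpow (norm_nonneg _) (hC' i _) h2.le
  have hs : ∀ w : lp (fun i => F i) 2,
      Summable fun i => |C| ^ (2 : ENNReal).toReal * ‖w i‖ ^ (2 : ENNReal).toReal := fun w =>
    ((lp.memℓp w).summable h2).mul_left _
  have hm : ∀ w : lp (fun i => F i) 2, Memℓp (fun i => T i (w i)) 2 := fun w =>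
    memℓp_gen ((hs w).of_nonneg_of_le (fun i => by positivity) (hb w))
  let D : lp (fun i => F i) 2 →L[ℂ] lp (fun i => F i) 2 := LinearMap.mkContinuous
    { toFun := fun w => ⟨fun i => T i (w i), hm w⟩
      map_add' := fun v w => lp.ext (funext fun i => map_add (T i) (v i) (w i))
      map_smul' := fun c w => lp.ext (funext fun i => map_smul (T i) c (w i)) } |C| (by
        intro w
        refine lp.norm_le_of_tsum_le h2 (by positivity) ?_
        rw [Real.mul_rpow (abs_nonneg C) (norm_nonneg _), lp.norm_rpow_eq_tsum h2, ← tsum_mul_left]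
        exact (lp.memℓp _).summable h2 |>.tsum_le_tsum (hb w) (hs w))
  refine ⟨(hF.linearIsometryEquiv.symm : lp (fun i => F i) 2 →L[ℂ] H).comp
    (D.comp (hF.linearIsometryEquiv : H →L[ℂ] lp (fun i => F i) 2)), fun h i => ?_⟩
  change hF.linearIsometryEquiv (hF.linearIsometryEquiv.symm (D (hF.linearIsometryEquiv h))) i = _
  rw [LinearIsometryEquiv.apply_symm_apply]
  rfl

end HilbertSum

/-- A bound in a form that unifies well for operators on nested submodules. -/
lemma exists_bound_clm {H : Type*} [NormedAddCommGroup H] [InnerProductSpace ℂ H] (T : H →L[ℂ] H) :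
    ∃ C, 0 < C ∧ ∀ x, ‖T x‖ ≤ C * ‖x‖ :=
  T.bound

/-- Outside the spectrum, `T - μ` has a two-sided inverse. -/
lemma exists_inverse_of_notMem_spectrum {H : Type*} [AddCommGroup H] [Module ℂ H]
    [TopologicalSpace H] [IsTopologicalAddGroup H] [ContinuousConstSMul ℂ H]
    {T : H →L[ℂ] H} {μ : ℂ} (h : μ ∉ spectrum ℂ T) :
    ∃ R : H →L[ℂ] H, ∀ x y : H, y + μ • x = T x ↔ x = R y := by
  rw [spectrum.notMem_iff] at h
  obtain ⟨u, hu⟩ := h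
  have hu' : ∀ x, (u : H →L[ℂ] H) x = μ • x - T x := fun x => by
    rw [hu]
    simp [Algebra.algebraMap_eq_smul_one]
  refine ⟨-(↑u⁻¹ : H →L[ℂ] H), fun x y => ?_⟩
  have h1 : ∀ z, (u : H →L[ℂ] H) ((↑u⁻¹ : H →L[ℂ] H) z) = z := fun z => by
    have := congrArg (fun S : H →L[ℂ] H => S z) u.mul_inv
    exact this
  have h2 : ∀ z, (↑u⁻¹ : H →L[ℂ] H) ((u : H →L[ℂ] H) z) = z := fun z => by
    have := congrArg (fun S : H →L[ℂ] H => S z) u.inv_mul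
    exact this
  constructor
  · intro h
    have h3 : (u : H →L[ℂ] H) x = -y := by rw [hu', ← h]; abel
    rw [neg_apply, ← map_neg, ← h3, h2]
  · rintro rfl
    have h3 := hu' ((-(↑u⁻¹ : H →L[ℂ] H)) y)
    rw [neg_apply, map_neg, h1] at h3
    rw [neg_apply]
    rw [eq_sub_iff_add_eq] at h3
    rw [← h3]
    abel_nf

/-! ### Diagonal form and resolvent of Γ -/

namespace SurfaceOfRevolution

variable (S : SurfaceOfRevolution)
variable {a b : E3 → ℝ} (ha : Continuous a) (hb : Continuous b)

/-- The component of `ζ` in `V_k`. -/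
def component (k : ℤ) (ζ : S.L2b) : S.V k := S.isHilbertSum_V.linearIsometryEquiv ζ k

lemma hasSum_component (ζ : S.L2b) : HasSum (fun k => (S.component k ζ : S.L2b)) ζ :=
  S.isHilbertSum_V.hasSum_component ζ

/-- A test eigenfunction of frequency l sees only the component of frequency -l, because A preserves
frequencies. -/
lemma integral_component {A : S.L2b →L[ℂ] S.L2} (hA : ∀ k, ∀ ζ ∈ S.V k, S.IsWeakEigen k (A ζ))
    {k l : ℤ} (hkl : k + l = 0) (ζ : S.L2b) {φ : E3 → ℂ} (hφ : IsSmoothEigen l φ) :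
    S.pairing φ hφ.1.continuous (A (S.component k ζ)) = S.pairing φ hφ.1.continuous (A ζ) := by
  have h1 := (S.hasSum_component ζ).mapL ((S.pairing φ hφ.1.continuous).comp A)
  refine (hasSum_single k fun j hj => ?_).unique h1
  rw [ContinuousLinearMap.comp_apply, pairing_apply]
  exact S.integral_smoothEigen_eq_zero (by omega) (hA j _ (S.component j ζ).2) hφ

/-- The operator `Γ` acts diagonally on the components in the spaces `V_k`. -/
lemma transport_mem_weakX3_iff_component (hza : S.IsZonal a) (hzb : S.IsZonal b) (ζ g : S.L2b) :
    (S.transport a b ha hb ζ, (g : S.L2)) ∈ S.weakX3 ↔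
      ∀ k, S.component k g = S.gammaK a b ha hb hza hzb k (S.component k ζ) := by
  constructor
  · intro h k
    rw [mem_weakX3_iff] at h
    rw [← sub_eq_zero]
    set d : S.V k := S.component k g - S.gammaK a b ha hb hza hzb k (S.component k ζ) with hd
    suffices hd0 : ((d : S.L2b) : S.L2) = 0 from Subtype.ext (Subtype.ext hd0)
    refine S.eq_zero_of_integral_eigen fun l φ hφ => ?_
    -- Only φ of frequency -k detects the k-th component; there X₃ acts on φ as -ik, and the weak
    -- equation for the full sum gives the claim.
    by_cases hkl : k + l = 0
    · have h1 := S.integral_component (A := S.L2b.subtypeL) (fun _ _ hζ => hζ) hkl g hφ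
      have h2 := S.integral_component (A := S.transport a b ha hb)
        (fun _ _ hζ => S.isWeakEigen_transport ha hb hza hzb hζ) hkl ζ hφ
      have h3 := h φ hφ.1
      have h4 : ∀ x, S.transport a b ha hb ζ x * fderiv ℝ φ x (X3 x)
          = -(Complex.I * k) * (S.transport a b ha hb ζ x * φ x) := fun x => by
        rw [hφ.2, show l = -k by omega]
        push_cast
        ring
      simp only [h4] at h3
      rw [integral_const_mul, ← S.pairing_apply hφ.1.continuous,
        ← S.pairing_apply hφ.1.continuous] at h3
      have h5 : ((d : S.L2b) : S.L2) = ((S.component k g : S.L2b) : S.L2)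
          - (Complex.I * k) • S.transport a b ha hb (S.component k ζ) := by
        rw [← S.coe_gammaK ha hb hza hzb]
        rfl
      rw [← S.pairing_apply hφ.1.continuous, h5, map_sub, map_smul, h2, smul_eq_mul]
      have h6 : S.pairing φ hφ.1.continuous ((S.component k g : S.L2b) : S.L2)
        = S.pairing φ hφ.1.continuous (g : S.L2) := h1
      rw [h6, h3]
      ring
    · exact S.integral_smoothEigen_eq_zero hkl d.2 hφ
  · intro h
    have h1 : HasSum (fun k => (S.transport a b ha hb (S.component k ζ),
        ((S.component k g : S.L2b) : S.L2))) (S.transport a b ha hb ζ, (g : S.L2)) :=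
      ((S.hasSum_component ζ).mapL (S.transport a b ha hb)).prodMk
        ((S.hasSum_component g).mapL S.L2b.subtypeL)
    -- Finite partial sums satisfy the relation, and the weak derivative is a closed relation.
    refine S.isClosed_weakX3.mem_of_tendsto h1 (Filter.Eventually.of_forall fun s => ?_)
    refine Submodule.sum_mem _ fun k _ => ?_
    exact (S.transport_mem_weakX3_iff ha hb hza hzb (S.component k ζ) (S.component k g)).2
      (congrArg Subtype.val (h k))

/-- Pointwise |ika - μ| ≥ |Re μ|, since ika is imaginary. -/
lemma norm_imagMul_sub_smul_ge (k : ℤ) (μ : ℂ) (ζ : S.L2) :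
    |μ.re| * ‖ζ‖ ≤ ‖(Complex.I * k) • S.mulR a ha ζ - μ • ζ‖ := by
  rw [← abs_of_nonneg (abs_nonneg μ.re), ← Real.norm_eq_abs, ← norm_smul]
  refine Lp.norm_le_norm_of_ae_le ?_
  filter_upwards [S.imagMul_sub_smul_coeFn ha (k := k) μ ζ, Lp.coeFn_smul |μ.re| ζ] with x h1 h2
  have h1' : ((Complex.I * k) • S.mulR a ha ζ - μ • ζ : S.L2) x
    = (Complex.I * k * a x - μ) * ζ x := h1
  rw [h1', h2, Pi.smul_apply, norm_smul, norm_mul, Real.norm_eq_abs, abs_abs]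
  refine mul_le_mul_of_nonneg_right ?_ (norm_nonneg _)
  have := Complex.abs_re_le_norm (Complex.I * k * a x - μ)
  simpa using this

/-- The compact term has norm at most |k|·B·R²/k², which for large |k| is at most half of the lower
bound |Re μ| from the multiplication part. -/
lemma norm_gammaK_sub_smul_ge (hza : S.IsZonal a) (hzb : S.IsZonal b) {B R : ℝ}
    (hB : ∀ x ∈ S.carrier, |b x| ≤ B) (hR : ∀ s ∈ Icc 0 S.L, S.r s ≤ R) {μ : ℂ} {k : ℤ}
    (hk : k ≠ 0) (hbig : 2 * (B * R ^ 2) ≤ |(k : ℝ)| * |μ.re|) (ζ : S.V k) :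
    |μ.re| / 2 * ‖ζ‖ ≤ ‖S.gammaK a b ha hb hza hzb k ζ - μ • ζ‖ := by
  have hk0 : 0 < |(k : ℝ)| := by positivity
  set u : S.L2 := ((ζ : S.L2b) : S.L2) with hu
  set v : S.L2 := ((S.invLap ζ : S.L2b) : S.L2) with hv
  have h1 := S.norm_imagMul_sub_smul_ge ha k μ u
  have h2 : (k : ℝ) ^ 2 * ‖v‖ ≤ R ^ 2 * ‖u‖ := S.norm_invLap_le hR ζ.2
  have h3 : ‖S.mulR b hb v‖ ≤ B * ‖v‖ := S.norm_mulR_le hb hB v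
  have hB0 : 0 ≤ B := (abs_nonneg _).trans
    (hB _ (param_mem_carrier (S := S) (left_mem_Icc.2 S.L_pos.le) 0))
  have h4 : ((S.gammaK a b ha hb hza hzb k ζ - μ • ζ : S.V k) : S.L2)
      = ((Complex.I * k) • S.mulR a ha u - μ • u) - (Complex.I * k) • S.mulR b hb v := by
    change (Complex.I * k) • S.mulR a ha u + -((Complex.I * k) • S.mulR b hb v) - μ • u = _
    abel
  have h5 : |μ.re| * ‖u‖ - |(k : ℝ)| * (B * ‖v‖)
      ≤ ‖((S.gammaK a b ha hb hza hzb k ζ - μ • ζ : S.V k) : S.L2)‖ := by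
    rw [h4]
    refine le_trans ?_ (norm_sub_norm_le _ _)
    have h6 : ‖(Complex.I * (k : ℂ)) • S.mulR b hb v‖ ≤ |(k : ℝ)| * (B * ‖v‖) := by
      rw [norm_smul]
      simp only [norm_mul, Complex.norm_I, one_mul, Complex.norm_intCast]
      exact mul_le_mul_of_nonneg_left h3 (abs_nonneg _)
    linarith
  refine le_trans ?_ h5
  change |μ.re| / 2 * ‖u‖ ≤ _
  have h7 : |(k : ℝ)| * (|(k : ℝ)| * (B * ‖v‖)) ≤ |(k : ℝ)| * (|μ.re| / 2 * ‖u‖) := by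
    calc |(k : ℝ)| * (|(k : ℝ)| * (B * ‖v‖)) = B * ((k : ℝ) ^ 2 * ‖v‖) := by
          rw [← sq_abs]; ring
      _ ≤ B * (R ^ 2 * ‖u‖) := mul_le_mul_of_nonneg_left h2 hB0
      _ = 2 * (B * R ^ 2) * (‖u‖ / 2) := by ring
      _ ≤ |(k : ℝ)| * |μ.re| * (‖u‖ / 2) := by gcongr
      _ = _ := by ring
  have h8 := le_of_mul_le_mul_left h7 hk0
  linarith

/-- The inverses of Γ_k - μ are bounded by 2/|Re μ| for large |k|, and only finitely many remain; a
uniformly bounded family is a bounded diagonal operator, and it inverts Γ - μ componentwise. -/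
lemma notMem_graphSpectrum (hza : S.IsZonal a) (hzb : S.IsZonal b) {f w χ : E3 → ℝ} {Ω : ℝ}
    (hf : S.IsStreamRate f a) (hw : S.IsStreamRate (fun y => w y - Ω * χ y) b) {μ : ℂ}
    (hμ : μ.re ≠ 0) (h : ∀ k, μ ∉ spectrum ℂ (S.gammaK a b ha hb hza hzb k)) :
    μ ∉ graphSpectrum (S.gammaGraph f w χ Ω) := by
  choose T hT using fun k => exists_inverse_of_notMem_spectrum (h k)
  obtain ⟨B, hB⟩ := S.isCompact_carrier.exists_bound_of_continuousOn hb.continuousOn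
  obtain ⟨R, hR0, hR⟩ := S.exists_r_le
  have hμ0 : 0 < |μ.re| := abs_pos.2 hμ
  obtain ⟨N, hN⟩ := exists_nat_ge (2 * (B * R ^ 2) / |μ.re|)
  rw [div_le_iff₀ hμ0] at hN
  have hlarge : ∀ k : ℤ, N < |k| → ∀ y, ‖T k y‖ ≤ 2 / |μ.re| * ‖y‖ := by
    intro k hk y
    have hk' : (N : ℝ) ≤ |(k : ℝ)| := by exact_mod_cast hk.le
    have h1 := S.norm_gammaK_sub_smul_ge ha hb hza hzb hB hR (μ := μ) (k := k)
      (by rintro rfl; simp at hk; omega) (hN.trans (mul_le_mul_of_nonneg_right hk' hμ0.le)) (T k y)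
    rw [← (hT k (T k y) y).2 rfl, add_sub_cancel_right] at h1
    rw [div_mul_eq_mul_div, le_div_iff₀ hμ0]
    linarith
  choose M hM0 hM using fun k => exists_bound_clm (H := S.V k) (T k)
  -- A common bound: the uniform one for |k| > N plus the finitely many individual ones.
  set C : ℝ := 2 / |μ.re| + ∑ k ∈ Finset.Icc (-N : ℤ) N, M k with hC
  have hbound : ∀ k y, ‖T k y‖ ≤ C * ‖y‖ := by
    intro k y
    have hsum : 0 ≤ ∑ k ∈ Finset.Icc (-N : ℤ) N, M k :=
      Finset.sum_nonneg fun k _ => (hM0 k).le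
    rcases lt_or_ge (N : ℤ) |k| with hk | hk
    · exact (hlarge k hk y).trans (mul_le_mul_of_nonneg_right (by linarith) (norm_nonneg _))
    · refine (hM k y).trans (mul_le_mul_of_nonneg_right ?_ (norm_nonneg _))
      have hmem : k ∈ Finset.Icc (-N : ℤ) N := Finset.mem_Icc.2 (abs_le.1 hk)
      have h1 := Finset.single_le_sum (f := M) (fun k _ => (hM0 k).le) hmem
      have h2 : 0 < 2 / |μ.re| := by positivity
      linarith
  obtain ⟨Q, hQ⟩ := S.isHilbertSum_V.exists_diagonal T hbound
  have hQ' : ∀ g k, S.component k (Q g) = T k (S.component k g) := hQ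
  simp only [graphSpectrum, mem_ofPred_eq, not_not]
  refine ⟨Q, fun ζ g => ?_⟩
  rw [mem_gammaGraph_iff ha hb hf hw, S.transport_mem_weakX3_iff_component ha hb hza hzb]
  have hlin : ∀ k, S.component k (g + μ • ζ) = S.component k g + μ • S.component k ζ := fun k => by
    simp only [component, map_add, map_smul]
    rfl
  constructor
  · intro h1
    refine S.isHilbertSum_V.ext_component fun k => ?_
    change S.component k ζ = S.component k (Q g)
    rw [hQ', ← hT, ← hlin, h1]
  · rintro rfl k
    rw [hlin, hT, hQ']

/-- `Γ_k` is a compact perturbation of multiplication by `i k a`. -/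
lemma spectrum_gammaK (hza : S.IsZonal a) (hzb : S.IsZonal b) {A : Set ℝ} (hA : IsCompact A)
    (haA : ∀ x ∈ S.carrier, a x ∈ A) (k : ℤ) :
    ∃ Sk : Set ℂ, Sk.Countable ∧
      spectrum ℂ (S.gammaK a b ha hb hza hzb k) ⊆ ikSet k A ∪ Sk ∧
      (∀ μ, AccPt μ (Filter.principal Sk) → μ ∈ ikSet k A) ∧
      ∀ μ ∈ Sk, Module.End.HasEigenvalue
          (S.gammaK a b ha hb hza hzb k : Module.End ℂ (S.V k)) μ ∧
        FiniteDimensional ℂ (Module.End.maxGenEigenspace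
          (S.gammaK a b ha hb hza hzb k : Module.End ℂ (S.V k)) μ) := by
  have hq := S.quadBoundOff_zonalMul k ha hza hA haA
  have hK := S.isCompactOperator_gammaK_sub hb hzb k
  refine ⟨spectrum ℂ (S.gammaK a b ha hb hza hzb k) \ ikSet k A, hq.countable hK, ?_, ?_, ?_⟩
  · rw [union_sdiff_self]
    exact subset_union_right
  · intro μ hμ
    by_contra hcon
    exact hq.not_accPt hK hcon (fun l hl => hq.hasEigenvalue hK hl.2 hl.1) hμ
  · exact fun μ hμ => ⟨hq.hasEigenvalue hK hμ.2 hμ.1, hq.finiteDimensional_maxGenEigenspace hK hμ.2⟩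

lemma re_eq_zero_of_mem_ikSet {k : ℤ} {A : Set ℝ} {μ : ℂ} (h : μ ∈ ikSet k A) : μ.re = 0 := by
  obtain ⟨x, -, rfl⟩ := h
  simp

end SurfaceOfRevolution

end

theorem proposition4p2p1 (S : SurfaceOfRevolution) (Ω : ℝ)
    -- `χ = e₃ · ν` on `M`
    (χ : E3 → ℝ) (hχ_smooth : ContDiff ℝ ∞ χ) (hχ : ∀ x ∈ S.carrier, χ x = S.normal x 2)
    -- `J∇ξ = -X₃` on `M`, `α₀ = min ξ`, `α₁ = max ξ`
    (ξ : E3 → ℝ) (hξ_smooth : ContDiff ℝ ∞ ξ)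
    (hξ : ∀ x ∈ S.carrier, S.J x (S.grad ξ x) = -SurfaceOfRevolution.X3 x)
    (α₀ α₁ : ℝ) (hα₀ : IsLeast (ξ '' S.carrier) α₀) (hα₁ : IsGreatest (ξ '' S.carrier) α₁)
    -- the zonal stream function `f`, also written `f = f₁(ξ)`, and its vorticity `w = Δ f`
    (f : E3 → ℝ) (hf_smooth : ContDiff ℝ ∞ f)
    (hf_zonal : ∀ x ∈ S.carrier, fderiv ℝ f x (SurfaceOfRevolution.X3 x) = 0)
    (f₁ : ℝ → ℝ) (hf₁ : ∀ x ∈ S.carrier, f x = f₁ (ξ x))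
    (w : E3 → ℝ) (hw_smooth : ContDiff ℝ ∞ w) (hw : S.IsLaplacian f w) :
    -- `Γ` is single valued
    (∀ ζ g g', (ζ, g) ∈ S.gammaGraph f w χ Ω → (ζ, g') ∈ S.gammaGraph f w χ Ω → g = g') ∧
    -- and restricts to bounded operators `Γ_k` on the spaces `V_k`
    ∃ Γ : (k : ℤ) → (S.V k →L[ℂ] S.V k),
      (∀ k (ζ : S.V k) (g : S.L2b),
        ((ζ : S.L2b), g) ∈ S.gammaGraph f w χ Ω ↔ g = (Γ k ζ : S.L2b)) ∧
      (∀ k, ∃ Sk : Set ℂ, Sk.Countable ∧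
        spectrum ℂ (Γ k) ⊆ ikSet k (derivRange f₁ α₀ α₁) ∪ Sk ∧
        (∀ μ, AccPt μ (Filter.principal Sk) → μ ∈ ikSet k (derivRange f₁ α₀ α₁)) ∧
        ∀ μ ∈ Sk, Module.End.HasEigenvalue (Γ k : Module.End ℂ (S.V k)) μ ∧
          FiniteDimensional ℂ (Module.End.maxGenEigenspace (Γ k : Module.End ℂ (S.V k)) μ)) ∧
      ((∃ μ ∈ graphSpectrum (S.gammaGraph f w χ Ω), μ.re ≠ 0) →
        ∃ k μ, Module.End.HasEigenvalue (Γ k : Module.End ℂ (S.V k)) μ ∧ μ.re ≠ 0) := by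
  have hξ' : S.IsRotationPotential ξ := hξ
  have hα : ξ '' S.carrier = Icc α₀ α₁ := by
    have h := hξ'.image_carrier hξ_smooth
    rw [h] at hα₀ hα₁ ⊢
    have hle := nonempty_Icc.1 hα₀.nonempty
    rw [hα₀.unique (isLeast_Icc hle), hα₁.unique (isGreatest_Icc hle)]
  have hle : α₀ ≤ α₁ := hα₁.2 hα₀.1
  have hfz : S.IsZonal f := SurfaceOfRevolution.isZonal_of_fderiv hf_smooth fun s hs θ =>
    hf_zonal _ (SurfaceOfRevolution.param_mem_carrier (Ioo_subset_Icc_self hs) θ)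
  have hwz := SurfaceOfRevolution.isZonal_laplacian hfz hw
  have hχz := SurfaceOfRevolution.isZonal_normal hχ
  have hvz : S.IsZonal fun y => w y - Ω * χ y := fun s hs θ => by
    simp only
    rw [hwz s hs θ, hχz s hs θ]
  -- The absolute vorticity w - Ωχ is zonal too, so it is a function of ξ and its J-gradient is also
  -- a multiple of X₃.
  obtain ⟨h₁, hh₁⟩ := hξ'.exists_profile hξ_smooth hvz
  obtain ⟨a, ha, hza, haf, haA, hA⟩ := hξ'.exists_rate hξ_smooth hα hle hf_smooth hf₁
  obtain ⟨b, hb, hzb, hbw, -, -⟩ := hξ'.exists_rate hξ_smooth hα hle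
    (hw_smooth.sub (contDiff_const.mul hχ_smooth)) hh₁
  have hgraph := SurfaceOfRevolution.mem_gammaGraph_iff ha hb haf hbw
  refine ⟨fun ζ g g' hg hg' => ?_, S.gammaK a b ha hb hza hzb, fun k ζ g => ?_,
    S.spectrum_gammaK ha hb hza hzb hA haA, ?_⟩
  · rw [hgraph] at hg hg'
    exact Subtype.ext (SurfaceOfRevolution.weakX3_unique hg hg')
  · rw [hgraph]
    exact S.transport_mem_weakX3_iff ha hb hza hzb ζ g
  · rintro ⟨μ, hμ, hre⟩
    by_contra hcon
    push Not at hcon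
    -- If no Γ_k has an eigenvalue off the imaginary axis, then a μ with Re μ ≠ 0 lies neither in
    -- any ikΣ nor in any S_k, hence in no spectrum of a Γ_k.
    refine S.notMem_graphSpectrum ha hb hza hzb haf hbw hre (fun k hk => hre ?_) hμ
    obtain ⟨Sk, -, hsub, -, hSk⟩ := S.spectrum_gammaK ha hb hza hzb hA haA k
    rcases hsub hk with h | h
    · exact SurfaceOfRevolution.re_eq_zero_of_mem_ikSet h
    · exact hcon k μ (hSk μ h).1
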